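/- Let $N\ge 1$, $T>0$, and $a\in L^\infty((0,T)\times\mathbb R^N;\mathbb R^N)$. Assume that $a$ satisfies the one-sided Lipschitz condition: there is a nonnegative $\alpha\in L^1(0,T)$ with $$\langle a(t,y)-a(t,x),y-x\rangle\le\alpha(t)|y-x|^2\quad\text{for a.e. }(t,x,y)\in(0,T)\times\mathbb R^N\times\mathbb R^N,$$ or, instead, only that there exists a transport flow in the sense below. Definitions. For $p(t,\cdot):\mathbb R^N\to\mathbb R^N$ write $J(p)(t,x)=\det(\partial_{x_j}p_i(t,x))_{i,j}$. * $\mathcal W^T$ is the space of $\pi\in C([0,T],L^\infty_{loc}(\mathbb R^N)\text{-}w^*)$ that solve $\partial_t\pi+\operatorname{div}(a\pi)=0$ in $(0,T)\times\mathbb R^N$ in the sense of distributions. * $\mathcal E^T$ is the set of $p\in \mathrm{Lip}_{loc}([0,T]\times\mathbb R^N)$ with $\partial_tp+a\cdot\nabla p=0$ a.e. in $(0,T)\times\mathbb R^N$ and $p(T,\cdot)=0$; $V^T_e=\bigcup_{p\in\mathcal E^T}\{(t,x)\in(0,T)\times\mathbb R^N: p(t,x)\ne0\}$; and $\mathcal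 V^T$ is the set of $\pi\in\mathcal W^T$ with $\pi=0$ a.e. in $V^T_e$. * $\mathcal J^T$ (the Jacobian solutions) is the set of $J(p_1,\dots,p_N)$, where $p_i\in\mathrm{Lip}_{loc}([0,T]\times\mathbb R^N)$ solve $\partial_tp_i+a\cdot\nabla p_i=0$ a.e. in $(0,T)\times\mathbb R^N$; $\mathrm{Vect}(\mathcal J^T)$ is its linear span. * A transport flow is a (globally) Lipschitz map $X:[0,T]\times\mathbb R^N\to\mathbb R^N$ with $\partial_tX+a\cdot\nabla X=0$ a.e. in $(0,T)\times\mathbb R^N$, $X(T,x)=x$ for all $x$, and $J(X)\ge0$ a.e. * $\pi\in\mathcal W^T$ is reversible ($\pi\in\mathcal R^T$) if for some transport flow $X$ one has $\pi(t,x)=\pi(T,X(t,x))\,J(X)(t,x)$ for all $t\in[0,T]$ and a.e. $x\in\mathbb R^N$. Then: 1. Let $\pi\in\mathcal W^T$ be such that $\pi(T,\cdot)$ is (a.e. equal to) a finite linear combination of Jacobian determinants of locally Lipschitz maps $\mathbb R^N\to\mathbb R^N$. Then $\pi$ is reversible if and only if $\pi\in\mathrm{Vect}(\mathcal J^T)\cap\mathcal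 V^T$. 2. Let $\pi\in\mathrm{Vect}(\mathcal J^T)$. Then $\pi$ is reversible if and only if $|\pi|\in\mathcal W^T$. -/

import Mathlib

open MeasureTheory Set
open scoped ENNReal ContDiff

noncomputable section

namespace Transport

/-- The Euclidean space `ℝ^N`. -/
abbrev Space (N : ℕ) := EuclideanSpace ℝ (Fin N)

variable {N : ℕ}

/-- The open slab `(0,T) × ℝ^N`. -/
def openSlab (N : ℕ) (T : ℝ) : Set (ℝ × Space N) := Ioo 0 T ×ˢ univ

/-- The closed slab `[0,T] × ℝ^N`. -/
def closedSlab (N : ℕ) (T : ℝ) : Set (ℝ × Space N) := Icc 0 T ×ˢ univ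

/-- The one-sided Lipschitz condition: there is a nonnegative `α ∈ L¹(0,T)` such that
`⟨a(t,y) - a(t,x), y - x⟩ ≤ α(t) |y - x|²` for almost every `(t,x,y)` in `(0,T) × ℝ^N × ℝ^N`. -/
def OSLC (T : ℝ) (a : ℝ × Space N → Space N) : Prop :=
  ∃ α : ℝ → ℝ, IntegrableOn α (Ioo 0 T) ∧ (∀ᵐ t ∂volume.restrict (Ioo 0 T), 0 ≤ α t) ∧
    ∀ᵐ w : ℝ × Space N × Space N ∂volume.restrict (Ioo 0 T ×ˢ (univ ×ˢ univ)),
      inner ℝ (a (w.1, w.2.2) - a (w.1, w.2.1)) (w.2.2 - w.2.1) ≤ α w.1 * ‖w.2.2 - w.2.1‖ ^ 2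

/-- The transport operator `∂ₜp + a·∇p` at the point `z = (t,x)`: the derivative of `p` in the
space-time direction `(1, a(t,x))`. (A locally Lipschitz `p` is differentiable almost everywhere in
the open slab, by Rademacher's theorem.) -/
def transportOp {F : Type*} [NormedAddCommGroup F] [NormedSpace ℝ F]
    (a : ℝ × Space N → Space N) (p : ℝ × Space N → F) (z : ℝ × Space N) : F :=
  fderiv ℝ p z (1, a z)

/-- `∂ₜp + a·∇p = 0` almost everywhere in `(0,T) × ℝ^N`. For vector-valued `p` this is the
equation for every component. -/
def SolvesTransport {F : Type*} [NormedAddCommGroup F] [NormedSpace ℝ F]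
    (T : ℝ) (a : ℝ × Space N → Space N) (p : ℝ × Space N → F) : Prop :=
  ∀ᵐ z ∂volume.restrict (openSlab N T), transportOp a p z = 0

/-- The jacobian determinant of a map `ℝ^N → ℝ^N`. -/
def jac (f : Space N → Space N) (x : Space N) : ℝ := (fderiv ℝ f x).det

/-- The jacobian determinant `J(p)(t,x)` of `p(t,·)` at `x`, only in the space variables. -/
def spaceJac (p : ℝ × Space N → Space N) (t : ℝ) (x : Space N) : ℝ :=
  jac (fun y => p (t, y)) x

/-- `π` is (a representative, measurable in `(t,x)`, of) an element of
`C([0,T], L^∞_loc(ℝ^N) weak-*)`, where `L^∞_loc` is the dual of the compactly supported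
integrable functions. -/
structure WeakStarContinuous (T : ℝ) (π : ℝ → Space N → ℝ) : Prop where
  measurable : AEStronglyMeasurable (fun z : ℝ × Space N => π z.1 z.2)
    (volume.restrict (openSlab N T))
  locBounded : ∀ t ∈ Icc 0 T, ∀ K : Set (Space N), IsCompact K →
    MemLp (π t) ∞ (volume.restrict K)
  continuous : ∀ φ : Space N → ℝ, Integrable φ → HasCompactSupport φ →
    ContinuousOn (fun t => ∫ x, π t x * φ x) (Icc 0 T)

/-- `𝒲^T`: the weak solutions in `C([0,T], L^∞_loc(ℝ^N) weak-*)` of `∂ₜπ + div(aπ) = 0`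
in `(0,T) × ℝ^N`. -/
def weakSolutions (T : ℝ) (a : ℝ × Space N → Space N) : Set (ℝ → Space N → ℝ) :=
  {π | WeakStarContinuous T π ∧
    ∀ φ : ℝ × Space N → ℝ, ContDiff ℝ ∞ φ → HasCompactSupport φ → tsupport φ ⊆ openSlab N T →
      ∫ z in openSlab N T, π z.1 z.2 * transportOp a φ z = 0}

/-- `ℰ^T`: the exceptional solutions, i.e. the locally Lipschitz solutions of the transport equation
on `[0,T] × ℝ^N` that vanish at time `T`. -/
def exceptionalSolutions (T : ℝ) (a : ℝ × Space N → Space N) : Set (ℝ × Space N → ℝ) :=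
  {p | LocallyLipschitzOn (closedSlab N T) p ∧ SolvesTransport T a p ∧ ∀ x, p (T, x) = 0}

/-- `V_e^T`: the union of the open supports of the exceptional solutions. -/
def exceptionalSupport (T : ℝ) (a : ℝ × Space N → Space N) : Set (ℝ × Space N) :=
  ⋃ p ∈ exceptionalSolutions T a, {z ∈ openSlab N T | p z ≠ 0}

/-- `𝒱^T`: the weak solutions that vanish almost everywhere in `V_e^T`. -/
def vanishingSolutions (T : ℝ) (a : ℝ × Space N → Space N) : Set (ℝ → Space N → ℝ) :=
  {π | π ∈ weakSolutions T a ∧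
    ∀ᵐ z : ℝ × Space N, z ∈ exceptionalSupport T a → π z.1 z.2 = 0}

/-- `𝒥^T`: the jacobian solutions `π = J(p₁,…,p_N)`, where the `pᵢ` are locally Lipschitz on
`[0,T] × ℝ^N` and solve the transport equation. Equality is that of curves of classes of functions:
for every `t ∈ [0,T]` and almost every `x`; as everywhere, the representative `π` is measurable
in `(t,x)`. -/
def jacobianSolutions (T : ℝ) (a : ℝ × Space N → Space N) : Set (ℝ → Space N → ℝ) :=
  {π | AEStronglyMeasurable (fun z : ℝ × Space N => π z.1 z.2) (volume.restrict (openSlab N T)) ∧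
    ∃ p : ℝ × Space N → Space N, LocallyLipschitzOn (closedSlab N T) p ∧ SolvesTransport T a p ∧
      ∀ t ∈ Icc 0 T, π t =ᵐ[volume] spaceJac p t}

/-- `X` is a transport flow: it is globally Lipschitz on `[0,T] × ℝ^N`, solves the transport
equation, equals the identity at time `T`, and has a nonnegative jacobian. -/
structure IsTransportFlow (T : ℝ) (a : ℝ × Space N → Space N) (X : ℝ × Space N → Space N) :
    Prop where
  lipschitz : ∃ C, LipschitzOnWith C X (closedSlab N T)
  solves : SolvesTransport T a X
  final : ∀ x, X (T, x) = x
  jac_nonneg : ∀ᵐ z ∂volume.restrict (openSlab N T), 0 ≤ spaceJac X z.1 z.2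

/-- `ℛ^T`: the reversible solutions, i.e. the weak solutions such that, for some transport flow `X`,
`π(t,x) = π(T,X(t,x)) J(X)(t,x)` for all `t ∈ [0,T]` and almost every `x`. -/
def reversibleSolutions (T : ℝ) (a : ℝ × Space N → Space N) : Set (ℝ → Space N → ℝ) :=
  {π | π ∈ weakSolutions T a ∧ ∃ X, IsTransportFlow T a X ∧
    ∀ t ∈ Icc 0 T, ∀ᵐ x, π t x = π T (X (t, x)) * spaceJac X t x}

/-- `g` coincides almost everywhere with a linear combination of jacobians of locally Lipschitz
maps `ℝ^N → ℝ^N`. -/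
def IsJacobianCombination (g : Space N → ℝ) : Prop :=
  ∃ h ∈ Submodule.span ℝ {h : Space N → ℝ | ∃ f : Space N → Space N, LocallyLipschitz f ∧ h = jac f},
    g =ᵐ[volume] h

end Transport

end

open scoped NNReal Topology Pointwise

set_option linter.unusedSectionVars false

noncomputable section

namespace Transport

/-! ### Locally Lipschitz functions, Rademacher's theorem and cutoffs -/

section LocallyLipschitz

variable {V W F : Type*} [NormedAddCommGroup V] [NormedSpace ℝ V] [FiniteDimensional ℝ V]
  [NormedAddCommGroup W] [NormedSpace ℝ W]
  [NormedAddCommGroup F] [NormedSpace ℝ F] [FiniteDimensional ℝ F]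

/-! Everything rests on a single transport flow X, given by hypothesis or built from the one-sided
Lipschitz condition, and on three facts about Jacobians.

First, J(p) solves the continuity equation whenever p solves the transport equation. Indeed J(p)(∂ₜφ
+ a·∇φ) is the space-time determinant of (φ, p₁, …, p_N) (`detGrad_spaceTime`), and the integral of
such a determinant vanishes when φ has compact support (`integral_detGrad_eq_zero`). The resulting
integration by parts also shows that Jacobians, tested against a fixed function, depend continuously
on the map in the uniform distance once the derivatives are bounded; hence the weak-* continuity in
time.

Second, a nonnegative weak solution vanishes a.e. on V_e (`ae_eq_zero_on_exceptionalSupport`). An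
exceptional p is constant along the field and is 0 at time T. So (|p| - δ)₊, multiplied by (t - δ)₊
and by a cone that opens at least as fast as |a|, is an admissible test function with nonnegative
transport derivative, positive where p is large enough. This applies to J(X), and to |π| when |π| is
a weak solution.

Third, X(t,·) carries the measure J(X)(t,x)dx to Lebesgue measure
(`IsExtendedFlow.map_withDensity_jac`). So J(X) vanishes a.e. on preimages of null sets. This yields
the chain rule J(f∘X) = J(f)(X) J(X) for Lipschitz f, and, by approximation in L¹, it makes g(X)
J(X) a weak solution for every locally bounded g.

Now let p solve the transport equation. Then p and p(T, X) are solutions with the same final value,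
so they differ by an exceptional solution and coincide off V_e. There the chain rule gives J(p) =
J(p)(T, X) J(X), and by linearity every π in Vect(𝒥ᵀ) satisfies π = π(T, X) J(X) off V_e. If π
vanishes on V_e, as J(X) does, the formula holds a.e., and then at every time by weak-* continuity.
In the first equivalence this vanishing is assumed; in the second it is the second fact applied to
|π|. Conversely, a reversible π vanishes on V_e together with J(X); it equals Σ cᵢ J(fᵢ∘X) if π(T) =
Σ cᵢ J(fᵢ); and |π| = |π(T)|(X) J(X) is again a weak solution.

To build the flow, the field is mollified and the explicit Euler scheme is run up to time T. The
one-sided condition bounds the Lipschitz constants through ∫α and the bound of |a| alone. By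
Arzelà–Ascoli there is a limit map, and both the equation and the sign of the Jacobian survive,
since each is stable under weak convergence. -/

lemma locallyLipschitz_mul {α : Type*} [PseudoEMetricSpace α] {f g : α → ℝ}
    (hf : LocallyLipschitz f) (hg : LocallyLipschitz g) : LocallyLipschitz fun x => f x * g x :=
  (contDiff_mul (𝕜 := ℝ) (𝔸 := ℝ) (n := 1)).locallyLipschitz.comp (hf.prodMk hg)

lemma locallyLipschitz_add {α : Type*} [PseudoEMetricSpace α] {f g : α → F}
    (hf : LocallyLipschitz f) (hg : LocallyLipschitz g) : LocallyLipschitz fun x => f x + g x :=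
  (contDiff_add (𝕜 := ℝ) (F := F) (n := 1)).locallyLipschitz.comp (hf.prodMk hg)

lemma locallyLipschitz_sub {α : Type*} [PseudoEMetricSpace α] {f g : α → F}
    (hf : LocallyLipschitz f) (hg : LocallyLipschitz g) : LocallyLipschitz fun x => f x - g x :=
  (contDiff_fst.sub contDiff_snd : ContDiff ℝ 1 (fun p : F × F => p.1 - p.2)).locallyLipschitz.comp
    (hf.prodMk hg)

lemma locallyLipschitz_clm_comp {α : Type*} [PseudoEMetricSpace α] {f : α → W}
    (A : W →L[ℝ] F) (hf : LocallyLipschitz f) : LocallyLipschitz fun x => A (f x) :=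
  A.lipschitz.locallyLipschitz.comp hf

/-- Local Lipschitz bounds become uniform on a compact ball, and Lipschitz maps with
finite-dimensional values extend. This reduces Rademacher's theorem and derivative bounds to the
globally Lipschitz case. -/
lemma exists_lipschitzWith_eqOn_closedBall {f : V → F} (hf : LocallyLipschitz f) (R : ℝ) :
    ∃ (C : ℝ≥0) (g : V → F), LipschitzWith C g ∧ EqOn f g (Metric.closedBall 0 R) := by
  have : ProperSpace V := FiniteDimensional.proper ℝ V
  obtain ⟨K, hK⟩ := (hf.locallyLipschitzOn (s := Metric.closedBall 0 R)).exists_lipschitzOnWith_of_compact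
    (isCompact_closedBall 0 R)
  obtain ⟨g, hg, hfg⟩ := hK.extend_finite_dimension
  exact ⟨_, g, hg, hfg⟩

lemma exists_lipschitzWith_eventuallyEq {f : V → F} (hf : LocallyLipschitz f) (R : ℝ) :
    ∃ (C : ℝ≥0) (g : V → F), LipschitzWith C g ∧ ∀ x ∈ Metric.ball 0 R, f =ᶠ[𝓝 x] g := by
  obtain ⟨C, g, hg, hfg⟩ := exists_lipschitzWith_eqOn_closedBall hf R
  exact ⟨C, g, hg, fun x hx => Filter.eventuallyEq_of_mem (Metric.isOpen_ball.mem_nhds hx)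
    (hfg.mono Metric.ball_subset_closedBall)⟩

lemma ae_differentiableAt_of_locallyLipschitz [MeasurableSpace V] [BorelSpace V] {μ : Measure V}
    [μ.IsAddHaarMeasure] {f : V → F} (hf : LocallyLipschitz f) :
    ∀ᵐ x ∂μ, DifferentiableAt ℝ f x := by
  have h : ∀ n : ℕ, ∀ᵐ x ∂μ, x ∈ Metric.ball (0 : V) n → DifferentiableAt ℝ f x := by
    intro n
    obtain ⟨C, g, hg, hfg⟩ := exists_lipschitzWith_eventuallyEq hf n
    filter_upwards [hg.ae_differentiableAt (μ := μ)] with x hx hxn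
    exact hx.congr_of_eventuallyEq (hfg x hxn)
  filter_upwards [ae_all_iff.2 h] with x hx
  obtain ⟨n, hn⟩ := exists_nat_gt ‖x‖
  exact hx n (by simpa using hn)

lemma exists_norm_fderiv_le_of_locallyLipschitz {f : V → F} (hf : LocallyLipschitz f) (R : ℝ) :
    ∃ C : ℝ, 0 ≤ C ∧ ∀ x ∈ Metric.ball (0 : V) R, ‖fderiv ℝ f x‖ ≤ C := by
  obtain ⟨C, g, hg, hfg⟩ := exists_lipschitzWith_eventuallyEq hf R
  refine ⟨C, C.2, fun x hx => ?_⟩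
  rw [(hfg x hx).fderiv_eq]
  exact norm_fderiv_le_of_lipschitz ℝ hg

lemma norm_fderiv_le_of_lipschitzOnWith_ball {f : V → F} {C : ℝ≥0} {R : ℝ}
    (hf : LipschitzOnWith C f (Metric.ball 0 R)) {x : V} (hx : x ∈ Metric.ball (0 : V) R) :
    ‖fderiv ℝ f x‖ ≤ C :=
  norm_fderiv_le_of_lipschitzOn ℝ (Metric.isOpen_ball.mem_nhds hx) hf

lemma exists_norm_le_of_continuous {f : V → F} (hf : Continuous f) (R : ℝ) :
    ∃ C : ℝ, 0 ≤ C ∧ ∀ x ∈ Metric.closedBall (0 : V) R, ‖f x‖ ≤ C := by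
  have : ProperSpace V := FiniteDimensional.proper ℝ V
  obtain ⟨C, hC⟩ := (isCompact_closedBall (0 : V) R).exists_bound_of_continuousOn hf.continuousOn
  exact ⟨max C 0, le_max_right _ _, fun x hx => (hC x hx).trans (le_max_left _ _)⟩

lemma exists_tsupport_subset_ball {α : Type*} [Zero α] {f : V → α} (hf : HasCompactSupport f) :
    ∃ R : ℝ, 0 < R ∧ tsupport f ⊆ Metric.ball 0 R := by
  obtain ⟨R, hR, h⟩ := hf.isCompact.isBounded.subset_ball_lt 0 0
  exact ⟨R, hR, h⟩

lemma exists_cutoff (V : Type*) [NormedAddCommGroup V] [NormedSpace ℝ V] [FiniteDimensional ℝ V]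
    (R : ℝ) : ∃ χ : V → ℝ, ContDiff ℝ ∞ χ ∧ HasCompactSupport χ ∧ (∀ x, 0 ≤ χ x) ∧
      (∀ x, χ x ≤ 1) ∧ ∀ x ∈ Metric.closedBall (0 : V) R, χ x = 1 := by
  let B : ContDiffBump (0 : V) := ⟨|R| + 1, |R| + 2, by positivity, by linarith⟩
  exact ⟨B, B.contDiff, B.hasCompactSupport, fun x => B.nonneg, fun x => B.le_one,
    fun x hx => B.one_of_mem_closedBall (Metric.closedBall_subset_closedBall
      (by have := le_abs_self R; show R ≤ |R| + 1; linarith) hx)⟩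

lemma integrable_mul_of_hasCompactSupport [MeasurableSpace V] [BorelSpace V] {μ : Measure V}
    [IsFiniteMeasureOnCompacts μ] {g h : V → ℝ} (hg : AEStronglyMeasurable g μ)
    (hb : ∀ R : ℝ, ∃ C : ℝ, ∀ᵐ x ∂μ, x ∈ Metric.ball (0 : V) R → |g x| ≤ C)
    (hh : Continuous h) (hc : HasCompactSupport h) : Integrable (fun x => g x * h x) μ := by
  obtain ⟨R, hR, hs⟩ := exists_tsupport_subset_ball hc
  obtain ⟨C, hC⟩ := hb R
  refine ((hh.integrable_of_hasCompactSupport hc).norm.const_mul C).mono'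
    (hg.mul hh.aestronglyMeasurable) ?_
  filter_upwards [hC] with x hx
  by_cases h0 : h x = 0
  · simp [h0]
  · rw [norm_mul]
    exact mul_le_mul_of_nonneg_right (hx (hs (subset_tsupport _ h0))) (norm_nonneg _)

end LocallyLipschitz

/-! ### The determinant as a combination of determinants of large perturbed dilations -/

section NullLagrangian

variable {V : Type*} [NormedAddCommGroup V] [NormedSpace ℝ V] [FiniteDimensional ℝ V]

/-- Evaluation at zero of the characteristic polynomial is a combination of its values at any
prescribed large nodes. -/
lemma exists_det_eq_sum (V : Type*) [NormedAddCommGroup V] [NormedSpace ℝ V]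
    [FiniteDimensional ℝ V] (c : ℝ) :
    ∃ (s : Finset ℕ) (w : ℕ → ℝ), ∀ A : V →L[ℝ] V,
      A.det = ∑ i ∈ s, w i * ((c + i) • ContinuousLinearMap.id ℝ V + A).det := by
  set n := Module.finrank ℝ V
  -- The characteristic polynomial of `-A` has degree `n`, so `n + 1` nodes determine it. The
  -- weights are the Lagrange basis polynomials at 0, and do not depend on `A`.
  refine ⟨Finset.range (n + 1), fun i =>
    (Lagrange.basis (Finset.range (n + 1)) (fun i : ℕ => c + i) i).eval 0, fun A => ?_⟩
  have hinj : Set.InjOn (fun i : ℕ => c + (i : ℝ)) (Finset.range (n + 1)) := by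
    intro i _ j _ h
    simpa using h
  have key : ∀ t : ℝ, (LinearMap.charpoly (-(A : V →ₗ[ℝ] V))).eval t =
      (t • ContinuousLinearMap.id ℝ V + A).det := by
    intro t
    rw [LinearMap.eval_charpoly]
    simp only [ContinuousLinearMap.det]
    congr 1
    ext x
    simp [sub_neg_eq_add, Algebra.algebraMap_eq_smul_one]
  have hdeg : (LinearMap.charpoly (-(A : V →ₗ[ℝ] V))).degree < (Finset.range (n + 1)).card := by
    rw [Polynomial.degree_eq_natDegree (LinearMap.charpoly_monic _).ne_zero,
      LinearMap.charpoly_natDegree]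
    simp [n]
    exact_mod_cast Nat.lt_succ_self _
  have h0 := key 0
  rw [Lagrange.eq_interpolate hinj hdeg, Lagrange.interpolate_apply,
    Polynomial.eval_finsetSum] at h0
  simp only [zero_smul, zero_add] at h0
  rw [← h0]
  refine Finset.sum_congr rfl fun i _ => ?_
  rw [Polynomial.eval_mul, Polynomial.eval_C, key, mul_comm]

end NullLagrangian

/-! ### The integral of the Jacobian of a compactly supported Lipschitz map -/

section NullLagrangian

variable {V : Type*} [NormedAddCommGroup V] [NormedSpace ℝ V] [FiniteDimensional ℝ V]

/-- The path s ↦ det(t·id + sA) starts at a positive value. If it ended below 0 it would vanish for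
some s in [0,1], and a kernel vector v would give t‖v‖ = s‖Av‖ ≤ ‖A‖‖v‖. -/
lemma det_smul_id_add_nonneg {t : ℝ} {A : V →L[ℝ] V} (hA : ‖A‖ < t) :
    0 ≤ (t • ContinuousLinearMap.id ℝ V + A).det := by
  by_contra! hneg
  have ht : 0 < t := (norm_nonneg _).trans_lt hA
  have hcont : ContinuousOn (fun s : ℝ => (t • ContinuousLinearMap.id ℝ V + s • A).det) (Icc 0 1) :=
    (ContinuousLinearMap.continuous_det.comp (by fun_prop)).continuousOn
  have h0 : 0 ≤ (t • ContinuousLinearMap.id ℝ V + (0 : ℝ) • A).det := by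
    have : (t • ContinuousLinearMap.id ℝ V + (0 : ℝ) • A).det = t ^ Module.finrank ℝ V := by
      simp [ContinuousLinearMap.det]
    rw [this]; positivity
  obtain ⟨s, hs, hs0⟩ := intermediate_value_Icc' zero_le_one hcont
    (show (0 : ℝ) ∈ _ from ⟨by simpa using hneg.le, h0⟩)
  obtain ⟨v, hv, hv0⟩ := Submodule.exists_mem_ne_zero_of_ne_bot
    (LinearMap.bot_lt_ker_of_det_eq_zero hs0).ne'
  have hv' : t • v + s • A v = 0 := by simpa using hv
  have h1 : t * ‖v‖ = s * ‖A v‖ := by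
    have := congrArg norm (eq_neg_of_add_eq_zero_left hv')
    rwa [norm_neg, norm_smul, norm_smul, Real.norm_of_nonneg ht.le,
      Real.norm_of_nonneg hs.1] at this
  have h2 : s * ‖A v‖ ≤ ‖A‖ * ‖v‖ := by
    calc s * ‖A v‖ ≤ 1 * ‖A v‖ := by gcongr; exact hs.2
      _ ≤ _ := by rw [one_mul]; exact A.le_opNorm v
  have h3 : ‖A‖ * ‖v‖ < t * ‖v‖ := mul_lt_mul_of_pos_right hA (norm_pos_iff.2 hv0)
  linarith

variable [MeasurableSpace V] [BorelSpace V] {μ : Measure V} [μ.IsAddHaarMeasure]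

/-- Lipschitz maps preserve null sets of the Hausdorff measure of full dimension, which has the same
null sets as `μ`. -/
lemma addHaar_image_eq_zero_of_lipschitzWith {C : ℝ≥0} {f : V → V} (hf : LipschitzWith C f)
    {s : Set V} (hs : μ s = 0) : μ (f '' s) = 0 := by
  have h1 : μH[Module.finrank ℝ V] s = 0 :=
    Measure.absolutelyContinuous_isAddHaarMeasure (μH[Module.finrank ℝ V]) μ hs
  have h2 : μH[Module.finrank ℝ V] (f '' s) = 0 := by
    refine le_antisymm ((hf.hausdorffMeasure_image_le (by positivity) s).trans ?_) zero_le
    rw [h1, mul_zero]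
  exact Measure.absolutelyContinuous_isAddHaarMeasure μ (μH[Module.finrank ℝ V]) h2

/-- A Lipschitz map that agrees with the dilation by `t` off a ball covers the dilated ball
exactly once if its Lipschitz deviation from the dilation is less than `t`. -/
lemma integral_det_smul_id_add_fderiv {C : ℝ≥0} {H : V → V} (hH : LipschitzWith C H)
    {R : ℝ} (hR : tsupport H ⊆ Metric.closedBall 0 R) {t : ℝ} (ht : C < t) :
    IntegrableOn (fun x => (t • ContinuousLinearMap.id ℝ V + fderiv ℝ H x).det)
      (Metric.closedBall 0 R) μ ∧
    ∫ x in Metric.closedBall 0 R, (t • ContinuousLinearMap.id ℝ V + fderiv ℝ H x).det ∂μ =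
      t ^ Module.finrank ℝ V * μ.real (Metric.closedBall 0 R) := by
  have : ProperSpace V := FiniteDimensional.proper ℝ V
  set B := Metric.closedBall (0 : V) R
  have ht0 : 0 < t := C.2.trans_lt ht
  have htne : t ≠ 0 := ht0.ne'
  let G : V → V := fun x => t • x + H x
  have hinj : Function.Injective G := by
    intro x y hxy
    by_contra hne
    have h1 : t • (x - y) = H y - H x := by
      have h : t • x + H x = t • y + H y := hxy
      rw [smul_sub, sub_eq_sub_iff_add_eq_add, h, add_comm]
    have h2 : t * ‖x - y‖ ≤ C * ‖x - y‖ := by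
      calc t * ‖x - y‖ = ‖H y - H x‖ := by rw [← h1, norm_smul, Real.norm_of_nonneg ht0.le]
        _ ≤ C * ‖y - x‖ := by simpa [dist_eq_norm] using hH.dist_le_mul y x
        _ = C * ‖x - y‖ := by rw [norm_sub_rev]
    have h3 : 0 < ‖x - y‖ := norm_pos_iff.2 (sub_ne_zero.2 hne)
    nlinarith
  -- Solving t x + H x = y amounts to finding a fixed point of x ↦ t⁻¹(y - H x), a contraction
  -- because `C < t`.
  have hsurj : Function.Surjective G := by
    intro y
    let K : V → V := fun x => t⁻¹ • (y - H x)
    have hK : ContractingWith (Real.toNNReal (C / t)) K := by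
      refine ⟨?_, LipschitzWith.of_dist_le_mul fun a b => ?_⟩
      · rw [← Real.toNNReal_one, Real.toNNReal_lt_toNNReal_iff one_pos]
        exact (div_lt_one ht0).2 ht
      · rw [Real.coe_toNNReal _ (div_nonneg C.coe_nonneg ht0.le), dist_eq_norm]
        have : K a - K b = t⁻¹ • (H b - H a) := by simp only [K]; rw [← smul_sub]; congr 1; abel
        rw [this, norm_smul, Real.norm_of_nonneg (inv_nonneg.2 ht0.le), div_eq_inv_mul, mul_assoc]
        gcongr
        rw [dist_comm a b, ← dist_eq_norm]
        exact hH.dist_le_mul b a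
    refine ⟨ContractingWith.fixedPoint K hK, ?_⟩
    have h := hK.fixedPoint_isFixedPt
    set x := ContractingWith.fixedPoint K hK
    have h' : t⁻¹ • (y - H x) = x := h
    show t • x + H x = y
    nth_rw 1 [← h']
    rw [smul_smul, mul_inv_cancel₀ htne, one_smul, sub_add_cancel]
  have hHout : ∀ x ∉ B, H x = 0 := fun x hx => image_eq_zero_of_notMem_tsupport fun h => hx (hR h)
  -- `G` and the dilation are bijections that agree off `B`, so they have the same image of the
  -- complement, hence of `B`.
  have himage : G '' B = t • B := by
    have hcompl : G '' Bᶜ = t • Bᶜ := by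
      rw [← image_smul]
      exact image_congr fun x hx => by simp [G, hHout x hx]
    have h := image_compl_eq (s := B) ⟨hinj, hsurj⟩
    rw [hcompl, ← image_smul, image_compl_eq (MulAction.bijective₀ htne)] at h
    exact (compl_injective h).symm
  let D := {x | DifferentiableAt ℝ H x}
  have hD : MeasurableSet D := measurableSet_of_differentiableAt ℝ H
  have hDnull : μ Dᶜ = 0 := hH.ae_differentiableAt
  have hGL : LipschitzWith (Real.toNNReal t + C) G :=
    LipschitzWith.of_dist_le_mul fun a b => by
      rw [NNReal.coe_add, Real.coe_toNNReal _ ht0.le, add_mul]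
      calc dist (G a) (G b) ≤ dist (t • a) (t • b) + dist (H a) (H b) := dist_add_add_le _ _ _ _
        _ ≤ _ := by
          rw [dist_smul₀, Real.norm_of_nonneg ht0.le]
          gcongr
          exact hH.dist_le_mul a b
  have hmeas : MeasurableSet (B ∩ D) := Metric.isClosed_closedBall.measurableSet.inter hD
  have hder : ∀ x ∈ B ∩ D, HasFDerivWithinAt G (t • ContinuousLinearMap.id ℝ V + fderiv ℝ H x)
      (B ∩ D) x := fun x hx =>
    (((hasFDerivAt_id x).const_smul t).add hx.2.hasFDerivAt).hasFDerivWithinAt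
  have harea := lintegral_abs_det_fderiv_eq_addHaar_image μ hmeas hder hinj.injOn
  have hae : B =ᵐ[μ] (B ∩ D : Set V) := by
    have : ∀ᵐ x ∂μ, x ∈ D := hDnull
    filter_upwards [this] with x hx
    exact propext ⟨fun h => ⟨h, hx⟩, fun h => h.1⟩
  -- The area formula needs differentiability. The discarded set is null and so is its image under
  -- the Lipschitz map `G`.
  have himageμ : μ (G '' (B ∩ D)) = μ (G '' B) := by
    refine le_antisymm (measure_mono (image_mono inter_subset_left)) ?_
    have hsub : G '' B ⊆ G '' (B ∩ D) ∪ G '' Dᶜ := by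
      rw [← image_union]
      exact image_mono fun x hx => (em (x ∈ D)).imp (fun h => ⟨hx, h⟩) id
    calc μ (G '' B) ≤ μ (G '' (B ∩ D)) + μ (G '' Dᶜ) :=
      (measure_mono hsub).trans (measure_union_le _ _)
      _ = _ := by rw [addHaar_image_eq_zero_of_lipschitzWith hGL hDnull, add_zero]
  rw [himageμ, himage, Measure.addHaar_smul, ← setLIntegral_congr hae] at harea
  have hnn : ∀ x, 0 ≤ (t • ContinuousLinearMap.id ℝ V + fderiv ℝ H x).det := fun x =>
    det_smul_id_add_nonneg ((norm_fderiv_le_of_lipschitz ℝ hH).trans_lt ht)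
  simp only [abs_of_nonneg (hnn _)] at harea
  have hmeasdet : Measurable fun x => (t • ContinuousLinearMap.id ℝ V + fderiv ℝ H x).det :=
    ContinuousLinearMap.continuous_det.measurable.comp ((measurable_fderiv ℝ H).const_add _)
  have hfin : μ B ≠ ⊤ := measure_closedBall_lt_top.ne
  refine ⟨?_, ?_⟩
  · rw [IntegrableOn, ← lintegral_ofReal_ne_top_iff_integrable hmeasdet.aestronglyMeasurable
      (Filter.Eventually.of_forall hnn), harea]
    exact ENNReal.mul_ne_top ENNReal.ofReal_ne_top hfin
  · rw [integral_eq_lintegral_of_nonneg_ae (Filter.Eventually.of_forall hnn)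
      hmeasdet.aestronglyMeasurable, harea, ENNReal.toReal_mul,
        ENNReal.toReal_ofReal (abs_nonneg _),
      abs_of_nonneg (by positivity)]
    rfl

/-- The integral over the ball of det(t·id + DH) is the same as for H = 0 as soon as t exceeds the
Lipschitz constant. Since det DH is a fixed combination of such determinants, its integral is that
of det 0, which is 0 in positive dimension. -/
theorem integral_det_fderiv_eq_zero [Nontrivial V] {C : ℝ≥0} {H : V → V} (hH : LipschitzWith C H)
    (hc : HasCompactSupport H) : ∫ x, (fderiv ℝ H x).det ∂μ = 0 := by
  obtain ⟨R, hR, hs⟩ := exists_tsupport_subset_ball hc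
  have hs' : tsupport H ⊆ Metric.closedBall 0 R := hs.trans Metric.ball_subset_closedBall
  have hz : (0 : V →L[ℝ] V).det = 0 := by
    simp [ContinuousLinearMap.det]
  have hset : ∫ x, (fderiv ℝ H x).det ∂μ = ∫ x in Metric.closedBall 0 R, (fderiv ℝ H x).det ∂μ := by
    refine (setIntegral_eq_integral_of_forall_compl_eq_zero fun x hx => ?_).symm
    have : fderiv ℝ H x = 0 := by
      by_contra h
      exact hx (hs' (support_fderiv_subset ℝ h))
    rw [this, hz]
  obtain ⟨s, w, hw⟩ := exists_det_eq_sum V ((C : ℝ) + 1)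
  have hC : ∀ i : ℕ, (C : ℝ) < C + 1 + i := fun i => by have := i.cast_nonneg (α := ℝ); linarith
  rw [hset, setIntegral_congr_fun Metric.isClosed_closedBall.measurableSet fun x _ => hw _,
    integral_finsetSum _ fun i _ => ((integral_det_smul_id_add_fderiv hH hs' (hC i)).1.const_mul _)]
  simp_rw [integral_const_mul, (integral_det_smul_id_add_fderiv hH hs' (hC _)).2, ← mul_assoc]
  rw [← Finset.sum_mul]
  have h0 := hw 0
  rw [hz] at h0
  have : ∀ i : ℕ, (((C : ℝ) + 1 + i) • ContinuousLinearMap.id ℝ V + 0).det =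
      ((C : ℝ) + 1 + i) ^ Module.finrank ℝ V := fun i => by simp [ContinuousLinearMap.det]
  simp only [this] at h0
  rw [← h0, zero_mul]

end NullLagrangian

/-! ### Determinants of gradients: integration by parts and weak continuity -/

section DetGrad

variable {V : Type*} [NormedAddCommGroup V] [NormedSpace ℝ V] [FiniteDimensional ℝ V]
  {ι : Type*} [Fintype ι] [DecidableEq ι]

/-- The determinant of the matrix of partial derivatives, in a basis, of a family of scalar
functions. -/
def detGrad (b : Module.Basis ι ℝ V) (u : ι → V → ℝ) (x : V) : ℝ :=
  (Matrix.of fun i j => fderiv ℝ (u i) x (b j)).det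

variable (b : Module.Basis ι ℝ V)

lemma detGrad_eq_det_fderiv {f : V → V} {x : V} (hf : DifferentiableAt ℝ f x) :
    detGrad b (fun i y => b.coord i (f y)) x = (fderiv ℝ f x).det := by
  rw [ContinuousLinearMap.det, ← LinearMap.det_toMatrix b, detGrad]
  congr 1
  ext i j
  have h := ((b.coord i).toContinuousLinearMap.hasFDerivAt.comp x hf.hasFDerivAt).fderiv
  have h' : fderiv ℝ (fun y => b.coord i (f y)) x =
      (b.coord i).toContinuousLinearMap.comp (fderiv ℝ f x) := h
  rw [Matrix.of_apply, h', LinearMap.toMatrix_apply]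
  rfl

lemma detGrad_congr {u v : ι → V → ℝ} {x : V} (h : ∀ i, fderiv ℝ (u i) x = fderiv ℝ (v i) x) :
    detGrad b u x = detGrad b v x := by
  simp only [detGrad, h]

lemma detGrad_eq_zero {u : ι → V → ℝ} {x : V} {i : ι} (h : fderiv ℝ (u i) x = 0) :
    detGrad b u x = 0 :=
  Matrix.det_eq_zero_of_row_eq_zero i fun j => by simp [h]

lemma detGrad_update (u : ι → V → ℝ) (i : ι) (w : V → ℝ) (x : V) :
    detGrad b (Function.update u i w) x =
      ((Matrix.of fun i j => fderiv ℝ (u i) x (b j)).updateRow i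
        fun j => fderiv ℝ w x (b j)).det := by
  rw [detGrad]
  congr 1
  ext k j
  by_cases hk : k = i
  · subst hk; simp
  · simp [Matrix.updateRow_ne hk, Function.update_of_ne hk]

lemma detGrad_update_sub (u : ι → V → ℝ) (i : ι) {w w' : V → ℝ} {x : V}
    (hw : DifferentiableAt ℝ w x) (hw' : DifferentiableAt ℝ w' x) :
    detGrad b (Function.update u i fun y => w y - w' y) x =
      detGrad b (Function.update u i w) x - detGrad b (Function.update u i w') x := by
  have h : fderiv ℝ (fun y => w y - w' y) x = fderiv ℝ w x - fderiv ℝ w' x := fderiv_fun_sub hw hw'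
  have e : (fun j => fderiv ℝ (fun y => w y - w' y) x (b j)) =
      (fun j => fderiv ℝ w x (b j)) + (-1 : ℝ) • fun j => fderiv ℝ w' x (b j) := by
    ext j; simp [h, ← sub_eq_add_neg]
  rw [detGrad_update, detGrad_update, detGrad_update, e, Matrix.det_updateRow_add,
    Matrix.det_updateRow_smul]
  ring

lemma detGrad_update_mul (u : ι → V → ℝ) (i : ι) {w w' : V → ℝ} {x : V}
    (hw : DifferentiableAt ℝ w x) (hw' : DifferentiableAt ℝ w' x) :
    detGrad b (Function.update u i fun y => w y * w' y) x =
      w x * detGrad b (Function.update u i w') x + w' x * detGrad b (Function.update u i w) x := by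
  have h : fderiv ℝ (fun y => w y * w' y) x = w x • fderiv ℝ w' x + w' x • fderiv ℝ w x :=
    fderiv_fun_mul hw hw'
  have e : (fun j => fderiv ℝ (fun y => w y * w' y) x (b j)) =
      (w x • fun j => fderiv ℝ w' x (b j)) + w' x • fun j => fderiv ℝ w x (b j) := by
    ext j; simp [h]
  rw [detGrad_update, detGrad_update, detGrad_update, e, Matrix.det_updateRow_add,
    Matrix.det_updateRow_smul, Matrix.det_updateRow_smul]

lemma exists_abs_detGrad_le (L : ℝ) : ∃ C : ℝ, 0 ≤ C ∧ ∀ (u : ι → V → ℝ) (x : V),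
    (∀ i, ‖fderiv ℝ (u i) x‖ ≤ L) → |detGrad b u x| ≤ C := by
  obtain ⟨β, hβ⟩ := Finite.exists_le fun j => ‖b j‖
  set K := |L| * |β|
  refine ⟨(Fintype.card ι).factorial * K ^ Fintype.card ι, by positivity, fun u x hu => ?_⟩
  have := Matrix.det_le (A := Matrix.of fun i j => fderiv ℝ (u i) x (b j))
    (abv := IsAbsoluteValue.toAbsoluteValue (abs : ℝ → ℝ)) (x := K) fun i j => by
      show |fderiv ℝ (u i) x (b j)| ≤ _
      refine ((fderiv ℝ (u i) x).le_opNorm (b j)).trans ?_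
      exact mul_le_mul ((hu i).trans (le_abs_self _)) ((hβ j).trans (le_abs_self _))
        (norm_nonneg _) (abs_nonneg _)
  simpa [detGrad] using this

lemma exists_abs_detGrad_le_of_locallyLipschitz {u : ι → V → ℝ} (hu : ∀ i, LocallyLipschitz (u i))
    (R : ℝ) : ∃ C : ℝ, 0 ≤ C ∧ ∀ x ∈ Metric.ball (0 : V) R, |detGrad b u x| ≤ C := by
  choose L hL0 hL using fun i => exists_norm_fderiv_le_of_locallyLipschitz (hu i) R
  obtain ⟨M, hM⟩ := Finite.exists_le L
  obtain ⟨C, hC0, hC⟩ := exists_abs_detGrad_le b M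
  exact ⟨C, hC0, fun x hx => hC u x fun i => (hL i x hx).trans (hM i)⟩

lemma exists_lipschitzWith_of_hasCompactSupport {F : Type*} [NormedAddCommGroup F]
    [NormedSpace ℝ F] [FiniteDimensional ℝ F] {f : V → F} (hf : LocallyLipschitz f)
    (hc : HasCompactSupport f) : ∃ C, LipschitzWith C f := by
  obtain ⟨R, hR, hs⟩ := exists_tsupport_subset_ball hc
  -- The margin 1 separates two cases: nearby points use the Lipschitz constant `C`, and points at
  -- distance at least 1 use the sup bound `M`.
  obtain ⟨C, g, hg, hfg⟩ := exists_lipschitzWith_eqOn_closedBall hf (R + 1)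
  obtain ⟨M, hM0, hM⟩ := exists_norm_le_of_continuous hf.continuous R
  have hout : ∀ x, R ≤ ‖x‖ → f x = 0 := fun x hx => image_eq_zero_of_notMem_tsupport fun h => by
    have := hs h
    rw [mem_ball_zero_iff] at this
    linarith
  have hbd : ∀ x, ‖f x‖ ≤ M := fun x => by
    rcases le_total ‖x‖ R with h | h
    · exact hM x (by simpa using h)
    · simpa [hout x h] using hM0
  have key : ∀ x y, ‖x‖ < R → dist (f x) (f y) ≤ max (C : ℝ) M * dist x y := by
    intro x y hx
    rcases le_or_gt ‖y‖ (R + 1) with hy | hy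
    · rw [hfg (show x ∈ Metric.closedBall 0 (R + 1) by simp; linarith), hfg (by simpa using hy)]
      exact (hg.dist_le_mul x y).trans (by gcongr; exact le_max_left _ _)
    · rw [hout y (by linarith), dist_zero_right]
      have h1 : 1 ≤ dist x y := by
        rw [dist_eq_norm, norm_sub_rev]
        have := norm_sub_norm_le y x
        linarith
      calc ‖f x‖ ≤ M * 1 := by simpa using hbd x
        _ ≤ max (C : ℝ) M * dist x y := by gcongr; exact le_max_right _ _
  refine ⟨max C ⟨M, hM0⟩, LipschitzWith.of_dist_le_mul fun x y => ?_⟩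
  show _ ≤ max (C : ℝ) M * _
  rcases lt_or_ge ‖x‖ R with hx | hx
  · exact key x y hx
  rcases lt_or_ge ‖y‖ R with hy | hy
  · rw [dist_comm, dist_comm x]; exact key y x hy
  · rw [hout x hx, hout y hy, dist_self]; positivity

variable [MeasurableSpace V] [BorelSpace V] {μ : Measure V} [μ.IsAddHaarMeasure]

lemma measurable_detGrad (u : ι → V → ℝ) : Measurable (detGrad b u) := by
  unfold detGrad
  simp_rw [Matrix.det_apply, Matrix.of_apply]
  refine Finset.measurable_sum _ fun σ _ => Measurable.const_smul
    (Finset.measurable_prod _ fun i _ => ?_) _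
  exact measurable_fderiv_apply_const ℝ (u _) (b i)

/-- One compactly supported entry suffices. Multiplying all entries by a cutoff equal to 1 near the
support of `u i₀` produces a compactly supported map. Its determinant is unchanged where the cutoff
is 1, and elsewhere row `i₀` vanishes before and after. -/
theorem integral_detGrad_eq_zero {u : ι → V → ℝ} (hu : ∀ i, LocallyLipschitz (u i)) (i₀ : ι)
    (hc : HasCompactSupport (u i₀)) : ∫ x, detGrad b u x ∂μ = 0 := by
  have : Nontrivial V := ⟨b i₀, 0, b.ne_zero i₀⟩
  obtain ⟨R, hR, hs⟩ := exists_tsupport_subset_ball hc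
  obtain ⟨χ, hχ, hχc, -, -, hχ1⟩ := exists_cutoff V R
  have hχL : LocallyLipschitz χ := (hχ.of_le (by simp)).locallyLipschitz (𝕂 := ℝ)
  let H : V → V := fun x => ∑ i, (χ x * u i x) • b i
  have hcoord : ∀ i, (fun x => b.coord i (H x)) = fun x => χ x * u i x := by
    intro i
    ext x
    simp [H, Finsupp.single_apply]
  have hHL : LocallyLipschitz H := by
    have h : LocallyLipschitz fun x i => χ x * u i x := by
      have h1 : LocallyLipschitz fun x => (χ x, fun i => u i x) := hχL.prodMk ?_
      · have h2 : ContDiff ℝ 1 fun p : ℝ × (ι → ℝ) => fun i => p.1 * p.2 i := by fun_prop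
        exact h2.locallyLipschitz.comp h1
      · intro x
        choose K t ht hK using fun i => hu i x
        refine ⟨Finset.univ.sup K, ⋂ i, t i, Filter.iInter_mem.2 ht, ?_⟩
        intro y hy z hz
        rw [edist_pi_def]
        refine Finset.sup_le fun i _ => (hK i (mem_iInter.1 hy i) (mem_iInter.1 hz i)).trans ?_
        gcongr
        exact Finset.le_sup (f := K) (Finset.mem_univ i)
    have h2 : ContDiff ℝ 1 fun p : ι → ℝ => ∑ i, p i • b i := by fun_prop
    exact h2.locallyLipschitz.comp h
  have hHc : HasCompactSupport H := hχc.mono fun x hx => by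
    contrapose! hx
    simp only [Function.mem_support, not_not] at hx ⊢
    simp [H, hx]
  obtain ⟨C, hC⟩ := exists_lipschitzWith_of_hasCompactSupport hHL hHc
  rw [← integral_det_fderiv_eq_zero (μ := μ) hC hHc]
  refine integral_congr_ae ?_
  filter_upwards [ae_differentiableAt_of_locallyLipschitz (μ := μ) hHL] with x hx
  rw [← detGrad_eq_det_fderiv b hx]
  by_cases hxR : x ∈ Metric.ball 0 R
  · refine detGrad_congr b fun i => Filter.EventuallyEq.fderiv_eq ?_
    filter_upwards [Metric.isOpen_ball.mem_nhds hxR] with y hy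
    rw [congrFun (hcoord i) y, hχ1 y (Metric.ball_subset_closedBall hy), one_mul]
  · have h0 : u i₀ =ᶠ[𝓝 x] fun _ => 0 := notMem_tsupport_iff_eventuallyEq.1 fun h => hxR (hs h)
    rw [detGrad_eq_zero b (i := i₀), detGrad_eq_zero b (i := i₀)]
    · rw [hcoord, Filter.EventuallyEq.fderiv_eq (f := fun _ => (0 : ℝ))]
      · simp
      · filter_upwards [h0] with y hy
        simp [hy]
    · rw [h0.fderiv_eq]; simp

lemma locallyLipschitz_update {u : ι → V → ℝ} (hu : ∀ i, LocallyLipschitz (u i)) {w : V → ℝ}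
    (hw : LocallyLipschitz w) (i j : ι) : LocallyLipschitz (Function.update u i w j) := by
  by_cases h : j = i
  · subst h; simpa using hw
  · rw [Function.update_of_ne h]; exact hu j

lemma integrable_mul_detGrad {u : ι → V → ℝ} (hu : ∀ i, LocallyLipschitz (u i)) {φ : V → ℝ}
    (hφ : Continuous φ) (hc : HasCompactSupport φ) :
    Integrable (fun x => φ x * detGrad b u x) μ := by
  simp_rw [mul_comm (φ _)]
  refine integrable_mul_of_hasCompactSupport (measurable_detGrad b u).aestronglyMeasurable
    (fun R => ?_) hφ hc
  obtain ⟨C, -, hC⟩ := exists_abs_detGrad_le_of_locallyLipschitz b hu R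
  exact ⟨C, Filter.Eventually.of_forall hC⟩

lemma fderiv_eq_zero_of_notMem_tsupport {φ : V → ℝ} {x : V} (hx : x ∉ tsupport φ) :
    fderiv ℝ φ x = 0 := by
  rw [(notMem_tsupport_iff_eventuallyEq.1 hx).fderiv_eq]
  simp

lemma integrable_mul_detGrad_update {u : ι → V → ℝ} (hu : ∀ i, LocallyLipschitz (u i)) {φ w : V → ℝ}
    (hφ : LocallyLipschitz φ) (hc : HasCompactSupport φ) (hw : LocallyLipschitz w) (i : ι) :
    Integrable (fun x => w x * detGrad b (Function.update u i φ) x) μ := by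
  obtain ⟨R, hR, hs⟩ := exists_tsupport_subset_ball hc
  obtain ⟨χ, hχ, hχc, -, -, hχ1⟩ := exists_cutoff V R
  have h := integrable_mul_detGrad b (μ := μ) (locallyLipschitz_update hu hφ i)
    (hχ.continuous.mul hw.continuous) hχc.mul_right
  refine h.congr (Filter.Eventually.of_forall fun x => ?_)
  by_cases hx : x ∈ tsupport φ
  · simp [hχ1 x (Metric.ball_subset_closedBall (hs hx))]
  · have : detGrad b (Function.update u i φ) x = 0 :=
      detGrad_eq_zero b (i := i) (by simpa using fderiv_eq_zero_of_notMem_tsupport hx)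
    simp [this]

/-- The previous vanishing theorem is applied with the product `φ w` in row `i`, and the Leibniz
rule splits that row. -/
theorem integral_mul_detGrad_update {u : ι → V → ℝ} (hu : ∀ i, LocallyLipschitz (u i)) {φ w : V → ℝ}
    (hφ : LocallyLipschitz φ) (hc : HasCompactSupport φ) (hw : LocallyLipschitz w) (i : ι) :
    ∫ x, φ x * detGrad b (Function.update u i w) x ∂μ =
      -∫ x, w x * detGrad b (Function.update u i φ) x ∂μ := by
  have h0 := integral_detGrad_eq_zero b (μ := μ)
    (locallyLipschitz_update hu (locallyLipschitz_mul hφ hw) i) i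
    (by rw [Function.update_self]; exact hc.mul_right)
  have h1 := integrable_mul_detGrad b (μ := μ) (locallyLipschitz_update hu hw i) hφ.continuous hc
  have h2 := integrable_mul_detGrad_update b (μ := μ) hu hφ hc hw i
  rw [eq_neg_iff_add_eq_zero, ← integral_add h1 h2, ← h0]
  refine integral_congr_ae ?_
  filter_upwards [ae_differentiableAt_of_locallyLipschitz (μ := μ) hφ,
    ae_differentiableAt_of_locallyLipschitz (μ := μ) hw] with x hx hx'
  rw [detGrad_update_mul b u i hx hx']

/-- Weak continuity of the determinant: on maps with a common bound of the derivatives, the integral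
against a test function is Lipschitz for the uniform distance. -/
theorem exists_abs_integral_mul_detGrad_sub_le {φ : V → ℝ} (hφ : LocallyLipschitz φ) {R : ℝ}
    (hc : HasCompactSupport φ) (hR : tsupport φ ⊆ Metric.ball 0 R) (L : ℝ) :
    ∃ C : ℝ, 0 ≤ C ∧ ∀ u v : ι → V → ℝ, (∀ i, LocallyLipschitz (u i)) →
      (∀ i, LocallyLipschitz (v i)) → (∀ i, ∀ x ∈ Metric.ball 0 R, ‖fderiv ℝ (u i) x‖ ≤ L) →
      (∀ i, ∀ x ∈ Metric.ball 0 R, ‖fderiv ℝ (v i) x‖ ≤ L) → ∀ δ : ℝ,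
      (∀ i, ∀ x ∈ Metric.ball 0 R, |u i x - v i x| ≤ δ) →
      |∫ x, φ x * detGrad b u x ∂μ - ∫ x, φ x * detGrad b v x ∂μ| ≤ C * δ := by
  have : ProperSpace V := FiniteDimensional.proper ℝ V
  obtain ⟨Lφ, -, hLφ⟩ := exists_norm_fderiv_le_of_locallyLipschitz hφ R
  -- After integration by parts one row is the gradient of `φ`, bounded by `Lφ`; the other rows are
  -- bounded by `L`.
  obtain ⟨C, hC0, hC⟩ := exists_abs_detGrad_le b (max L Lφ)
  set m := μ.real (Metric.ball (0 : V) R)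
  -- Changing one entry: integration by parts moves the derivative from `w - w'` to `φ`, so only the
  -- uniform distance of `w` and `w'` enters.
  have step : ∀ (u : ι → V → ℝ) (i : ι) (w w' : V → ℝ), (∀ i, LocallyLipschitz (u i)) →
      LocallyLipschitz w → LocallyLipschitz w' →
      (∀ i, ∀ x ∈ Metric.ball 0 R, ‖fderiv ℝ (u i) x‖ ≤ L) → ∀ δ : ℝ,
      (∀ x ∈ Metric.ball 0 R, |w x - w' x| ≤ δ) →
      |∫ x, φ x * detGrad b (Function.update u i w) x ∂μ -
        ∫ x, φ x * detGrad b (Function.update u i w') x ∂μ| ≤ C * m * δ := by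
    intro u i w w' hu hw hw' huL δ hδ
    have h1 := integrable_mul_detGrad b (μ := μ) (locallyLipschitz_update hu hw i) hφ.continuous hc
    have h2 := integrable_mul_detGrad b (μ := μ) (locallyLipschitz_update hu hw' i) hφ.continuous hc
    have e : ∫ x, φ x * detGrad b (Function.update u i w) x ∂μ -
        ∫ x, φ x * detGrad b (Function.update u i w') x ∂μ =
        ∫ x, φ x * detGrad b (Function.update u i fun y => w y - w' y) x ∂μ := by
      rw [← integral_sub h1 h2]
      refine integral_congr_ae ?_
      filter_upwards [ae_differentiableAt_of_locallyLipschitz (μ := μ) hw,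
        ae_differentiableAt_of_locallyLipschitz (μ := μ) hw'] with x hx hx'
      rw [detGrad_update_sub b u i hx hx', mul_sub]
    rw [e, integral_mul_detGrad_update b hu hφ hc (locallyLipschitz_sub hw hw') i, abs_neg]
    have hset : ∫ x, (w x - w' x) * detGrad b (Function.update u i φ) x ∂μ =
        ∫ x in Metric.ball 0 R, (w x - w' x) * detGrad b (Function.update u i φ) x ∂μ := by
      refine (setIntegral_eq_integral_of_forall_compl_eq_zero fun x hx => ?_).symm
      have : detGrad b (Function.update u i φ) x = 0 := detGrad_eq_zero b (i := i)
        (by simpa using fderiv_eq_zero_of_notMem_tsupport fun h => hx (hR h))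
      rw [this, mul_zero]
    rw [hset, ← Real.norm_eq_abs]
    refine (norm_setIntegral_le_of_norm_le_const (C := C * δ) measure_ball_lt_top
      fun x hx => ?_).trans (le_of_eq (by ring))
    rw [norm_mul, mul_comm C]
    have hδ0 : 0 ≤ δ := (abs_nonneg _).trans (hδ x hx)
    refine mul_le_mul (hδ x hx) (hC _ x fun j => ?_) (norm_nonneg _) hδ0
    by_cases hj : j = i
    · subst hj; simpa using Or.inr (hLφ x hx)
    · rw [Function.update_of_ne hj]; exact (huL j x hx).trans (le_max_left _ _)
  refine ⟨Fintype.card ι * (C * m), by positivity, fun u v hu hv huL hvL δ hδ => ?_⟩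
  -- The entries of `u` are replaced by those of `v` one at a time, each at a cost of `C * m * δ`.
  have key : ∀ s : Finset ι, |∫ x, φ x * detGrad b u x ∂μ -
      ∫ x, φ x * detGrad b (fun i => if i ∈ s then v i else u i) x ∂μ| ≤ s.card * (C * m) * δ := by
    intro s
    induction s using Finset.induction_on with
    | empty => simp
    | insert i s his ih =>
      set M : ι → V → ℝ := fun i => if i ∈ s then v i else u i
      have e1 : (fun j => if j ∈ insert i s then v j else u j) = Function.update M i (v i) := by
        ext1 j
        by_cases hj : j = i
        · subst hj; simp
        · simp [M, hj]
      have e2 : M = Function.update M i (u i) := by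
        rw [Function.eq_update_iff]
        simp [M, his]
      have hM : ∀ i, LocallyLipschitz (M i) := fun j => by
        simp only [M]; split_ifs <;> [exact hv j; exact hu j]
      have hML : ∀ i, ∀ x ∈ Metric.ball 0 R, ‖fderiv ℝ (M i) x‖ ≤ L := fun j x hx => by
        simp only [M]; split_ifs <;> [exact hvL j x hx; exact huL j x hx]
      have h := step M i (u i) (v i) hM (hu i) (hv i) hML δ (hδ i)
      rw [← e2, ← e1] at h
      rw [Finset.card_insert_of_notMem his]
      calc _ ≤ _ := abs_sub_le _ _ _
        _ ≤ _ := add_le_add ih h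
        _ = _ := by push_cast; ring
  simpa using key Finset.univ

end DetGrad

/-! ### Extension of functions from the closed slab -/

section Slab

variable {N : ℕ} {T : ℝ} {a : ℝ × Space N → Space N}

lemma isOpen_openSlab : IsOpen (openSlab N T) := isOpen_Ioo.prod isOpen_univ

lemma measurableSet_openSlab : MeasurableSet (openSlab N T) := isOpen_openSlab.measurableSet

lemma openSlab_subset_closedSlab : openSlab N T ⊆ closedSlab N T :=
  prod_mono Ioo_subset_Icc_self Subset.rfl

lemma mk_mem_closedSlab {t : ℝ} {x : Space N} : (t, x) ∈ closedSlab N T ↔ t ∈ Icc 0 T := by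
  simp [closedSlab]

lemma mem_openSlab {z : ℝ × Space N} : z ∈ openSlab N T ↔ z.1 ∈ Ioo 0 T := by
  simp [openSlab]

/-- Every locally Lipschitz map on the closed slab is the restriction of one on the whole
space-time. -/
lemma exists_locallyLipschitz_extension {F : Type*} [PseudoEMetricSpace F] (hT : 0 ≤ T)
    {p : ℝ × Space N → F} (hp : LocallyLipschitzOn (closedSlab N T) p) :
    ∃ q : ℝ × Space N → F, LocallyLipschitz q ∧ EqOn q p (closedSlab N T) ∧
      ∀ t x, T ≤ t → q (t, x) = p (T, x) := by
  -- Clamping the time to `[0,T]` is 1-Lipschitz. It freezes the extension at its final value after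
  -- `T`, so that exceptional solutions are extended by 0 there.
  let c : ℝ × Space N → ℝ × Space N := fun z => (max 0 (min T z.1), z.2)
  have hc : LipschitzWith 1 c := by
    have h := ((LipschitzWith.prod_fst (α := ℝ) (β := Space N)).const_min T).const_max 0
    simpa using h.prodMk LipschitzWith.prod_snd
  have hmem : ∀ z, c z ∈ closedSlab N T := fun z =>
    mk_mem_closedSlab.2 ⟨le_max_left _ _, max_le hT (min_le_left _ _)⟩
  refine ⟨p ∘ c, fun z => ?_, fun z hz => ?_, fun t x ht => by simp [c, ht, hT]⟩
  · obtain ⟨K, t, ht, hK⟩ := hp (hmem z)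
    refine ⟨K, c ⁻¹' t, ?_, ?_⟩
    · exact (tendsto_nhdsWithin_iff.2 ⟨hc.continuous.continuousAt,
        Filter.Eventually.of_forall hmem⟩) ht
    · have := hK.comp (hc.lipschitzOnWith (s := c ⁻¹' t)) (mapsTo_preimage c t)
      simpa using this
  · have h1 : 0 ≤ z.1 := hz.1.1
    have h2 : z.1 ≤ T := hz.1.2
    have : c z = z := by simp [c, h1, h2]
    simp [this]

lemma fderiv_eq_of_eqOn_closedSlab {F : Type*} [NormedAddCommGroup F] [NormedSpace ℝ F]
    {p q : ℝ × Space N → F} (h : EqOn q p (closedSlab N T)) {z : ℝ × Space N}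
    (hz : z ∈ openSlab N T) : fderiv ℝ q z = fderiv ℝ p z :=
  Filter.EventuallyEq.fderiv_eq (Filter.eventuallyEq_of_mem (isOpen_openSlab.mem_nhds hz)
    (h.mono openSlab_subset_closedSlab))

lemma SolvesTransport.congr {F : Type*} [NormedAddCommGroup F] [NormedSpace ℝ F]
    {p q : ℝ × Space N → F} (hp : SolvesTransport T a p) (h : EqOn q p (closedSlab N T)) :
    SolvesTransport T a q := by
  filter_upwards [hp, ae_restrict_mem measurableSet_openSlab] with z hz hzs
  rw [← hz, transportOp, transportOp, fderiv_eq_of_eqOn_closedSlab h hzs]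

lemma spaceJac_congr {p q : ℝ × Space N → Space N} (h : EqOn q p (closedSlab N T)) {t : ℝ}
    (ht : t ∈ Icc 0 T) : spaceJac q t = spaceJac p t := by
  have : (fun y => q (t, y)) = fun y => p (t, y) := funext fun y => h (mk_mem_closedSlab.2 ht)
  ext x
  simp [spaceJac, this]

end Slab

/-! ### Jacobians in coordinates and the space-time determinant -/

section CoordinateJacobian

variable {N : ℕ}

/-- The standard basis of `ℝ^N`. -/
def spaceBasis (N : ℕ) : Module.Basis (Fin N) ℝ (Space N) :=
  (EuclideanSpace.basisFun (Fin N) ℝ).toBasis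

/-- The standard basis of `ℝ × ℝ^N`. -/
def spaceTimeBasis (N : ℕ) : Module.Basis (Unit ⊕ Fin N) ℝ (ℝ × Space N) :=
  (Module.Basis.singleton Unit ℝ).prod (spaceBasis N)

lemma spaceBasis_coord (i : Fin N) (x : Space N) : (spaceBasis N).coord i x = x i := by
  simp [spaceBasis]

lemma sum_smul_spaceBasis (v : Space N) : ∑ j, v j • spaceBasis N j = v := by
  conv_rhs => rw [← (spaceBasis N).sum_repr v]
  rfl

lemma jac_eq_detGrad {f : Space N → Space N} {x : Space N} (hf : DifferentiableAt ℝ f x) :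
    jac f x = detGrad (spaceBasis N) (fun i y => f y i) x := by
  rw [jac, ← detGrad_eq_det_fderiv (spaceBasis N) hf]
  simp_rw [spaceBasis_coord]

lemma locallyLipschitz_coord {α : Type*} [PseudoEMetricSpace α] {f : α → Space N}
    (hf : LocallyLipschitz f) (i : Fin N) : LocallyLipschitz fun x => f x i :=
  locallyLipschitz_clm_comp (EuclideanSpace.proj i : Space N →L[ℝ] ℝ) hf

lemma abs_coord_le (x : Space N) (i : Fin N) : |x i| ≤ ‖x‖ := by
  simpa using PiLp.norm_apply_le x i

lemma exists_abs_det_le (V : Type*) [NormedAddCommGroup V] [NormedSpace ℝ V]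
    [FiniteDimensional ℝ V] (L : ℝ) : ∃ C : ℝ, 0 ≤ C ∧ ∀ A : V →L[ℝ] V, ‖A‖ ≤ L → |A.det| ≤ C := by
  obtain ⟨C, hC0, hC⟩ := exists_norm_le_of_continuous
    (ContinuousLinearMap.continuous_det (𝕜 := ℝ) (E := V)) L
  exact ⟨C, hC0, fun A hA => hC A (by simpa using hA)⟩

lemma measurable_jac (f : Space N → Space N) : Measurable (jac f) :=
  ContinuousLinearMap.continuous_det.measurable.comp (measurable_fderiv ℝ f)

lemma jac_ae_eq_detGrad {f : Space N → Space N} (hf : LocallyLipschitz f) :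
    jac f =ᵐ[volume] detGrad (spaceBasis N) fun i y => f y i := by
  filter_upwards [ae_differentiableAt_of_locallyLipschitz (μ := volume) hf] with x hx
  exact jac_eq_detGrad hx

/-- This quantitative weak continuity serves twice: it gives continuity in time of Jacobian
solutions, and it passes the sign of Jacobians to limits of flows. -/
theorem exists_abs_integral_jac_mul_sub_le {φ : Space N → ℝ} (hφ : LocallyLipschitz φ) {R : ℝ}
    (hc : HasCompactSupport φ) (hR : tsupport φ ⊆ Metric.ball 0 R) (L : ℝ≥0) :
    ∃ C : ℝ, 0 ≤ C ∧ ∀ f g : Space N → Space N, LocallyLipschitz f → LocallyLipschitz g →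
      LipschitzOnWith L f (Metric.ball 0 R) → LipschitzOnWith L g (Metric.ball 0 R) → ∀ δ : ℝ,
      (∀ x ∈ Metric.ball 0 R, ‖f x - g x‖ ≤ δ) →
      |(∫ x, jac f x * φ x) - ∫ x, jac g x * φ x| ≤ C * δ := by
  obtain ⟨C, hC0, hC⟩ := exists_abs_integral_mul_detGrad_sub_le (spaceBasis N) (μ := volume)
    hφ hc hR L
  refine ⟨C, hC0, fun f g hf hg hfL hgL δ hδ => ?_⟩
  have e : ∀ f : Space N → Space N, LocallyLipschitz f → ∫ x, jac f x * φ x =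
      ∫ x, φ x * detGrad (spaceBasis N) (fun i y => f y i) x := by
    intro f hf
    refine integral_congr_ae ?_
    filter_upwards [jac_ae_eq_detGrad hf] with x hx
    rw [hx, mul_comm]
  have hb : ∀ f : Space N → Space N, LipschitzOnWith L f (Metric.ball 0 R) → ∀ i,
      ∀ x ∈ Metric.ball (0 : Space N) R, ‖fderiv ℝ (fun y => f y i) x‖ ≤ L := by
    intro f hf i x hx
    refine norm_fderiv_le_of_lipschitzOnWith_ball (LipschitzOnWith.of_dist_le_mul
      fun y hy w hw => ?_) hx
    refine le_trans ?_ (hf.dist_le_mul y hy w hw)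
    rw [Real.dist_eq, dist_eq_norm]
    exact abs_coord_le (f y - f w) i
  rw [e f hf, e g hg]
  exact hC _ _ (locallyLipschitz_coord hf) (locallyLipschitz_coord hg) (hb f hfL) (hb g hgL) δ
    fun i x hx => (abs_coord_le (f x - g x) i).trans (hδ x hx)

/-- The space-time determinant of a function and a solution of the transport equation. -/
lemma detGrad_spaceTime {q : ℝ × Space N → Space N} {φ : ℝ × Space N → ℝ} {z : ℝ × Space N}
    (hq : DifferentiableAt ℝ q z) {v : Space N} (hv : fderiv ℝ q z (1, v) = 0) :
    detGrad (spaceTimeBasis N) (Sum.elim (fun _ => φ) fun i w => q w i) z =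
      fderiv ℝ φ z (1, v) * spaceJac q z.1 z.2 := by
  have hslice : HasFDerivAt (fun y => q (z.1, y))
      ((fderiv ℝ q z).comp (ContinuousLinearMap.inr ℝ ℝ (Space N))) z.2 :=
    HasFDerivAt.comp z.2 (show HasFDerivAt q (fderiv ℝ q z) (z.1, z.2) from hq.hasFDerivAt)
      (hasFDerivAt_prodMk_right z.1 z.2)
  have hcoord : ∀ i w, fderiv ℝ (fun w => q w i) z w = fderiv ℝ q z w i := by
    intro i w
    have h : fderiv ℝ (fun w => q w i) z = _ :=
      ((EuclideanSpace.proj i : Space N →L[ℝ] ℝ).hasFDerivAt.comp z hq.hasFDerivAt).fderiv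
    rw [h]; rfl
  have hcoord' : ∀ i w, fderiv ℝ (fun y => q (z.1, y) i) z.2 w = fderiv ℝ q z (0, w) i := by
    intro i w
    have h : fderiv ℝ (fun y => q (z.1, y) i) z.2 = _ :=
      ((EuclideanSpace.proj i : Space N →L[ℝ] ℝ).hasFDerivAt.comp z.2 hslice).fderiv
    rw [h]; simp
  have hsplit : ∀ A : ℝ × Space N →L[ℝ] ℝ,
      A (1, 0) + ∑ j, A (0, spaceBasis N j) * v j = A (1, v) := by
    intro A
    have h : ((1, v) : ℝ × Space N) = (1, 0) + ∑ j, v j • (0, spaceBasis N j) := by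
      have : ∑ j, v j • ((0 : ℝ), spaceBasis N j) = (0, v) := by
        rw [Prod.ext_iff]
        simp [Prod.fst_sum, Prod.snd_sum, sum_smul_spaceBasis]
      rw [this]; simp
    rw [h, map_add, map_sum]
    simp only [map_smul, smul_eq_mul, mul_comm]
  rw [spaceJac, jac_eq_detGrad hslice.differentiableAt, detGrad, detGrad]
  set D : Matrix (Fin N) (Fin N) ℝ :=
    Matrix.of fun i j => fderiv ℝ (fun y => q (z.1, y) i) z.2 (spaceBasis N j) with hD
  set B : Matrix Unit (Fin N) ℝ := Matrix.of fun _ j => fderiv ℝ φ z (0, spaceBasis N j) with hB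
  set A : Matrix Unit Unit ℝ := Matrix.of fun _ _ => fderiv ℝ φ z (1, 0) with hA
  set C : Matrix (Fin N) Unit ℝ := Matrix.of fun i _ => fderiv ℝ q z (1, 0) i with hC
  set S : Matrix (Fin N) Unit ℝ := Matrix.of fun i _ => v i with hS
  have hM : (Matrix.of fun i j => fderiv ℝ (Sum.elim (fun _ => φ) (fun i w => q w i) i) z
      (spaceTimeBasis N j)) = Matrix.fromBlocks A B C D := by
    ext i j
    rcases i with i | i <;> rcases j with j | j <;>
      simp [spaceTimeBasis, hA, hB, hC, hD, hcoord, hcoord', Module.Basis.prod_apply]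
  -- The column operation adds the space columns, weighted by the components of `v`, to the time
  -- column. This turns time derivatives into derivatives along `(1, v)`, and the equation for `q`
  -- kills the lower left block.
  have hmul : Matrix.fromBlocks A B C D * Matrix.fromBlocks 1 0 S 1 =
      Matrix.fromBlocks (Matrix.of fun _ _ => fderiv ℝ φ z (1, v)) B 0 D := by
    rw [Matrix.fromBlocks_multiply]
    congr 1
    · ext i j
      simp [hA, hB, hS, Matrix.mul_apply, hsplit]
    · simp
    · ext i j
      have h := hsplit ((EuclideanSpace.proj i : Space N →L[ℝ] ℝ).comp (fderiv ℝ q z))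
      simp only [ContinuousLinearMap.comp_apply, hv] at h
      simpa [hC, hD, hS, Matrix.mul_apply, hcoord'] using h
    · simp
  have hdet := congrArg Matrix.det hmul
  rw [Matrix.det_mul, Matrix.det_fromBlocks_zero₁₂, Matrix.det_fromBlocks_zero₂₁] at hdet
  rw [hM]
  simpa using hdet

end CoordinateJacobian

/-! ### Jacobian solutions solve the continuity equation and are weak-* continuous -/

section TransportSolutions

instance (N : ℕ) : (volume : Measure (ℝ × Space N)).IsAddHaarMeasure :=
  inferInstanceAs ((volume : Measure ℝ).prod (volume : Measure (Space N))).IsAddHaarMeasure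

/-- The radius is independent of `ε` because every approximation is multiplied by the same cutoff;
local bounds on that ball therefore apply to all of them. -/
lemma exists_smooth_integral_sub_le {V : Type*} [NormedAddCommGroup V] [NormedSpace ℝ V]
    [FiniteDimensional ℝ V] [MeasurableSpace V] [BorelSpace V] {μ : Measure V}
    [IsFiniteMeasureOnCompacts μ] {φ : V → ℝ} (hφ : Integrable φ μ)
    (hc : HasCompactSupport φ) : ∃ R : ℝ, tsupport φ ⊆ Metric.ball 0 R ∧ ∀ ε : ℝ, 0 < ε →
      ∃ ψ : V → ℝ, ContDiff ℝ ∞ ψ ∧ HasCompactSupport ψ ∧ tsupport ψ ⊆ Metric.ball 0 R ∧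
        ∫ x, |φ x - ψ x| ∂μ ≤ ε := by
  have : ProperSpace V := FiniteDimensional.proper ℝ V
  obtain ⟨R, hR, hs⟩ := exists_tsupport_subset_ball hc
  obtain ⟨χ, hχ, hχc, hχ0, hχ1, hχR⟩ := exists_cutoff V R
  obtain ⟨R', hR', hs'⟩ := exists_tsupport_subset_ball hχc
  have hχs : tsupport φ ⊆ tsupport χ := fun x hx => subset_tsupport _ (by
    simp [hχR x (Metric.ball_subset_closedBall (hs hx))])
  refine ⟨R', hχs.trans hs', fun ε hε => ?_⟩
  obtain ⟨g, hgc, hg, hge⟩ := (memLp_one_iff_integrable.2 hφ).exist_eLpNorm_sub_le (by simp)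
    le_rfl hε
  have hgi : Integrable g μ := hg.continuous.integrable_of_hasCompactSupport hgc
  refine ⟨fun x => χ x * g x, hχ.mul hg, hχc.mul_right, (tsupport_mul_subset_left).trans hs', ?_⟩
  have h1 : ∫ x, ‖(φ - g) x‖ ∂μ ≤ ε := by
    rw [integral_norm_eq_lintegral_enorm (hφ.sub hgi).aestronglyMeasurable,
      ← eLpNorm_one_eq_lintegral_enorm]
    exact ENNReal.toReal_le_of_le_ofReal hε.le hge
  refine (integral_mono_of_nonneg (Filter.Eventually.of_forall fun x => abs_nonneg _)
    (hφ.sub hgi).norm (Filter.Eventually.of_forall fun x => ?_)).trans h1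
  have h2 : φ x - χ x * g x = χ x * (φ x - g x) := by
    by_cases hx : x ∈ tsupport φ
    · rw [hχR x (Metric.ball_subset_closedBall (hs hx))]; ring
    · rw [image_eq_zero_of_notMem_tsupport hx]; ring
  simp only [h2, abs_mul, abs_of_nonneg (hχ0 x), Pi.sub_apply, Real.norm_eq_abs]
  exact mul_le_of_le_one_left (abs_nonneg _) (hχ1 x)

variable {N : ℕ} {T : ℝ} {a : ℝ × Space N → Space N}

/-- The weak form of the continuity equation, tested against Lipschitz functions. -/
def LipschitzWeak (T : ℝ) (a : ℝ × Space N → Space N) (u : ℝ × Space N → ℝ) : Prop :=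
  ∀ φ : ℝ × Space N → ℝ, LocallyLipschitz φ → HasCompactSupport φ → tsupport φ ⊆ openSlab N T →
    ∫ z in openSlab N T, u z * transportOp a φ z = 0

/-- The integrand is the space-time determinant of `(φ, q)`, whose integral vanishes because `φ` has
compact support. -/
theorem lipschitzWeak_spaceJac {q : ℝ × Space N → Space N} (hq : LocallyLipschitz q)
    (hs : SolvesTransport T a q) : LipschitzWeak T a fun z => spaceJac q z.1 z.2 := by
  intro φ hφ hc hsupp
  have h0 := integral_detGrad_eq_zero (spaceTimeBasis N) (μ := volume)
    (u := Sum.elim (fun _ => φ) fun i w => q w i)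
    (by rintro (i | i); exacts [hφ, locallyLipschitz_coord hq i]) (Sum.inl ()) hc
  rw [← h0, ← setIntegral_eq_integral_of_forall_compl_eq_zero (s := openSlab N T) fun z hz =>
    detGrad_eq_zero _ (i := Sum.inl ()) (fderiv_eq_zero_of_notMem_tsupport fun h => hz (hsupp h))]
  refine integral_congr_ae ?_
  filter_upwards [hs, ae_restrict_of_ae (ae_differentiableAt_of_locallyLipschitz (μ := volume) hq)]
    with z hz hzd
  rw [detGrad_spaceTime hzd hz, transportOp, mul_comm]

lemma measurable_spaceJac {q : ℝ × Space N → Space N} (hq : Continuous q) :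
    Measurable fun z : ℝ × Space N => spaceJac q z.1 z.2 :=
  ContinuousLinearMap.continuous_det.measurable.comp
    (measurable_fderiv_with_param (f := fun t y => q (t, y)) ℝ hq)

lemma locallyLipschitz_slice {F : Type*} [PseudoEMetricSpace F] {q : ℝ × Space N → F}
    (hq : LocallyLipschitz q) (t : ℝ) : LocallyLipschitz fun y => q (t, y) :=
  hq.comp (LocallyLipschitz.prodMk_left t)

lemma exists_slice_bounds {q : ℝ × Space N → Space N} (hq : LocallyLipschitz q) (T R : ℝ) :
    ∃ K : ℝ≥0, (∀ t ∈ Icc 0 T, LipschitzOnWith K (fun y => q (t, y)) (Metric.ball 0 R)) ∧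
      ∀ s ∈ Icc 0 T, ∀ t ∈ Icc 0 T, ∀ x ∈ Metric.ball (0 : Space N) R,
        ‖q (s, x) - q (t, x)‖ ≤ K * |s - t| := by
  obtain ⟨K, g, hg, hqg⟩ := exists_lipschitzWith_eqOn_closedBall hq (max |T| R)
  have hmem : ∀ t ∈ Icc 0 T, ∀ x ∈ Metric.ball (0 : Space N) R,
      ((t, x) : ℝ × Space N) ∈ Metric.closedBall 0 (max |T| R) := by
    intro t ht x hx
    rw [mem_closedBall_zero_iff, Prod.norm_def, Real.norm_of_nonneg ht.1]
    exact max_le_max (ht.2.trans (le_abs_self T)) (by simpa using (mem_ball_zero_iff.1 hx).le)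
  refine ⟨K, fun t ht => LipschitzOnWith.of_dist_le_mul fun x hx y hy => ?_,
    fun s hs t ht x hx => ?_⟩
  · rw [hqg (hmem t ht x hx), hqg (hmem t ht y hy)]
    simpa [Prod.dist_eq] using hg.dist_le_mul (t, x) (t, y)
  · rw [hqg (hmem t ht x hx), hqg (hmem s hs x hx)]
    simpa [Prod.dist_eq, dist_eq_norm] using hg.dist_le_mul (s, x) (t, x)

/-- Bounds that are uniform in time on balls. -/
def LocallyBounded (T : ℝ) (π : ℝ → Space N → ℝ) : Prop :=
  ∀ R : ℝ, ∃ C : ℝ, 0 ≤ C ∧ ∀ t ∈ Icc 0 T, ∀ᵐ x, x ∈ Metric.ball (0 : Space N) R → |π t x| ≤ C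

lemma abs_spaceJac_le {q : ℝ × Space N → Space N} (hq : LocallyLipschitz q) (T R : ℝ) :
    ∃ C : ℝ, 0 ≤ C ∧ ∀ t ∈ Icc 0 T, ∀ x ∈ Metric.ball (0 : Space N) R, |spaceJac q t x| ≤ C := by
  obtain ⟨K, hK, -⟩ := exists_slice_bounds hq T R
  obtain ⟨C, hC0, hC⟩ := exists_abs_det_le (Space N) K
  exact ⟨C, hC0, fun t ht x hx => hC _ (norm_fderiv_le_of_lipschitzOnWith_ball (hK t ht) hx)⟩

lemma locallyBounded_spaceJac {q : ℝ × Space N → Space N} (hq : LocallyLipschitz q) (T : ℝ) :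
    LocallyBounded T (spaceJac q) := fun R => by
  obtain ⟨C, hC0, hC⟩ := abs_spaceJac_le hq T R
  exact ⟨C, hC0, fun t ht => Filter.Eventually.of_forall (hC t ht)⟩

lemma continuousOn_integral_spaceJac_mul {q : ℝ × Space N → Space N} (hq : LocallyLipschitz q)
    {φ : Space N → ℝ} (hφ : LocallyLipschitz φ) (hc : HasCompactSupport φ) :
    ContinuousOn (fun t => ∫ x, spaceJac q t x * φ x) (Icc 0 T) := by
  obtain ⟨R, hR, hs⟩ := exists_tsupport_subset_ball hc
  obtain ⟨K, hK, hK'⟩ := exists_slice_bounds hq T R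
  obtain ⟨C, hC0, hC⟩ := exists_abs_integral_jac_mul_sub_le hφ hc hs K
  have : LipschitzOnWith (Real.toNNReal (C * K)) (fun t => ∫ x, spaceJac q t x * φ x) (Icc 0 T) :=
    by
    refine LipschitzOnWith.of_dist_le_mul fun s hs t ht => ?_
    rw [Real.coe_toNNReal _ (by positivity), Real.dist_eq, Real.dist_eq, mul_assoc]
    exact hC _ _ (locallyLipschitz_slice hq s) (locallyLipschitz_slice hq t) (hK s hs) (hK t ht) _
      (hK' s hs t ht)
  exact this.continuousOn

/-- Integrable test functions are approximated in L¹ by smooth ones supported in a common ball. The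
bound of `π` on that ball is uniform in time, so the tested curve is a uniform limit of continuous
ones. -/
theorem weakStarContinuous_of_lipschitz {π : ℝ → Space N → ℝ}
    (hm : AEStronglyMeasurable (fun z : ℝ × Space N => π z.1 z.2) (volume.restrict (openSlab N T)))
    (hmt : ∀ t ∈ Icc 0 T, AEStronglyMeasurable (π t) volume) (hb : LocallyBounded T π)
    (hcont : ∀ φ : Space N → ℝ, LocallyLipschitz φ → HasCompactSupport φ →
      ContinuousOn (fun t => ∫ x, π t x * φ x) (Icc 0 T)) : WeakStarContinuous T π := by
  refine ⟨hm, fun t ht K hK => ?_, fun φ hφ hc => ?_⟩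
  · obtain ⟨R, hR⟩ := hK.isBounded.subset_ball (0 : Space N)
    obtain ⟨C, -, hC⟩ := hb R
    refine memLp_top_of_bound (hmt t ht).restrict C ?_
    filter_upwards [ae_restrict_of_ae (hC t ht), ae_restrict_mem hK.measurableSet] with x hx hxK
    exact hx (hR hxK)
  · obtain ⟨R, hs, happ⟩ := exists_smooth_integral_sub_le hφ hc
    obtain ⟨C, hC0, hC⟩ := hb R
    have hint : ∀ ψ : Space N → ℝ, Integrable ψ → tsupport ψ ⊆ Metric.ball 0 R → ∀ t ∈ Icc 0 T,
        Integrable (fun x => π t x * ψ x) ∧ ∀ᵐ x, ‖π t x * ψ x‖ ≤ C * |ψ x| := by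
      intro ψ hψ hψs t ht
      have h : ∀ᵐ x, ‖π t x * ψ x‖ ≤ C * |ψ x| := by
        filter_upwards [hC t ht] with x hx
        rw [norm_mul, Real.norm_eq_abs, Real.norm_eq_abs]
        by_cases h0 : ψ x = 0
        · simp [h0]
        · gcongr
          exact hx (hψs (subset_tsupport _ h0))
      exact ⟨(hψ.abs.const_mul C).mono' ((hmt t ht).mul hψ.aestronglyMeasurable) h, h⟩
    refine continuousOn_of_uniform_approx_of_continuousOn fun U hU => ?_
    obtain ⟨ε, hε, hεU⟩ := Metric.mem_uniformity_dist.1 hU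
    obtain ⟨ψ, hψ, hψc, hψs, hψε⟩ := happ (ε / (2 * (C + 1))) (by positivity)
    refine ⟨_, hcont ψ ((hψ.of_le (by simp)).locallyLipschitz (𝕂 := ℝ)) hψc, fun t ht => hεU ?_⟩
    have hψi : Integrable ψ := hψ.continuous.integrable_of_hasCompactSupport hψc
    have hsub : tsupport (fun x => φ x - ψ x) ⊆ Metric.ball 0 R :=
      (tsupport_sub φ ψ).trans (union_subset hs hψs)
    rw [dist_eq_norm, ← integral_sub (hint φ hφ hs t ht).1 (hint ψ hψi hψs t ht).1]
    simp_rw [← mul_sub]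
    obtain ⟨-, h2⟩ := hint _ (hφ.sub hψi) hsub t ht
    calc _ ≤ ∫ x, C * |φ x - ψ x| :=
          norm_integral_le_of_norm_le ((hφ.sub hψi).abs.const_mul C) h2
      _ = C * ∫ x, |φ x - ψ x| := integral_const_mul _ _
      _ ≤ (C + 1) * (ε / (2 * (C + 1))) := by
          gcongr
          linarith
      _ = ε / 2 := by field_simp
      _ < ε := half_lt_self hε

theorem weakStarContinuous_spaceJac {q : ℝ × Space N → Space N} (hq : LocallyLipschitz q) (T : ℝ) :
    WeakStarContinuous T (spaceJac q) :=
  weakStarContinuous_of_lipschitz (measurable_spaceJac hq.continuous).aestronglyMeasurable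
    (fun t _ => (measurable_jac fun y => q (t, y)).aestronglyMeasurable)
    (locallyBounded_spaceJac hq T) fun _ hφ hc => continuousOn_integral_spaceJac_mul hq hφ hc

end TransportSolutions

/-! ### Functions of solutions are solutions -/

section Directional

variable {V F G : Type*} [NormedAddCommGroup V] [NormedSpace ℝ V]
  [NormedAddCommGroup F] [NormedSpace ℝ F] [NormedAddCommGroup G] [NormedSpace ℝ G]

/-- A locally Lipschitz function of `q` is stationary in every direction in which `q` is. -/
lemma fderiv_comp_apply_eq_zero {f : F → G} (hf : LocallyLipschitz f) {q : V → F} {x v : V}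
    (hq : DifferentiableAt ℝ q x) (hv : fderiv ℝ q x v = 0)
    (hfq : DifferentiableAt ℝ (fun y => f (q y)) x) : fderiv ℝ (fun y => f (q y)) x v = 0 := by
  have h1 : HasDerivAt (fun s : ℝ => q (x + s • v)) 0 0 := by
    have := hq.hasFDerivAt.hasLineDerivAt v
    rwa [hv] at this
  have h2 : HasDerivAt (fun s : ℝ => f (q (x + s • v))) (fderiv ℝ (fun y => f (q y)) x v) 0 :=
    hfq.hasFDerivAt.hasLineDerivAt v
  refine h2.unique (hasDerivAt_iff_isLittleO.2 ?_)
  have h3 := hasDerivAt_iff_isLittleO.1 h1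
  simp only [smul_zero, sub_zero] at h3 ⊢
  refine Asymptotics.IsBigO.trans_isLittleO ?_ h3
  obtain ⟨K, t, ht, hK⟩ := hf (q (x + (0 : ℝ) • v))
  have hcont : Filter.Tendsto (fun s : ℝ => q (x + s • v)) (𝓝 0) (𝓝 (q (x + (0 : ℝ) • v))) :=
    h1.continuousAt
  refine Asymptotics.IsBigO.of_bound K ?_
  filter_upwards [hcont ht] with s hs
  rw [← dist_eq_norm, ← dist_eq_norm]
  exact hK.dist_le_mul _ hs _ (mem_of_mem_nhds ht)

lemma fderiv_apply_nonneg {f : V → ℝ} {x v : V} (hf : DifferentiableAt ℝ f x)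
    (h : ∀ s : ℝ, 0 < s → f x ≤ f (x + s • v)) : 0 ≤ fderiv ℝ f x v := by
  refine ge_of_tendsto (hf.hasFDerivAt.hasLineDerivAt v).tendsto_slope_zero_right ?_
  filter_upwards [self_mem_nhdsWithin] with s hs
  exact mul_nonneg (inv_nonneg.2 (le_of_lt hs)) (sub_nonneg.2 (h s hs))

/-- Only `q` and `f ∘ q` have to be differentiable at the point, which Rademacher's theorem
provides. No differentiability of `f` is needed, although the range of `q` may be a null set. -/
lemma SolvesTransport.comp {N : ℕ} {T : ℝ} {a : ℝ × Space N → Space N} [FiniteDimensional ℝ F]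
    [FiniteDimensional ℝ G] {q : ℝ × Space N → F} (hq : LocallyLipschitz q)
    (hs : SolvesTransport T a q) {f : F → G} (hf : LocallyLipschitz f) :
    SolvesTransport T a fun z => f (q z) := by
  filter_upwards [hs, ae_restrict_of_ae (ae_differentiableAt_of_locallyLipschitz (μ := volume) hq),
    ae_restrict_of_ae (ae_differentiableAt_of_locallyLipschitz (μ := volume) (hf.comp hq))]
    with z hz h1 h2
  exact fderiv_comp_apply_eq_zero hf h1 hz h2

end Directional

/-! ### Mollification of bounded and of Lipschitz functions -/

section Mollification

open scoped Convolution

variable {V : Type*} [NormedAddCommGroup V] [NormedSpace ℝ V] [FiniteDimensional ℝ V]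
  [MeasurableSpace V] [BorelSpace V] {μ : Measure V} [μ.IsAddHaarMeasure]

/-- Bump functions at the origin whose supports shrink to a point. -/
def shrinkingBump (V : Type*) [NormedAddCommGroup V] [NormedSpace ℝ V] [FiniteDimensional ℝ V]
    (n : ℕ) : ContDiffBump (0 : V) where
  rIn := 1 / (2 * (n + 1))
  rOut := 1 / (n + 1)
  rIn_pos := by positivity
  rIn_lt_rOut := by
    apply one_div_lt_one_div_of_lt <;> [positivity; linarith [n.cast_nonneg (α := ℝ)]]

lemma tendsto_rOut_shrinkingBump :
    Filter.Tendsto (fun n => (shrinkingBump V n).rOut) Filter.atTop (𝓝 0) :=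
  tendsto_one_div_add_atTop_nhds_zero_nat

lemma ae_tendsto_shrinkingBump_convolution {F : Type*} [NormedAddCommGroup F] [NormedSpace ℝ F]
    [CompleteSpace F] {g : V → F} (hg : LocallyIntegrable g μ) : ∀ᵐ x ∂μ, Filter.Tendsto
      (fun n => ((shrinkingBump V n).normed μ ⋆[ContinuousLinearMap.lsmul ℝ ℝ, μ] g) x)
      Filter.atTop (𝓝 (g x)) := by
  -- The outer radius is twice the inner one, so the bumps have the bounded eccentricity required by
  -- Lebesgue differentiation.
  refine ContDiffBump.ae_convolution_tendsto_right_of_locallyIntegrable (K := 2)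
    tendsto_rOut_shrinkingBump (Filter.Eventually.of_forall fun n => ?_) hg
  show 1 / ((n : ℝ) + 1) ≤ 2 * (1 / (2 * (n + 1)))
  field_simp
  exact le_rfl

lemma norm_bump_convolution_le {F : Type*} [NormedAddCommGroup F] [NormedSpace ℝ F]
    (ρ : ContDiffBump (0 : V)) {g : V → F} {C : ℝ} (hC : ∀ᵐ x ∂μ, ‖g x‖ ≤ C) (x : V) :
    ‖(ρ.normed μ ⋆[ContinuousLinearMap.lsmul ℝ ℝ, μ] g) x‖ ≤ C := by
  have hshift : ∀ᵐ y ∂μ, ‖g (x - y)‖ ≤ C :=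
    (Measure.measurePreserving_sub_left μ x).quasiMeasurePreserving.ae hC
  calc _ ≤ ∫ y, ρ.normed μ y * C ∂μ := by
        refine norm_integral_le_of_norm_le (ρ.integrable_normed.mul_const C) ?_
        filter_upwards [hshift] with y hy
        rw [ContinuousLinearMap.lsmul_apply, norm_smul, Real.norm_of_nonneg (ρ.nonneg_normed y)]
        exact mul_le_mul_of_nonneg_left hy (ρ.nonneg_normed y)
    _ = C := by rw [integral_mul_const, ρ.integral_normed, one_mul]

/-- The derivative falls on `φ`, not on the bump. So the mollified derivatives inherit the bound `C`
and converge a.e. to the derivative of `φ`. -/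
lemma hasFDerivAt_bump_convolution (ρ : ContDiffBump (0 : V)) {φ : V → ℝ} {C : ℝ≥0}
    (hφ : LipschitzWith C φ) (x : V) :
    HasFDerivAt (ρ.normed μ ⋆[ContinuousLinearMap.lsmul ℝ ℝ, μ] φ)
      ((ρ.normed μ ⋆[ContinuousLinearMap.lsmul ℝ ℝ, μ] fderiv ℝ φ) x) x := by
  have hcont : ∀ x, Continuous fun y => ρ.normed μ y • φ (x - y) := fun x =>
    ρ.continuous_normed.smul (hφ.continuous.comp (continuous_const.sub continuous_id))
  have hshift : ∀ᵐ y ∂μ, DifferentiableAt ℝ φ (x - y) :=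
    (Measure.measurePreserving_sub_left μ x).quasiMeasurePreserving.ae hφ.ae_differentiableAt
  refine (hasFDerivAt_integral_of_dominated_loc_of_lip (bound := fun y => ρ.normed μ y * C)
    (s := univ) (F' := fun y => ρ.normed μ y • fderiv ℝ φ (x - y)) Filter.univ_mem
    (Filter.Eventually.of_forall fun x => (hcont x).aestronglyMeasurable)
    ((hcont x).integrable_of_hasCompactSupport ρ.hasCompactSupport_normed.smul_right) ?_ ?_
    (ρ.integrable_normed.mul_const _) ?_).2
  · exact ρ.continuous_normed.aestronglyMeasurable.smul
      ((measurable_fderiv ℝ φ).comp (measurable_const_sub x)).aestronglyMeasurable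
  · refine Filter.Eventually.of_forall fun y => LipschitzOnWith.of_dist_le_mul fun w _ w' _ => ?_
    have h0 := ρ.nonneg_normed (μ := μ) y
    rw [Real.coe_nnabs, abs_of_nonneg (mul_nonneg h0 C.coe_nonneg), dist_smul₀,
      Real.norm_of_nonneg h0,
      mul_assoc]
    gcongr
    simpa using hφ.dist_le_mul (w - y) (w' - y)
  · filter_upwards [hshift] with y hy
    have := hy.hasFDerivAt.comp x ((hasFDerivAt_id x).sub_const y)
    exact this.const_smul (ρ.normed μ y)

/-- A compactly supported Lipschitz function is a limit of test functions, with its derivatives. -/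
theorem exists_smooth_approximation {φ : V → ℝ} (hφ : LocallyLipschitz φ) (hc : HasCompactSupport φ)
    {U : Set V} (hU : IsOpen U) (hs : tsupport φ ⊆ U) :
    ∃ (ψ : ℕ → V → ℝ) (R C : ℝ), (∀ n, ContDiff ℝ ∞ (ψ n)) ∧ (∀ n, HasCompactSupport (ψ n)) ∧
      (∀ n, tsupport (ψ n) ⊆ U) ∧ (∀ n, tsupport (ψ n) ⊆ Metric.ball 0 R) ∧
      (∀ n x, ‖fderiv ℝ (ψ n) x‖ ≤ C) ∧
      ∀ᵐ x ∂μ, Filter.Tendsto (fun n => fderiv ℝ (ψ n) x) Filter.atTop (𝓝 (fderiv ℝ φ x)) := by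
  have : ProperSpace V := FiniteDimensional.proper ℝ V
  obtain ⟨C, hC⟩ := exists_lipschitzWith_of_hasCompactSupport hφ hc
  obtain ⟨R, hR, hsR⟩ := exists_tsupport_subset_ball hc
  obtain ⟨δ, hδ, hδU⟩ := hc.isCompact.exists_cthickening_subset_open (hU.inter Metric.isOpen_ball)
    (subset_inter hs hsR)
  -- The first `n₀` bumps are dropped: only radii at most `δ` keep the supports inside `U` and the
  -- ball.
  obtain ⟨n₀, hn₀⟩ := ((tendsto_rOut_shrinkingBump (V := V)).eventually
    (ge_mem_nhds hδ)).exists_forall_of_atTop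
  let ψ : ℕ → V → ℝ := fun n =>
    (shrinkingBump V (n + n₀)).normed μ ⋆[ContinuousLinearMap.lsmul ℝ ℝ, μ] φ
  have hfd : ∀ n x, fderiv ℝ (ψ n) x = ((shrinkingBump V (n + n₀)).normed μ
      ⋆[ContinuousLinearMap.lsmul ℝ ℝ, μ] fderiv ℝ φ) x := fun n x =>
    (hasFDerivAt_bump_convolution _ hC x).fderiv
  have hbound : ∀ x, ‖fderiv ℝ φ x‖ ≤ C := fun x => norm_fderiv_le_of_lipschitz ℝ hC
  have hsupp : ∀ n, tsupport (ψ n) ⊆ Metric.cthickening δ (tsupport φ) := by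
    intro n
    refine closure_minimal (fun x hx => ?_) Metric.isClosed_cthickening
    obtain ⟨y, hy, z, hz, rfl⟩ := support_convolution_subset (ContinuousLinearMap.lsmul ℝ ℝ) hx
    rw [ContDiffBump.support_normed_eq, mem_ball_zero_iff] at hy
    refine Metric.mem_cthickening_of_dist_le _ z _ _ (subset_tsupport _ hz) ?_
    rw [dist_eq_norm, add_sub_cancel_right]
    exact hy.le.trans (hn₀ _ (Nat.le_add_left _ _))
  have hint : LocallyIntegrable (fderiv ℝ φ) μ := by
    refine (memLp_top_of_bound (measurable_fderiv ℝ φ).aestronglyMeasurable C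
      (Filter.Eventually.of_forall hbound)).locallyIntegrable le_top
  refine ⟨ψ, R, C, fun n => ?_, fun n => ?_, fun n => ?_, fun n => ?_, fun n x => ?_, ?_⟩
  · exact (ContDiffBump.hasCompactSupport_normed _).contDiff_convolution_left _
      (ContDiffBump.contDiff_normed _) hC.continuous.locallyIntegrable
  · exact HasCompactSupport.of_support_subset_isCompact hc.isCompact.cthickening
      ((subset_tsupport _).trans (hsupp n))
  · exact (hsupp n).trans (hδU.trans inter_subset_left)
  · exact (hsupp n).trans (hδU.trans inter_subset_right)
  · rw [hfd]
    exact norm_bump_convolution_le _ (Filter.Eventually.of_forall hbound) x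
  · filter_upwards [ae_tendsto_shrinkingBump_convolution (μ := μ) hint] with x hx
    simp_rw [hfd]
    exact hx.comp (Filter.tendsto_add_atTop_nat n₀)

end Mollification

/-! ### Smooth and Lipschitz test functions are equivalent -/

section WeakFormulation

variable {N : ℕ} {T : ℝ} {a : ℝ × Space N → Space N}

lemma exists_ae_norm_le (ha : MemLp a ⊤ (volume.restrict (openSlab N T))) :
    ∃ M : ℝ, 0 ≤ M ∧ ∀ᵐ z ∂volume.restrict (openSlab N T), ‖a z‖ ≤ M := by
  have hfin := ha.2
  rw [eLpNorm_exponent_top] at hfin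
  refine ⟨(eLpNormEssSup a (volume.restrict (openSlab N T))).toReal, ENNReal.toReal_nonneg, ?_⟩
  filter_upwards [ae_le_eLpNormEssSup (f := a) (μ := volume.restrict (openSlab N T))] with z hz
  simpa using ENNReal.toReal_mono hfin.ne hz

/-- Essential bounds on bounded subsets of the slab. -/
def SlabBounded (T : ℝ) (u : ℝ × Space N → ℝ) : Prop :=
  AEStronglyMeasurable u (volume.restrict (openSlab N T)) ∧ ∀ R : ℝ, ∃ C : ℝ,
    ∀ᵐ z ∂volume.restrict (openSlab N T), z ∈ Metric.ball (0 : ℝ × Space N) R → |u z| ≤ C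

lemma norm_transportOp_le {F : Type*} [NormedAddCommGroup F] [NormedSpace ℝ F]
    {p : ℝ × Space N → F} {z : ℝ × Space N} {M : ℝ} (hz : ‖a z‖ ≤ M) :
    ‖transportOp a p z‖ ≤ ‖fderiv ℝ p z‖ * max 1 M := by
  refine ((fderiv ℝ p z).le_opNorm _).trans ?_
  gcongr
  rw [Prod.norm_def, norm_one]
  exact max_le_max le_rfl hz

lemma aestronglyMeasurable_transportOp {F : Type*} [NormedAddCommGroup F] [NormedSpace ℝ F]
    [FiniteDimensional ℝ F] (ha : MemLp a ⊤ (volume.restrict (openSlab N T)))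
    (p : ℝ × Space N → F) :
    AEStronglyMeasurable (transportOp a p) (volume.restrict (openSlab N T)) := by
  borelize F
  have h1 : AEStronglyMeasurable (fun z => fderiv ℝ p z) (volume.restrict (openSlab N T)) :=
    (measurable_fderiv ℝ p).aestronglyMeasurable
  have h2 : AEStronglyMeasurable (fun z => ((1 : ℝ), a z)) (volume.restrict (openSlab N T)) :=
    aestronglyMeasurable_const.prodMk ha.1
  exact isBoundedBilinearMap_apply.continuous.comp_aestronglyMeasurable (h1.prodMk h2)

lemma transportOp_eq_zero_of_notMem_tsupport {φ : ℝ × Space N → ℝ} {z : ℝ × Space N}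
    (hz : z ∉ tsupport φ) : transportOp a φ z = 0 := by
  rw [transportOp, fderiv_eq_zero_of_notMem_tsupport hz]; rfl

lemma integrable_mul_transportOp (ha : MemLp a ⊤ (volume.restrict (openSlab N T)))
    {u : ℝ × Space N → ℝ} (hu : SlabBounded T u) {φ : ℝ × Space N → ℝ} (hφ : LocallyLipschitz φ)
    (hc : HasCompactSupport φ) :
    Integrable (fun z => u z * transportOp a φ z) (volume.restrict (openSlab N T)) := by
  obtain ⟨R, hR, hs⟩ := exists_tsupport_subset_ball hc
  obtain ⟨M, hM0, hM⟩ := exists_ae_norm_le ha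
  obtain ⟨C, hC⟩ := hu.2 R
  obtain ⟨L, hL⟩ := exists_lipschitzWith_of_hasCompactSupport hφ hc
  have hint : Integrable ((Metric.ball (0 : ℝ × Space N) R).indicator fun _ => C * (L * max 1 M))
      (volume.restrict (openSlab N T)) :=
    ((integrableOn_const measure_ball_lt_top.ne).integrable_indicator
      Metric.isOpen_ball.measurableSet).restrict
  refine hint.mono' (hu.1.mul (aestronglyMeasurable_transportOp ha φ)) ?_
  filter_upwards [hC, hM] with z hz hzM
  by_cases hzR : z ∈ Metric.ball 0 R
  · rw [indicator_of_mem hzR, norm_mul]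
    refine mul_le_mul (hz hzR) ((norm_transportOp_le hzM).trans ?_) (norm_nonneg _)
      ((abs_nonneg _).trans (hz hzR))
    gcongr
    exact norm_fderiv_le_of_lipschitz ℝ hL
  · rw [indicator_of_notMem hzR, transportOp_eq_zero_of_notMem_tsupport fun h => hzR (hs h)]
    simp

/-- Mollified test functions have uniformly bounded, a.e. convergent derivatives and supports in a
common ball, so dominated convergence applies although `a` is only measurable. -/
theorem lipschitzWeak_of_smooth (ha : MemLp a ⊤ (volume.restrict (openSlab N T)))
    {u : ℝ × Space N → ℝ} (hu : SlabBounded T u)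
    (h : ∀ φ : ℝ × Space N → ℝ, ContDiff ℝ ∞ φ → HasCompactSupport φ → tsupport φ ⊆ openSlab N T →
      ∫ z in openSlab N T, u z * transportOp a φ z = 0) : LipschitzWeak T a u := by
  intro φ hφ hc hs
  obtain ⟨ψ, R, L, hψ, hψc, hψs, hψR, hψL, hlim⟩ :=
    exists_smooth_approximation (μ := volume) hφ hc isOpen_openSlab hs
  obtain ⟨M, hM0, hM⟩ := exists_ae_norm_le ha
  obtain ⟨C, hC⟩ := hu.2 R
  have hint : Integrable ((Metric.ball (0 : ℝ × Space N) R).indicator fun _ => C * (L * max 1 M))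
      (volume.restrict (openSlab N T)) :=
    ((integrableOn_const measure_ball_lt_top.ne).integrable_indicator
      Metric.isOpen_ball.measurableSet).restrict
  have key := tendsto_integral_of_dominated_convergence
    (F := fun n z => u z * transportOp a (ψ n) z) (f := fun z => u z * transportOp a φ z) _
    (fun n => hu.1.mul (aestronglyMeasurable_transportOp ha (ψ n))) hint ?_ ?_
  · simp_rw [h _ (hψ _) (hψc _) (hψs _)] at key
    exact tendsto_nhds_unique key tendsto_const_nhds
  · intro n
    filter_upwards [hC, hM] with z hz hzM
    by_cases hzR : z ∈ Metric.ball 0 R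
    · rw [indicator_of_mem hzR, norm_mul]
      refine mul_le_mul (hz hzR) ((norm_transportOp_le hzM).trans ?_) (norm_nonneg _)
        ((abs_nonneg _).trans (hz hzR))
      gcongr
      exact hψL n z
    · rw [indicator_of_notMem hzR, transportOp_eq_zero_of_notMem_tsupport fun h => hzR (hψR n h)]
      simp
  · filter_upwards [ae_restrict_of_ae hlim] with z hz
    exact (((ContinuousLinearMap.apply ℝ ℝ ((1 : ℝ),
      a z)).continuous.tendsto _).comp hz).const_mul _

lemma LipschitzWeak.smooth {u : ℝ × Space N → ℝ} (h : LipschitzWeak T a u) :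
    ∀ φ : ℝ × Space N → ℝ, ContDiff ℝ ∞ φ → HasCompactSupport φ → tsupport φ ⊆ openSlab N T →
      ∫ z in openSlab N T, u z * transportOp a φ z = 0 := fun φ hφ hc hs =>
  h φ ((hφ.of_le (by simp)).locallyLipschitz (𝕂 := ℝ)) hc hs

end WeakFormulation

/-! ### Nonnegative weak solutions vanish on the exceptional support -/

section Vanishing

variable {N : ℕ} {T : ℝ} {a : ℝ × Space N → Space N}

lemma restrict_openSlab (N : ℕ) (T : ℝ) :
    (volume : Measure (ℝ × Space N)).restrict (openSlab N T) =
      (volume.restrict (Ioo 0 T)).prod (volume : Measure (Space N)) := by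
  rw [openSlab, Measure.volume_eq_prod, ← Measure.prod_restrict, Measure.restrict_univ]

lemma ae_slice_of_ae_openSlab {P : ℝ × Space N → Prop}
    (h : ∀ᵐ z ∂volume.restrict (openSlab N T), P z) :
    ∀ᵐ t ∂volume.restrict (Ioo 0 T), ∀ᵐ x : Space N, P (t, x) := by
  rw [restrict_openSlab] at h
  exact Measure.ae_ae_of_ae_prod h

/-- The converse direction of Fubini needs measurability: the exceptional set is exchanged for an
a.e. equal measurable subset, whose slices are null. -/
lemma ae_openSlab_of_ae_slice {P : ℝ × Space N → Prop}
    (hP : NullMeasurableSet {z | P z} (volume.restrict (openSlab N T)))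
    (h : ∀ᵐ t ∂volume.restrict (Ioo 0 T), ∀ᵐ x : Space N, P (t, x)) :
    ∀ᵐ z ∂volume.restrict (openSlab N T), P z := by
  rw [restrict_openSlab] at hP ⊢
  obtain ⟨s, hsub, hs, hse⟩ := hP.compl.exists_measurable_subset_ae_eq
  rw [ae_iff]
  change ((volume.restrict (Ioo 0 T)).prod volume) {z | P z}ᶜ = 0
  rw [← measure_congr hse, Measure.measure_prod_null hs]
  filter_upwards [h] with t ht
  refine measure_mono_null (fun x hx => ?_) ht
  exact hsub hx

lemma ae_openSlab_of_forall_slice {P : ℝ × Space N → Prop}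
    (hP : NullMeasurableSet {z | P z} (volume.restrict (openSlab N T)))
    (h : ∀ t ∈ Icc 0 T, ∀ᵐ x : Space N, P (t, x)) :
    ∀ᵐ z ∂volume.restrict (openSlab N T), P z :=
  ae_openSlab_of_ae_slice hP (by
    filter_upwards [ae_restrict_mem measurableSet_Ioo] with t ht
    exact h t (Ioo_subset_Icc_self ht))

lemma LocallyBounded.slabBounded {π : ℝ → Space N → ℝ} (hb : LocallyBounded T π)
    (hm : AEStronglyMeasurable (fun z : ℝ × Space N => π z.1 z.2)
      (volume.restrict (openSlab N T))) : SlabBounded T fun z => π z.1 z.2 := by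
  refine ⟨hm, fun R => ?_⟩
  obtain ⟨C, hC0, hC⟩ := hb R
  refine ⟨C, ?_⟩
  have h1 : NullMeasurableSet {z : ℝ × Space N | |π z.1 z.2| ≤ C}
      (volume.restrict (openSlab N T)) :=
    nullMeasurableSet_le hm.aemeasurable.abs aemeasurable_const
  have h2 : MeasurableSet {z : ℝ × Space N | z ∈ Metric.ball (0 : ℝ × Space N) R} :=
    Metric.isOpen_ball.measurableSet
  refine ae_openSlab_of_forall_slice ?_ fun t ht => ?_
  · have : {z : ℝ × Space N | z ∈ Metric.ball (0 : ℝ × Space N) R → |π z.1 z.2| ≤ C} =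
        {z : ℝ × Space N | z ∈ Metric.ball (0 : ℝ × Space N) R}ᶜ ∪
          {z : ℝ × Space N | |π z.1 z.2| ≤ C} := by
      ext z; simp [imp_iff_not_or]
    rw [this]
    exact h2.compl.nullMeasurableSet.union h1
  · filter_upwards [hC t ht] with x hx hz
    refine hx ?_
    rw [mem_ball_zero_iff, Prod.norm_def, max_lt_iff] at hz
    simpa using hz.2

lemma transportOp_comp_fst {φ : ℝ × Space N → ℝ} {z : ℝ × Space N} (f : ℝ → ℝ) {c : ℝ}
    (hf : HasDerivAt f c z.1) (hφ : φ = fun w => f w.1) : transportOp a φ z = c := by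
  have h : HasFDerivAt φ (c • ContinuousLinearMap.fst ℝ ℝ (Space N)) z := by
    rw [hφ]
    exact hf.comp_hasFDerivAt z hasFDerivAt_fst
  rw [transportOp, h.fderiv]
  simp

/-- A test function built from `p` has nonnegative transport derivative, positive where `|p|` and
`t` exceed `δ` and `|x| < R`. Tested against `u ≥ 0`, the equation forces `u` to vanish there, and
`δ → 0`, `R → ∞` exhaust the set where `p` is nonzero. -/
theorem ae_eq_zero_of_exceptional (hT : 0 < T) (ha : MemLp a ⊤ (volume.restrict (openSlab N T)))
    {u : ℝ × Space N → ℝ} (hu : SlabBounded T u) (hw : LipschitzWeak T a u)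
    (hu0 : ∀ᵐ z ∂volume.restrict (openSlab N T), 0 ≤ u z) {p : ℝ × Space N → ℝ}
    (hp : p ∈ exceptionalSolutions T a) :
    ∀ᵐ z ∂volume.restrict (openSlab N T), p z ≠ 0 → u z = 0 := by
  obtain ⟨hpL, hpS, hpT⟩ := hp
  obtain ⟨q, hq, hqp, hqT⟩ := exists_locallyLipschitz_extension hT.le hpL
  have hqS := hpS.congr hqp
  obtain ⟨M, hM0, hM⟩ := exists_ae_norm_le ha
  have key : ∀ δ R : ℝ, 0 < δ → 0 < R → ∀ᵐ z ∂volume.restrict (openSlab N T),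
      δ < z.1 → δ < |q z| → ‖z.2‖ < R → u z = 0 := by
    intro δ R hδ hR
    -- `A` increases in time and cuts off small times. `B` is transported by the equation. The cone
    -- `ψ` expands at speed `M`, which bounds `|a|`, so it is nondecreasing along `(1, a)`.
    let A : ℝ × Space N → ℝ := fun z => max (z.1 - δ) 0
    let β : ℝ → ℝ := fun y => max (|y| - δ) 0
    let B : ℝ × Space N → ℝ := fun z => β (q z)
    let ψ : ℝ × Space N → ℝ := fun z => max (R + M * z.1 - ‖z.2‖) 0
    have hfst : LocallyLipschitz (Prod.fst : ℝ × Space N → ℝ) :=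
      LipschitzWith.prod_fst.locallyLipschitz
    have hsnd : LocallyLipschitz (fun z : ℝ × Space N => ‖z.2‖) :=
      lipschitzWith_one_norm.locallyLipschitz.comp LipschitzWith.prod_snd.locallyLipschitz
    have hA : LocallyLipschitz A := (locallyLipschitz_sub hfst
      (LocallyLipschitz.const δ)).max_const 0
    have hβ : LocallyLipschitz β :=
      (locallyLipschitz_sub lipschitzWith_one_norm.locallyLipschitz
        (LocallyLipschitz.const δ)).max_const 0
    have hB : LocallyLipschitz B := hβ.comp hq
    have hψ : LocallyLipschitz ψ := (locallyLipschitz_sub (locallyLipschitz_add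
      (LocallyLipschitz.const R) (locallyLipschitz_mul (LocallyLipschitz.const M) hfst))
      hsnd).max_const 0
    have hBψ := locallyLipschitz_mul hB hψ
    let φ : ℝ × Space N → ℝ := fun z => A z * (B z * ψ z)
    have hφ : LocallyLipschitz φ := locallyLipschitz_mul hA hBψ
    let K : Set (ℝ × Space N) := {z | δ ≤ z.1 ∧ δ ≤ |q z| ∧ ‖z.2‖ ≤ R + M * z.1}
    -- From time `T` on the extension `q` is identically 0, so no point of `K` lies there; this
    -- gives compact support in the open slab.
    have hKT : ∀ z ∈ K, z.1 < T := by
      intro z hz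
      by_contra! h
      have h1 := hz.2.1
      rw [show z = (z.1, z.2) from rfl, hqT _ _ h, hpT, abs_zero] at h1
      linarith
    have hKc : IsClosed K :=
      (isClosed_le continuous_const continuous_fst).inter
        ((isClosed_le continuous_const hq.continuous.abs).inter
          (isClosed_le continuous_snd.norm (by fun_prop)))
    have hKcomp : IsCompact K := by
      refine (isCompact_Icc.prod (isCompact_closedBall (0 : Space N)
        (R + M * T))).of_isClosed_subset
        hKc (s := Icc 0 T ×ˢ Metric.closedBall (0 : Space N) (R + M * T)) fun z hz => ?_
      refine ⟨⟨hδ.le.trans hz.1, (hKT z hz).le⟩, mem_closedBall_zero_iff.2 (hz.2.2.trans ?_)⟩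
      have := (hKT z hz).le
      gcongr
    have hsupp : Function.support φ ⊆ K := by
      intro z hz
      have hz' : A z * (B z * ψ z) ≠ 0 := hz
      have h1 := left_ne_zero_of_mul hz'
      have h2 := left_ne_zero_of_mul (right_ne_zero_of_mul hz')
      have h3 := right_ne_zero_of_mul (right_ne_zero_of_mul hz')
      refine ⟨?_, ?_, ?_⟩
      · by_contra! h
        exact h1 (max_eq_right (by linarith))
      · by_contra! h
        exact h2 (max_eq_right (by linarith))
      · by_contra! h
        exact h3 (max_eq_right (by linarith))
    have hts : tsupport φ ⊆ K := closure_minimal hsupp hKc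
    have hφc : HasCompactSupport φ := HasCompactSupport.of_support_subset_isCompact hKcomp hsupp
    have hφs : tsupport φ ⊆ openSlab N T := fun z hz =>
      mem_openSlab.2 ⟨hδ.trans_le (hts hz).1, hKT z (hts hz)⟩
    have hder : ∀ᵐ z ∂volume.restrict (openSlab N T), 0 ≤ transportOp a φ z ∧
        (δ < z.1 → δ < |q z| → ‖z.2‖ < R → 0 < transportOp a φ z) := by
      filter_upwards [hM, hqS.comp hq hβ,
        ae_restrict_of_ae (ae_differentiableAt_of_locallyLipschitz (μ := volume) hA),
        ae_restrict_of_ae (ae_differentiableAt_of_locallyLipschitz (μ := volume) hB),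
        ae_restrict_of_ae (ae_differentiableAt_of_locallyLipschitz (μ := volume) hψ),
        ae_restrict_mem measurableSet_openSlab] with z hz hzB hA' hB' hψ' hzs
      have hz0 : 0 < z.1 := (mem_openSlab.1 hzs).1
      have e : transportOp a φ z = A z * (B z * transportOp a ψ z) +
          B z * ψ z * transportOp a A z := by
        have h1 : fderiv ℝ φ z = _ := fderiv_fun_mul hA' (hB'.mul hψ')
        have h2 : fderiv ℝ (fun w => B w * ψ w) z = _ := fderiv_fun_mul hB' hψ'
        have h3 : fderiv ℝ B z (1, a z) = 0 := hzB
        have h4 : fderiv ℝ φ z (1, a z) = A z * fderiv ℝ (fun w => B w * ψ w) z (1, a z) +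
            B z * ψ z * fderiv ℝ A z (1, a z) := by rw [h1]; rfl
        have h5 : fderiv ℝ (fun w => B w * ψ w) z (1, a z) = B z * fderiv ℝ ψ z (1, a z) +
            ψ z * fderiv ℝ B z (1, a z) := by rw [h2]; rfl
        simp only [transportOp, h4, h5, h3, mul_zero, add_zero]
      have hA0 : 0 ≤ A z := le_max_right _ _
      have hB0 : 0 ≤ B z := le_max_right _ _
      have hψ0 : 0 ≤ ψ z := le_max_right _ _
      have hDA : 0 ≤ transportOp a A z := fderiv_apply_nonneg hA' fun s hs => by
        simp only [A, Prod.fst_add, Prod.smul_fst, smul_eq_mul, mul_one]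
        exact max_le_max (by linarith) le_rfl
      have hDψ : 0 ≤ transportOp a ψ z := fderiv_apply_nonneg hψ' fun s hs => by
        simp only [ψ, Prod.fst_add, Prod.smul_fst, smul_eq_mul, mul_one, Prod.snd_add,
          Prod.smul_snd]
        refine max_le_max ?_ le_rfl
        have h1 : ‖z.2 + s • a z‖ ≤ ‖z.2‖ + s * M := by
          refine (norm_add_le _ _).trans ?_
          rw [norm_smul, Real.norm_of_nonneg hs.le]
          gcongr
        nlinarith
      refine ⟨by rw [e]; positivity, fun h1 h2 h3 => ?_⟩
      have hDA1 : transportOp a A z = 1 := by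
        have hd : HasDerivAt (fun s : ℝ => max (s - δ) 0) 1 z.1 := by
          refine ((hasDerivAt_id z.1).sub_const δ).congr_of_eventuallyEq ?_
          filter_upwards [lt_mem_nhds h1] with s hs
          exact max_eq_left (sub_pos.2 hs).le
        exact transportOp_comp_fst _ hd rfl
      have hBpos : 0 < B z := lt_max_of_lt_left (sub_pos.2 h2)
      have hψpos : 0 < ψ z := lt_max_of_lt_left (by nlinarith)
      rw [e, hDA1]
      positivity
    have hint := integrable_mul_transportOp ha hu hφ hφc
    have hzero := (integral_eq_zero_iff_of_nonneg_ae (by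
      filter_upwards [hu0, hder] with z h1 h2
      exact mul_nonneg h1 h2.1) hint).1 (hw φ hφ hφc hφs)
    filter_upwards [hzero, hder] with z h1 h2 h3 h4 h5
    exact (mul_eq_zero.1 h1).resolve_right (h2.2 h3 h4 h5).ne'
  have hall := ae_all_iff.2 fun n : ℕ => key (1 / (n + 1)) (n + 1) (by positivity) (by positivity)
  filter_upwards [hall, ae_restrict_mem measurableSet_openSlab] with z hz hzs hpz
  have hz0 : 0 < z.1 := (mem_openSlab.1 hzs).1
  have hq0 : 0 < |q z| := abs_pos.2 (by rwa [hqp (openSlab_subset_closedSlab hzs)])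
  obtain ⟨n, hn⟩ := (((tendsto_one_div_add_atTop_nhds_zero_nat (𝕜 := ℝ)).eventually
    (gt_mem_nhds hz0)).and ((tendsto_one_div_add_atTop_nhds_zero_nat.eventually
    (gt_mem_nhds hq0)).and (tendsto_natCast_atTop_atTop.eventually_gt_atTop ‖z.2‖))).exists
  exact hz n hn.1 hn.2.1 (hn.2.2.trans (lt_add_one _))

theorem isOpen_exceptionalSupport : IsOpen (exceptionalSupport T a) := by
  refine isOpen_biUnion fun p hp => ?_
  exact (hp.1.continuousOn.mono openSlab_subset_closedSlab).isOpen_inter_preimage isOpen_openSlab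
    isOpen_compl_singleton

lemma exceptionalSupport_subset : exceptionalSupport T a ⊆ openSlab N T :=
  iUnion₂_subset fun _ _ => sep_subset _ _

/-- The union over all exceptional solutions is uncountable, but the sets are open, so by the
Lindelöf property countably many cover it. -/
theorem ae_eq_zero_on_exceptionalSupport (hT : 0 < T)
    (ha : MemLp a ⊤ (volume.restrict (openSlab N T))) {u : ℝ × Space N → ℝ} (hu : SlabBounded T u)
    (hw : LipschitzWeak T a u) (hu0 : ∀ᵐ z ∂volume.restrict (openSlab N T), 0 ≤ u z) :
    ∀ᵐ z ∂volume.restrict (openSlab N T), z ∈ exceptionalSupport T a → u z = 0 := by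
  have hopen : ∀ p : exceptionalSolutions T a, IsOpen {z ∈ openSlab N T | p.1 z ≠ 0} := fun p =>
    (p.2.1.continuousOn.mono openSlab_subset_closedSlab).isOpen_inter_preimage isOpen_openSlab
      isOpen_compl_singleton
  obtain ⟨S, hSc, hS⟩ := TopologicalSpace.isOpen_iUnion_countable _ hopen
  have hall := (ae_ball_iff hSc).2 fun p _ => ae_eq_zero_of_exceptional hT ha hu hw hu0 p.2
  filter_upwards [hall] with z hz hmem
  rw [exceptionalSupport, biUnion_eq_iUnion, ← hS] at hmem
  obtain ⟨p, hp, hzp⟩ := mem_iUnion₂.1 hmem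
  exact hz p hp hzp.2

end Vanishing

/-! ### From almost every time to every time -/

section TimeContinuity

variable {N : ℕ} {T : ℝ} {a : ℝ × Space N → Space N}

/-- The continuous functions `max f g` and `g` agree a.e., hence everywhere on the interval. -/
lemma le_on_Icc_of_ae_le (hT : 0 < T) {f g : ℝ → ℝ} (hf : ContinuousOn f (Icc 0 T))
    (hg : ContinuousOn g (Icc 0 T)) (h : ∀ᵐ t ∂volume.restrict (Ioo 0 T), f t ≤ g t) :
    ∀ t ∈ Icc 0 T, f t ≤ g t := by
  have h1 : (fun t => max (f t) (g t)) =ᵐ[volume.restrict (Icc 0 T)] g := by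
    rw [restrict_Ioo_eq_restrict_Icc] at h
    filter_upwards [h] with t ht
    exact max_eq_right ht
  intro t ht
  have := Measure.eqOn_Icc_of_ae_eq volume hT.ne h1 (hf.sup hg) hg ht
  exact max_eq_right_iff.1 this

lemma WeakStarContinuous.integrable_mul {π : ℝ → Space N → ℝ} (hπ : WeakStarContinuous T π) {t : ℝ}
    (ht : t ∈ Icc 0 T) {φ : Space N → ℝ} (hφ : Integrable φ) (hc : HasCompactSupport φ) :
    Integrable fun x => π t x * φ x := by
  have h := hπ.locBounded t ht _ hc.isCompact
  have h1 : IntegrableOn (fun x => π t x * φ x) (tsupport φ) := by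
    have := (memLp_one_iff_integrable.2 hφ.integrableOn).mul (r := 1) h (μ :=
      volume.restrict (tsupport φ))
    exact memLp_one_iff_integrable.1 this
  rw [← integrableOn_univ]
  refine h1.of_forall_sdiff_eq_zero MeasurableSet.univ fun x hx => ?_
  rw [image_eq_zero_of_notMem_tsupport hx.2, mul_zero]

/-- With `t` fixed, both curves are tested against the indicator of the part of a ball where the
inequality fails at time `t`. The integrals are ordered at almost every time, hence also at `t`, so
that set is null. -/
theorem WeakStarContinuous.ae_le (hT : 0 < T) {π ρ : ℝ → Space N → ℝ} (hπ : WeakStarContinuous T π)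
    (hρ : WeakStarContinuous T ρ)
    (h : ∀ᵐ z ∂volume.restrict (openSlab N T), π z.1 z.2 ≤ ρ z.1 z.2) :
    ∀ t ∈ Icc 0 T, ∀ᵐ x, π t x ≤ ρ t x := by
  intro t ht
  have key : ∀ n : ℕ, ∀ᵐ x, x ∈ Metric.closedBall (0 : Space N) n → π t x ≤ ρ t x := by
    intro n
    set B := Metric.closedBall (0 : Space N) n
    have hBm : MeasurableSet B := Metric.isClosed_closedBall.measurableSet
    have hBc : IsCompact B := isCompact_closedBall _ _
    have h1 := (hπ.locBounded t ht B hBc).1.aemeasurable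
    have h2 := (hρ.locBounded t ht B hBc).1.aemeasurable
    let S : Set (Space N) := {x | h2.mk _ x < h1.mk _ x} ∩ B
    have hS : MeasurableSet S := (measurableSet_lt h2.measurable_mk h1.measurable_mk).inter hBm
    have hφ : Integrable (S.indicator fun _ => (1 : ℝ)) :=
      (integrable_indicator_iff hS).2 (integrableOn_const
        ((measure_mono inter_subset_right).trans_lt hBc.measure_lt_top).ne)
    have hc : HasCompactSupport (S.indicator fun _ => (1 : ℝ)) :=
      HasCompactSupport.of_support_subset_isCompact hBc (support_indicator_subset.trans
        inter_subset_right)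
    have h0 : ∀ x, 0 ≤ S.indicator (fun _ => (1 : ℝ)) x := indicator_nonneg fun _ _ => zero_le_one
    have hle := le_on_Icc_of_ae_le hT (hπ.continuous _ hφ hc) (hρ.continuous _ hφ hc) (by
      filter_upwards [ae_slice_of_ae_openSlab h, ae_restrict_mem measurableSet_Ioo] with s hs hs'
      have hs'' := Ioo_subset_Icc_self hs'
      refine integral_mono_ae (hπ.integrable_mul hs'' hφ hc) (hρ.integrable_mul hs'' hφ hc) ?_
      filter_upwards [hs] with x hx
      exact mul_le_mul_of_nonneg_right hx (h0 x)) t ht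
    rw [← sub_nonneg, ← integral_sub (hρ.integrable_mul ht hφ hc) (hπ.integrable_mul ht hφ hc)]
      at hle
    have hae1 := (ae_restrict_iff' hBm).1 h1.ae_eq_mk
    have hae2 := (ae_restrict_iff' hBm).1 h2.ae_eq_mk
    have hnonpos : ∀ᵐ x, 0 ≤ -(ρ t x * S.indicator (fun _ => (1 : ℝ)) x -
        π t x * S.indicator (fun _ => (1 : ℝ)) x) := by
      filter_upwards [hae1, hae2] with x hx1 hx2
      by_cases hx : x ∈ S
      · have h3 : h2.mk _ x < h1.mk _ x := hx.1
        rw [← hx1 hx.2, ← hx2 hx.2] at h3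
        simp [hx, h3.le]
      · simp [hx]
    have hint := ((hρ.integrable_mul ht hφ hc).sub (hπ.integrable_mul ht hφ hc)).neg
    have hzero : ∫ x, -(ρ t x * S.indicator (fun _ => (1 : ℝ)) x -
        π t x * S.indicator (fun _ => (1 : ℝ)) x) = 0 :=
      le_antisymm (by rw [integral_neg]; linarith) (integral_nonneg_of_ae hnonpos)
    have := (integral_eq_zero_iff_of_nonneg_ae hnonpos hint).1 hzero
    filter_upwards [this, hae1, hae2] with x hx hx1 hx2 hxB
    by_contra! hlt
    have hxS : x ∈ S := ⟨by
      show h2.mk _ x < h1.mk _ x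
      rwa [← hx1 hxB, ← hx2 hxB], hxB⟩
    simp only [hxS, indicator_of_mem, mul_one, Pi.zero_apply] at hx
    linarith
  filter_upwards [ae_all_iff.2 key] with x hx
  obtain ⟨n, hn⟩ := exists_nat_ge ‖x‖
  exact hx n (by simpa using hn)

theorem WeakStarContinuous.ae_eq (hT : 0 < T) {π ρ : ℝ → Space N → ℝ} (hπ : WeakStarContinuous T π)
    (hρ : WeakStarContinuous T ρ)
    (h : ∀ᵐ z ∂volume.restrict (openSlab N T), π z.1 z.2 = ρ z.1 z.2) :
    ∀ t ∈ Icc 0 T, ∀ᵐ x, π t x = ρ t x := by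
  intro t ht
  filter_upwards [hπ.ae_le hT hρ (h.mono fun _ => le_of_eq) t ht,
    hρ.ae_le hT hπ (h.mono fun _ hz => hz.ge) t ht] with x h1 h2
  exact le_antisymm h1 h2

/-- Continuity in time of the integral of a Jacobian against a moving test function. -/
lemma continuousOn_integral_spaceJac_mul_moving {q : ℝ × Space N → Space N}
    (hq : LocallyLipschitz q) {H : ℝ × Space N → ℝ} (hH : LocallyLipschitz H) {R : ℝ}
    (hR : ∀ t ∈ Icc 0 T, ∀ x, H (t, x) ≠ 0 → x ∈ Metric.closedBall (0 : Space N) R) :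
    ContinuousOn (fun t => ∫ x, spaceJac q t x * H (t, x)) (Icc 0 T) := by
  have hc : ∀ t ∈ Icc 0 T, HasCompactSupport fun x => H (t, x) := fun t ht =>
    HasCompactSupport.of_support_subset_isCompact (isCompact_closedBall 0 R) fun x hx =>
      hR t ht x hx
  have hint : ∀ s ∈ Icc 0 T, ∀ t ∈ Icc 0 T, Integrable fun x => spaceJac q s x * H (t, x) :=
    fun s hs t ht => (weakStarContinuous_spaceJac hq T).integrable_mul hs
      ((locallyLipschitz_slice hH t).continuous.integrable_of_hasCompactSupport (hc t ht)) (hc t ht)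
  obtain ⟨C, hC0, hC⟩ := abs_spaceJac_le hq T (R + 1)
  obtain ⟨K, g, hg, hHg⟩ := exists_lipschitzWith_eqOn_closedBall hH (max |T| (|R| + 1))
  have hHK : ∀ s ∈ Icc 0 T, ∀ t ∈ Icc 0 T, ∀ x ∈ Metric.closedBall (0 : Space N) R,
      |H (s, x) - H (t, x)| ≤ K * |s - t| := by
    intro s hs t ht x hx
    have hmem : ∀ t ∈ Icc 0 T, ((t, x) : ℝ × Space N) ∈ Metric.closedBall 0 (max |T| (|R| + 1)) :=
      by
      intro t ht
      rw [mem_closedBall_zero_iff, Prod.norm_def, Real.norm_of_nonneg ht.1]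
      refine max_le_max (ht.2.trans (le_abs_self T)) ?_
      have := mem_closedBall_zero_iff.1 hx
      linarith [le_abs_self R]
    rw [hHg (hmem t ht), hHg (hmem s hs)]
    simpa [Prod.dist_eq, Real.dist_eq] using hg.dist_le_mul (s, x) (t, x)
  intro t₀ ht₀
  -- The test function is frozen at `t₀`: the first term is continuous by weak continuity of
  -- Jacobians, the second is of order `|t - t₀|`.
  have hsplit : ∀ t ∈ Icc 0 T, ∫ x, spaceJac q t x * H (t, x) =
      (∫ x, spaceJac q t x * H (t₀, x)) + ∫ x, spaceJac q t x * (H (t, x) - H (t₀, x)) := by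
    intro t ht
    simp_rw [mul_sub]
    rw [integral_sub (hint t ht t ht) (hint t ht t₀ ht₀)]
    ring
  have h1 := continuousOn_integral_spaceJac_mul (T := T) hq (locallyLipschitz_slice hH t₀)
    (hc t₀ ht₀) t₀ ht₀
  have h2 : Filter.Tendsto (fun t => ∫ x, spaceJac q t x * (H (t, x) - H (t₀, x)))
      (𝓝[Icc 0 T] t₀) (𝓝 0) := by
    set m := volume.real (Metric.closedBall (0 : Space N) R)
    have hlim : Filter.Tendsto (fun t => C * (K * |t - t₀|) * m) (𝓝[Icc 0 T] t₀) (𝓝 0) := by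
      have : Continuous fun t => C * (K * |t - t₀|) * m := by fun_prop
      have h := this.tendsto t₀
      simp only [sub_self, abs_zero, mul_zero, zero_mul] at h
      exact h.mono_left nhdsWithin_le_nhds
    refine squeeze_zero_norm' ?_ hlim
    filter_upwards [self_mem_nhdsWithin] with t ht
    rw [← setIntegral_eq_integral_of_forall_compl_eq_zero (s := Metric.closedBall (0 : Space N) R)]
    · refine norm_setIntegral_le_of_norm_le_const measure_closedBall_lt_top fun x hx => ?_
      rw [norm_mul]
      exact mul_le_mul (hC t ht x (Metric.closedBall_subset_ball (lt_add_one R) hx))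
        (hHK t ht t₀ ht₀ x hx) (norm_nonneg _) hC0
    · intro x hx
      have e1 : H (t, x) = 0 := by_contra fun h => hx (hR t ht x h)
      have e2 : H (t₀, x) = 0 := by_contra fun h => hx (hR t₀ ht₀ x h)
      simp [e1, e2]
  have h3 : Filter.Tendsto (fun t => (∫ x, spaceJac q t x * H (t₀, x)) +
      ∫ x, spaceJac q t x * (H (t, x) - H (t₀, x))) (𝓝[Icc 0 T] t₀)
      (𝓝 (∫ x, spaceJac q t₀ x * H (t₀, x))) := by
    simpa using Filter.Tendsto.add h1 h2
  refine h3.congr' ?_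
  filter_upwards [self_mem_nhdsWithin] with t ht
  rw [hsplit t ht]

/-- A continuous function whose weak derivative vanishes is constant. -/
lemma eq_of_forall_integral_deriv_mul_eq_zero (hT : 0 < T) {m : ℝ → ℝ}
    (hm : ContinuousOn m (Icc 0 T))
    (h : ∀ θ : ℝ → ℝ, LocallyLipschitz θ → tsupport θ ⊆ Ioo 0 T →
      ∫ t in Ioo 0 T, deriv θ t * m t = 0) : ∀ t ∈ Icc 0 T, m t = m T := by
  have key : ∀ r s : ℝ, 0 < r → r < s → s < T → m r = m s := by
    intro r s hr hrs hsT
    have hmt : ∀ t ∈ Ioo 0 T, ContinuousAt m t := fun t ht =>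
      (hm t (Ioo_subset_Icc_self ht)).continuousAt (Icc_mem_nhds ht.1 ht.2)
    have hstep : ∀ δ : ℝ, 0 < δ → s + δ < T → ∫ t in r..(r + δ), m t = ∫ t in s..(s + δ), m t := by
      intro δ hδ hsδ
      -- `θ` is a trapezoid with slope 1 on `(r, r + δ)` and slope -1 on `(s, s + δ)`, so the
      -- hypothesis says that `m` has the same integral over both intervals.
      let κ : ℝ → ℝ := fun y => min (max y 0) δ
      let θ : ℝ → ℝ := fun t => κ (t - r) - κ (t - s)
      have hκ : LocallyLipschitz κ := (LocallyLipschitz.id.max_const 0).min_const δ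
      have hθ : LocallyLipschitz θ := locallyLipschitz_sub
        (hκ.comp (locallyLipschitz_sub LocallyLipschitz.id (LocallyLipschitz.const r)))
        (hκ.comp (locallyLipschitz_sub LocallyLipschitz.id (LocallyLipschitz.const s)))
      have hsupp : tsupport θ ⊆ Ioo 0 T := by
        refine Subset.trans (closure_minimal (t := Icc r (s + δ)) (fun t ht => ?_) isClosed_Icc)
          fun t ht => ⟨hr.trans_le ht.1, ht.2.trans_lt hsδ⟩
        by_contra hcon
        refine ht ?_
        rw [mem_Icc, not_and_or, not_le, not_le] at hcon
        rcases hcon with hcon | hcon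
        · simp only [θ, κ]
          rw [max_eq_right (by linarith), max_eq_right (by linarith), sub_self]
        · simp only [θ, κ]
          rw [max_eq_left (by linarith), max_eq_left (by linarith), min_eq_right (by linarith),
            min_eq_right (by linarith), sub_self]
      have hκ' : ∀ y, y ≠ 0 → y ≠ δ → HasDerivAt κ ((Ioo 0 δ).indicator (fun _ => 1) y) y := by
        intro y h0 hδ'
        rcases lt_or_gt_of_ne h0 with hy | hy
        · rw [indicator_of_notMem fun h => (h.1.trans hy).false]
          refine (hasDerivAt_const y (0 : ℝ)).congr_of_eventuallyEq ?_
          filter_upwards [gt_mem_nhds hy] with w hw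
          simp only [κ]
          rw [max_eq_right hw.le, min_eq_left hδ.le]
        rcases lt_or_gt_of_ne hδ' with hy' | hy'
        · rw [indicator_of_mem (show y ∈ Ioo 0 δ from ⟨hy, hy'⟩)]
          refine (hasDerivAt_id y).congr_of_eventuallyEq ?_
          filter_upwards [Ioo_mem_nhds hy hy'] with w hw
          simp only [κ]
          rw [max_eq_left hw.1.le, min_eq_left hw.2.le, id]
        · rw [indicator_of_notMem fun h => (h.2.trans hy').false]
          refine (hasDerivAt_const y δ).congr_of_eventuallyEq ?_
          filter_upwards [lt_mem_nhds hy'] with w hw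
          simp only [κ]
          rw [max_eq_left (hδ.trans hw).le, min_eq_right hw.le]
      have hθ' : ∀ᵐ t, deriv θ t = (Ioo r (r + δ)).indicator (fun _ => 1) t -
          (Ioo s (s + δ)).indicator (fun _ => 1) t := by
        have hfin : ∀ᵐ t : ℝ, t ∉ ({r, r + δ, s, s + δ} : Set ℝ) :=
          (toFinite ({r, r + δ, s, s + δ} : Set ℝ)).countable.ae_notMem volume
        filter_upwards [hfin] with t ht
        simp only [mem_insert_iff, mem_singleton_iff, not_or] at ht
        have d : ∀ c : ℝ, t ≠ c → t ≠ c + δ → HasDerivAt (fun t => κ (t - c))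
            ((Ioo c (c + δ)).indicator (fun _ => 1) t) t := by
          intro c h1 h2
          have := (hκ' (t - c) (sub_ne_zero.2 h1) fun h => h2 (by linarith)).comp_sub_const t c
          have e : (Ioo c (c + δ)).indicator (fun _ => (1 : ℝ)) t =
              (Ioo 0 δ).indicator (fun _ => 1) (t - c) := by
            simp only [indicator_apply, mem_Ioo, sub_pos, sub_lt_iff_lt_add']
          rw [e]
          exact this
        exact ((d r ht.1 ht.2.1).sub (d s ht.2.2.1 ht.2.2.2)).deriv
      have hI : ∀ c : ℝ, 0 < c → c + δ < T → IntegrableOn m (Ioo c (c + δ)) ∧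
          ∫ t in Ioo 0 T, (Ioo c (c + δ)).indicator (fun _ => (1 : ℝ)) t * m t =
            ∫ t in c..(c + δ), m t := by
        intro c hc hcδ
        have hsub : Icc c (c + δ) ⊆ Icc 0 T := Icc_subset_Icc hc.le hcδ.le
        have hi : IntegrableOn m (Icc c (c + δ)) :=
          (hm.mono hsub).integrableOn_compact isCompact_Icc
        refine ⟨hi.mono_set Ioo_subset_Icc_self, ?_⟩
        have : (fun t => (Ioo c (c + δ)).indicator (fun _ => (1 : ℝ)) t * m t) =
            (Ioo c (c + δ)).indicator m := by
          ext t; by_cases ht : t ∈ Ioo c (c + δ) <;> simp [ht]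
        rw [this, setIntegral_indicator measurableSet_Ioo,
          inter_eq_self_of_subset_right (Ioo_subset_Ioo hc.le hcδ.le),
          intervalIntegral.integral_of_le (by linarith), integral_Ioc_eq_integral_Ioo]
      have h0 := h θ hθ hsupp
      have e : ∫ t in Ioo 0 T, deriv θ t * m t =
          ∫ t in Ioo 0 T, ((Ioo r (r + δ)).indicator (fun _ => (1 : ℝ)) t * m t -
            (Ioo s (s + δ)).indicator (fun _ => (1 : ℝ)) t * m t) := by
        refine integral_congr_ae ?_
        filter_upwards [ae_restrict_of_ae hθ'] with t ht
        rw [ht, sub_mul]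
      have hint : ∀ c : ℝ, 0 < c → c + δ < T → Integrable
          (fun t => (Ioo c (c + δ)).indicator (fun _ => (1 : ℝ)) t * m t)
          (volume.restrict (Ioo 0 T)) := by
        intro c hc hcδ
        have : (fun t => (Ioo c (c + δ)).indicator (fun _ => (1 : ℝ)) t * m t) =
            (Ioo c (c + δ)).indicator m := by
          ext t; by_cases ht : t ∈ Ioo c (c + δ) <;> simp [ht]
        rw [this]
        exact ((integrable_indicator_iff measurableSet_Ioo).2 (hI c hc hcδ).1).restrict
      rw [e, integral_sub (hint r hr (by linarith)) (hint s (hr.trans hrs) hsδ),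
        (hI r hr (by linarith)).2, (hI s (hr.trans hrs) hsδ).2] at h0
      exact sub_eq_zero.1 h0
    have hd : ∀ c ∈ Ioo 0 T, HasDerivWithinAt (fun δ => ∫ t in c..(c + δ), m t) (m c) (Ioi 0) 0 :=
      by
      intro c hc
      have h1 : IntervalIntegrable m volume c c := IntervalIntegrable.refl
      have hmeas : StronglyMeasurableAtFilter m (𝓝 c) volume :=
        ContinuousOn.stronglyMeasurableAtFilter isOpen_Ioo
          (hm.mono Ioo_subset_Icc_self) c hc
      have h2 := intervalIntegral.integral_hasDerivAt_right h1 hmeas (hmt c hc)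
      have h3 : HasDerivAt (fun δ => ∫ t in c..(c + δ), m t) (m c) 0 :=
        HasDerivAt.comp_const_add (f := fun u => ∫ t in c..u, m t) c 0 (by simpa using h2)
      exact h3.hasDerivWithinAt
    have hr' := hd r ⟨hr, hrs.trans hsT⟩
    have hs' := hd s ⟨hr.trans hrs, hsT⟩
    -- The two primitives agree for all small `δ > 0`; comparing right derivatives at 0 gives `m r =
    -- m s`.
    refine (uniqueDiffWithinAt_Ioi (0 : ℝ)).eq_deriv _ hr' (hs'.congr_of_eventuallyEq ?_ (by simp))
    filter_upwards [Ioo_mem_nhdsGT (show (0 : ℝ) < T - s by linarith)] with δ hδ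
    exact hstep δ hδ.1 (by linarith [hδ.2])
  have hmid : EqOn m (fun _ => m (T / 2)) (Ioo 0 T) := by
    intro t ht
    rcases lt_trichotomy t (T / 2) with h' | h' | h'
    · exact key _ _ ht.1 h' (by linarith)
    · rw [h']
    · exact (key _ _ (by linarith) h' ht.2).symm
  have hall : EqOn m (fun _ => m (T / 2)) (Icc 0 T) :=
    hmid.of_subset_closure hm continuousOn_const Ioo_subset_Icc_self
      (closure_Ioo hT.ne).symm.subset
  intro t ht
  rw [hall ht, hall (right_mem_Icc.2 hT.le)]

end TimeContinuity

/-! ### The flow transports Lebesgue measure; the chain rule for its Jacobian -/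

section Flow

variable {N : ℕ} {T : ℝ} {a : ℝ × Space N → Space N} {q : ℝ × Space N → Space N} {D : ℝ}

/-- A transport flow extended to the whole space-time, with a bound on the displacement. -/
structure IsExtendedFlow (T : ℝ) (a q : ℝ × Space N → Space N) (D : ℝ) : Prop where
  lip : LocallyLipschitz q
  solves : SolvesTransport T a q
  final : ∀ x, q (T, x) = x
  displacement : ∀ t ∈ Icc 0 T, ∀ x, ‖q (t, x) - x‖ ≤ D
  nonneg : ∀ᵐ z ∂volume.restrict (openSlab N T), 0 ≤ spaceJac q z.1 z.2

lemma IsTransportFlow.exists_extension (hT : 0 < T) {X : ℝ × Space N → Space N}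
    (hX : IsTransportFlow T a X) :
    ∃ q D, IsExtendedFlow T a q D ∧ EqOn q X (closedSlab N T) := by
  obtain ⟨C, hC⟩ := hX.lipschitz
  have hXL : LocallyLipschitzOn (closedSlab N T) X := fun z _ =>
    ⟨C, closedSlab N T, self_mem_nhdsWithin, hC⟩
  obtain ⟨q, hq, hqX, hqT⟩ := exists_locallyLipschitz_extension hT.le hXL
  have hTmem : T ∈ Icc 0 T := right_mem_Icc.2 hT.le
  -- `X(T,x) = x` and the global Lipschitz bound in time limit the displacement to `C * T`. This
  -- keeps preimages of bounded sets bounded.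
  refine ⟨q, C * T, ⟨hq, hX.solves.congr hqX, fun x => ?_, fun t ht x => ?_, ?_⟩, hqX⟩
  · rw [hqT T x le_rfl, hX.final]
  · have h := hC.dist_le_mul (t, x) (mk_mem_closedSlab.2 ht) (T, x) (mk_mem_closedSlab.2 hTmem)
    rw [hX.final, ← hqX (mk_mem_closedSlab.2 ht), dist_eq_norm] at h
    refine h.trans ?_
    simp only [Prod.dist_eq, dist_self, Real.dist_eq]
    gcongr
    rw [max_eq_left (abs_nonneg _), abs_sub_comm, abs_of_nonneg (sub_nonneg.2 ht.2)]
    linarith [ht.1]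
  · filter_upwards [hX.jac_nonneg, ae_restrict_mem measurableSet_openSlab] with z hz hzs
    rwa [spaceJac_congr hqX (Ioo_subset_Icc_self (mem_openSlab.1 hzs))]

namespace IsExtendedFlow

/-- The sign is known a.e. in the slab; comparison with the zero curve in the weak-* continuous
class gives it at every time. -/
lemma jac_nonneg (hT : 0 < T) (h : IsExtendedFlow T a q D) :
    ∀ t ∈ Icc 0 T, ∀ᵐ x, 0 ≤ spaceJac q t x := by
  have h0 : WeakStarContinuous T (fun _ _ => 0 : ℝ → Space N → ℝ) :=
    ⟨aestronglyMeasurable_const, fun _ _ _ _ => MemLp.zero', fun _ _ _ => by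
      simpa using continuousOn_const⟩
  exact h0.ae_le hT (weakStarContinuous_spaceJac h.lip T) h.nonneg

lemma displacement_nonneg (hT : 0 < T) (h : IsExtendedFlow T a q D) : 0 ≤ D :=
  (norm_nonneg _).trans (h.displacement 0 (left_mem_Icc.2 hT.le) 0)

lemma norm_le (h : IsExtendedFlow T a q D) {t : ℝ} (ht : t ∈ Icc 0 T) (x : Space N) :
    ‖x‖ ≤ ‖q (t, x)‖ + D := by
  have h1 := h.displacement t ht x
  have h2 := norm_sub_norm_le x (q (t, x))
  rw [norm_sub_rev] at h2
  linarith

lemma norm_apply_le (h : IsExtendedFlow T a q D) {t : ℝ} (ht : t ∈ Icc 0 T) (x : Space N) :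
    ‖q (t, x)‖ ≤ ‖x‖ + D := by
  have h1 := h.displacement t ht x
  have h2 := norm_sub_norm_le (q (t, x)) x
  linarith

lemma jac_final (h : IsExtendedFlow T a q D) (x : Space N) : spaceJac q T x = 1 := by
  have : (fun y => q (T, y)) = id := funext h.final
  rw [spaceJac, this, jac, fderiv_id, ContinuousLinearMap.det]
  simp

/-- The flow transports Lebesgue measure, on test functions. -/
theorem integral_comp_mul_jac (hT : 0 < T) (ha : MemLp a ⊤ (volume.restrict (openSlab N T)))
    (h : IsExtendedFlow T a q D) {f : Space N → ℝ} (hf : LocallyLipschitz f)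
    (hc : HasCompactSupport f) : ∀ t ∈ Icc 0 T, ∫ x, spaceJac q t x * f (q (t, x)) = ∫ x, f x := by
  obtain ⟨R, hR, hs⟩ := exists_tsupport_subset_ball hc
  let H : ℝ × Space N → ℝ := fun z => f (q z)
  have hH : LocallyLipschitz H := hf.comp h.lip
  have hHs : ∀ t ∈ Icc 0 T, ∀ x, H (t, x) ≠ 0 → x ∈ Metric.closedBall (0 : Space N) (R + D) := by
    intro t ht x hx
    have h1 := mem_ball_zero_iff.1 (hs (subset_tsupport _ hx))
    rw [mem_closedBall_zero_iff]
    linarith [h.norm_le ht x]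
  have hcont := continuousOn_integral_spaceJac_mul_moving h.lip hH hHs
  have hJ := (locallyBounded_spaceJac h.lip T).slabBounded
    (measurable_spaceJac h.lip.continuous).aestronglyMeasurable
  have hconst := eq_of_forall_integral_deriv_mul_eq_zero hT hcont ?_
  · intro t ht
    rw [hconst t ht]
    simp [H, h.jac_final, h.final]
  intro θ hθ hθs
  -- `H = f ∘ q` is itself transported, so only the derivative of `θ` survives, and the equation for
  -- the Jacobian says that the tested mass has zero weak derivative.
  let φ : ℝ × Space N → ℝ := fun z => θ z.1 * H z
  have hfst : LocallyLipschitz (Prod.fst : ℝ × Space N → ℝ) :=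
    LipschitzWith.prod_fst.locallyLipschitz
  have hθ1 : LocallyLipschitz fun z : ℝ × Space N => θ z.1 := hθ.comp hfst
  have hφ : LocallyLipschitz φ := locallyLipschitz_mul hθ1 hH
  have hθc : IsCompact (tsupport θ) :=
    isCompact_Icc.of_isClosed_subset (isClosed_tsupport θ) (hθs.trans Ioo_subset_Icc_self)
  have hsupp : Function.support φ ⊆ tsupport θ ×ˢ Metric.closedBall (0 : Space N) (R + D) := by
    intro z hz
    have hz' : θ z.1 * H z ≠ 0 := hz
    have h1 : z.1 ∈ tsupport θ := subset_tsupport _ (left_ne_zero_of_mul hz')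
    exact ⟨h1, hHs z.1 (Ioo_subset_Icc_self (hθs h1)) z.2 (right_ne_zero_of_mul hz')⟩
  have hφc : HasCompactSupport φ :=
    HasCompactSupport.of_support_subset_isCompact (hθc.prod (isCompact_closedBall _ _)) hsupp
  have hφs : tsupport φ ⊆ openSlab N T :=
    (closure_minimal hsupp ((isClosed_tsupport θ).prod Metric.isClosed_closedBall)).trans
      (prod_mono hθs (subset_univ _))
  have hzero := lipschitzWeak_spaceJac h.lip h.solves φ hφ hφc hφs
  have hint := integrable_mul_transportOp ha hJ hφ hφc
  have hθd : ∀ᵐ z ∂volume.restrict (openSlab N T), DifferentiableAt ℝ θ z.1 := by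
    have h1 : ∀ᵐ t : ℝ, DifferentiableAt ℝ θ t := ae_differentiableAt_of_locallyLipschitz hθ
    rw [restrict_openSlab]
    exact Measure.quasiMeasurePreserving_fst.ae (ae_restrict_of_ae h1)
  have hae : ∀ᵐ z ∂volume.restrict (openSlab N T), spaceJac q z.1 z.2 * transportOp a φ z =
      deriv θ z.1 * (spaceJac q z.1 z.2 * H z) := by
    filter_upwards [hθd, h.solves.comp h.lip hf,
      ae_restrict_of_ae (ae_differentiableAt_of_locallyLipschitz (μ := volume) hH)] with z h1 h2 h3
    have h4 : transportOp a (fun z : ℝ × Space N => θ z.1) z = deriv θ z.1 :=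
      transportOp_comp_fst θ h1.hasDerivAt rfl
    have h5 : fderiv ℝ φ z = _ :=
      fderiv_fun_mul (h1.comp z differentiableAt_fst : DifferentiableAt ℝ (fun z => θ z.1) z) h3
    have h6 : transportOp a φ z = θ z.1 * transportOp a H z +
        H z * transportOp a (fun z : ℝ × Space N => θ z.1) z := by
      rw [transportOp, h5]; rfl
    have h7 : transportOp a H z = 0 := h2
    rw [h6, h4, h7]
    ring
  rw [integral_congr_ae hae, restrict_openSlab, integral_prod _ (by
    rw [← restrict_openSlab]; exact hint.congr hae)] at hzero
  simpa only [integral_const_mul] using hzero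

/-- The image of Lebesgue measure under the flow, weighted by the Jacobian, is Lebesgue measure. -/
theorem map_withDensity_jac (hT : 0 < T) (ha : MemLp a ⊤ (volume.restrict (openSlab N T)))
    (h : IsExtendedFlow T a q D) : ∀ t ∈ Icc 0 T,
    ((volume : Measure (Space N)).withDensity fun x => ENNReal.ofReal (spaceJac q t x)).map
      (fun x => q (t, x)) = volume := by
  intro t ht
  have hqt : Continuous fun x => q (t, x) := (locallyLipschitz_slice h.lip t).continuous
  have hJm : Measurable fun x => ENNReal.ofReal (spaceJac q t x) :=
    (measurable_jac fun y => q (t, y)).ennreal_ofReal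
  set μ := (volume : Measure (Space N)).withDensity fun x => ENNReal.ofReal (spaceJac q t x)
  set ν := μ.map fun x => q (t, x) with hν
  have hfin : IsFiniteMeasureOnCompacts ν := ⟨fun K hK => by
    obtain ⟨R, hR⟩ := hK.isBounded.subset_ball (0 : Space N)
    obtain ⟨C, hC0, hC⟩ := abs_spaceJac_le h.lip T (R + D)
    rw [hν, Measure.map_apply hqt.measurable hK.measurableSet,
      withDensity_apply _ (hqt.measurable hK.measurableSet)]
    have hsub : (fun x => q (t, x)) ⁻¹' K ⊆ Metric.ball 0 (R + D) := by
      intro x hx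
      have := mem_ball_zero_iff.1 (hR hx)
      rw [mem_ball_zero_iff]
      linarith [h.norm_le ht x]
    calc ∫⁻ x in (fun x => q (t, x)) ⁻¹' K, ENNReal.ofReal (spaceJac q t x)
        ≤ ∫⁻ x in Metric.ball (0 : Space N) (R + D), ENNReal.ofReal (spaceJac q t x) :=
          lintegral_mono_set hsub
      _ ≤ ∫⁻ x in Metric.ball (0 : Space N) (R + D), ENNReal.ofReal C :=
          setLIntegral_mono measurable_const fun x hx =>
            ENNReal.ofReal_le_ofReal ((le_abs_self _).trans (hC t ht x hx))
      _ < ⊤ := by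
          rw [setLIntegral_const]
          exact ENNReal.mul_lt_top ENNReal.ofReal_lt_top measure_ball_lt_top⟩
  -- The transport identity is known for Lipschitz test functions. Uniform approximation by C¹
  -- functions supported in the support of `f` then handles continuous `f`, which determine the
  -- measure.
  have hsmooth : ∀ g : Space N → ℝ, ContDiff ℝ 1 g → HasCompactSupport g →
      ∫ x, g x ∂ν = ∫ x, g x := by
    intro g hg hgc
    rw [hν, integral_map hqt.aemeasurable hg.continuous.aestronglyMeasurable,
      integral_withDensity_eq_integral_toReal_smul hJm
        (Filter.Eventually.of_forall fun _ => ENNReal.ofReal_lt_top),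
      ← h.integral_comp_mul_jac hT ha (hg.locallyLipschitz) hgc t ht]
    refine integral_congr_ae ?_
    filter_upwards [h.jac_nonneg hT t ht] with x hx
    simp [ENNReal.toReal_ofReal hx]
  refine Measure.ext_of_integral_eq_on_compactlySupported fun f => ?_
  have hf : Continuous f := f.continuous
  have hfc : HasCompactSupport f := f.hasCompactSupport
  set K := tsupport f
  have hKm : MeasurableSet K := (isClosed_tsupport f).measurableSet
  have happ : ∀ ε : ℝ, 0 < ε → |(∫ x, f x ∂ν) - ∫ x, f x| ≤ ε * (ν.real K + volume.real K) := by
    intro ε hε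
    obtain ⟨g, hg, hgf, hgs⟩ := hf.exists_contDiff_approx 1 (ε := fun _ => ε) continuous_const
      fun _ => hε
    have hgc : HasCompactSupport g := hfc.mono hgs
    have hd : ∀ (m : Measure (Space N)) [IsFiniteMeasureOnCompacts m],
        |(∫ x, f x ∂m) - ∫ x, g x ∂m| ≤ ε * m.real K := by
      intro m _
      rw [← integral_sub (hf.integrable_of_hasCompactSupport hfc)
        (hg.continuous.integrable_of_hasCompactSupport hgc),
        ← setIntegral_eq_integral_of_forall_compl_eq_zero (μ := m) (s := K)]
      · rw [← Real.norm_eq_abs]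
        refine norm_setIntegral_le_of_norm_le_const (hfc.isCompact.measure_lt_top (μ :=
          m)) fun x _ => ?_
        rw [← dist_eq_norm, dist_comm]
        exact (hgf x).le
      · intro x hx
        have h1 : f x = 0 := image_eq_zero_of_notMem_tsupport hx
        have h2 : g x = 0 := by_contra fun h => hgs h h1
        rw [h1, h2, sub_zero]
    have h1 := hd ν
    have h2 := hd volume
    rw [hsmooth g (mod_cast hg) hgc] at h1
    rw [abs_le] at h1 h2 ⊢
    constructor <;> linarith
  refine sub_eq_zero.1 (abs_eq_zero.1 (le_antisymm ?_ (abs_nonneg _)))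
  refine le_of_forall_pos_le_add fun ε hε => ?_
  rw [zero_add]
  set c := ν.real K + volume.real K
  have hc : 0 ≤ c := by positivity
  refine (happ (ε / (c + 1)) (by positivity)).trans ?_
  rw [div_mul_eq_mul_div, div_le_iff₀ (by positivity)]
  nlinarith

lemma lintegral_comp_mul_jac (hT : 0 < T) (ha : MemLp a ⊤ (volume.restrict (openSlab N T)))
    (h : IsExtendedFlow T a q D) {t : ℝ} (ht : t ∈ Icc 0 T) {f : Space N → ℝ≥0∞}
    (hf : Measurable f) :
    ∫⁻ x, ENNReal.ofReal (spaceJac q t x) * f (q (t, x)) = ∫⁻ x, f x := by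
  have hqt : Continuous fun x => q (t, x) := (locallyLipschitz_slice h.lip t).continuous
  have hJm : Measurable fun x => ENNReal.ofReal (spaceJac q t x) :=
    (measurable_jac fun y => q (t, y)).ennreal_ofReal
  conv_rhs => rw [← h.map_withDensity_jac hT ha t ht]
  rw [lintegral_map hf hqt.measurable]
  exact (lintegral_withDensity_eq_lintegral_mul _ hJm (hf.comp hqt.measurable)).symm

/-- The Jacobian of the flow vanishes on preimages of null sets. -/
lemma ae_jac_eq_zero_of_null (hT : 0 < T) (ha : MemLp a ⊤ (volume.restrict (openSlab N T)))
    (h : IsExtendedFlow T a q D) {t : ℝ} (ht : t ∈ Icc 0 T) {P : Space N → Prop}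
    (hP : ∀ᵐ y, P y) : ∀ᵐ x, P (q (t, x)) ∨ spaceJac q t x = 0 := by
  have hqt : Continuous fun x => q (t, x) := (locallyLipschitz_slice h.lip t).continuous
  have hJm : Measurable fun x => ENNReal.ofReal (spaceJac q t x) :=
    (measurable_jac fun y => q (t, y)).ennreal_ofReal
  rw [← h.map_withDensity_jac hT ha t ht] at hP
  have h1 := ae_of_ae_map hqt.aemeasurable hP
  rw [ae_withDensity_iff hJm] at h1
  filter_upwards [h1, h.jac_nonneg hT t ht] with x hx hx0
  by_cases hJ : spaceJac q t x = 0
  · exact Or.inr hJ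
  · exact Or.inl (hx (ENNReal.ofReal_pos.2 (lt_of_le_of_ne hx0 (Ne.symm hJ))).ne')

/-- The chain rule for Jacobians along the flow. -/
theorem ae_jac_comp (hT : 0 < T) (ha : MemLp a ⊤ (volume.restrict (openSlab N T)))
    (h : IsExtendedFlow T a q D) {t : ℝ} (ht : t ∈ Icc 0 T) {f : Space N → Space N}
    (hf : LocallyLipschitz f) :
    ∀ᵐ x, spaceJac (fun z => f (q z)) t x = jac f (q (t, x)) * spaceJac q t x := by
  have hqt := locallyLipschitz_slice h.lip t
  filter_upwards [ae_differentiableAt_of_locallyLipschitz (μ := volume) hqt,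
    ae_differentiableAt_of_locallyLipschitz (μ := volume) (hf.comp hqt),
    h.ae_jac_eq_zero_of_null hT ha ht (ae_differentiableAt_of_locallyLipschitz (μ := volume) hf)]
    with x h1 h2 h3
  rcases h3 with h3 | h3
  · have h4 : fderiv ℝ (fun y => f (q (t, y))) x = _ := fderiv_comp x h3 h1
    rw [spaceJac, spaceJac, jac, jac, jac, h4, ContinuousLinearMap.det, ContinuousLinearMap.det,
      ContinuousLinearMap.det, ← LinearMap.det_comp]
    rfl
  -- Where `f` may fail to be differentiable at `q(t,x)`, the Jacobian of `q` vanishes. A kernel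
  -- vector of its derivative is also killed by the derivative of `f ∘ q`, so both sides are 0.
  · rw [h3, mul_zero]
    obtain ⟨v, hv, hv0⟩ := Submodule.exists_mem_ne_zero_of_ne_bot
      (LinearMap.bot_lt_ker_of_det_eq_zero h3).ne'
    have h4 : fderiv ℝ (fun y => f (q (t, y))) x v = 0 := fderiv_comp_apply_eq_zero hf h1 hv h2
    by_contra hne
    have hinj := LinearMap.ker_eq_bot.1 (LinearMap.ker_eq_bot.2
      (LinearMap.equivOfDetNeZero _ hne).injective)
    exact hv0 (hinj (by simpa using h4))

end IsExtendedFlow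

end Flow

/-! ### Transporting bounded final data by the flow gives weak solutions -/

section Reversible

variable {N : ℕ} {T : ℝ} {a : ℝ × Space N → Space N} {q : ℝ × Space N → Space N} {D : ℝ}

/-- `g ∘ q` is transported, so it may be absorbed into the test function: `φ · g(q)` is again
admissible. -/
lemma LipschitzWeak.mul_comp {g : Space N → ℝ} (hq : LocallyLipschitz q)
    (hs : SolvesTransport T a q) (hg : LocallyLipschitz g) :
    LipschitzWeak T a fun z => spaceJac q z.1 z.2 * g (q z) := by
  intro φ hφ hc hsupp
  have hgq : LocallyLipschitz fun z => g (q z) := hg.comp hq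
  rw [← lipschitzWeak_spaceJac hq hs (fun z => φ z * g (q z)) (locallyLipschitz_mul hφ hgq)
    hc.mul_right ((tsupport_mul_subset_left).trans hsupp)]
  refine integral_congr_ae ?_
  filter_upwards [hs.comp hq hg,
    ae_restrict_of_ae (ae_differentiableAt_of_locallyLipschitz (μ := volume) hφ),
    ae_restrict_of_ae (ae_differentiableAt_of_locallyLipschitz (μ := volume) hgq)] with z h1 h2 h3
  have h4 : fderiv ℝ (fun z => φ z * g (q z)) z = _ := fderiv_fun_mul h2 h3
  have h5 : transportOp a (fun z => φ z * g (q z)) z = φ z * transportOp a (fun z => g (q z)) z +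
      g (q z) * transportOp a φ z := by
    rw [transportOp, h4]; rfl
  rw [h5, h1, mul_zero, zero_add, mul_assoc]

lemma abs_integral_le_of_lintegral_le {α : Type*} [MeasurableSpace α] {μ : Measure α} {f : α → ℝ}
    {C : ℝ} (hC : 0 ≤ C) (h : ∫⁻ x, ‖f x‖ₑ ∂μ ≤ ENNReal.ofReal C) : |∫ x, f x ∂μ| ≤ C := by
  have h1 := (enorm_integral_le_lintegral_enorm f).trans h
  rwa [← ofReal_norm, ENNReal.ofReal_le_ofReal_iff hC] at h1

/-- For Lipschitz `g` this is already known. In general `g` is approximated in L¹ on a large ball.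
Since the flow preserves integrals weighted by the Jacobian, the error after transport is the L¹
error before it, uniformly in time. -/
theorem IsExtendedFlow.mem_weakSolutions_of_measurable (hT : 0 < T)
    (ha : MemLp a ⊤ (volume.restrict (openSlab N T))) (h : IsExtendedFlow T a q D)
    {g : Space N → ℝ} (hg : Measurable g)
    (hgb : ∀ R : ℝ, ∃ C : ℝ, 0 ≤ C ∧ ∀ᵐ y, y ∈ Metric.ball (0 : Space N) R → |g y| ≤ C)
    {π : ℝ → Space N → ℝ} (hm : AEStronglyMeasurable (fun z : ℝ × Space N => π z.1 z.2)
      (volume.restrict (openSlab N T)))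
    (hπ : ∀ t ∈ Icc 0 T, ∀ᵐ x, π t x = g (q (t, x)) * spaceJac q t x) :
    π ∈ weakSolutions T a := by
  have hqt : ∀ t, Continuous fun x => q (t, x) := fun t =>
    (locallyLipschitz_slice h.lip t).continuous
  have hJt : ∀ t, Measurable (spaceJac q t) := fun t => measurable_jac fun y => q (t, y)
  have hJ := measurable_spaceJac h.lip.continuous
  have hD := h.displacement_nonneg hT
  have hmt : ∀ t ∈ Icc 0 T, AEStronglyMeasurable (π t) volume := fun t ht =>
    (((hg.comp (hqt t).measurable).mul (hJt t)).aestronglyMeasurable).congr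
      ((hπ t ht).mono fun x hx => hx.symm)
  have hb : LocallyBounded T π := by
    intro R
    obtain ⟨C, hC0, hC⟩ := hgb (R + D)
    obtain ⟨C', hC0', hC'⟩ := abs_spaceJac_le h.lip T R
    refine ⟨C * C', by positivity, fun t ht => ?_⟩
    -- The bound on `g` holds only off a null set; where `q(t,·)` hits that set the Jacobian is 0,
    -- so the product is still bounded.
    filter_upwards [hπ t ht, h.ae_jac_eq_zero_of_null hT ha ht hC] with x hx hx' hxR
    rw [hx, abs_mul]
    rcases hx' with hx' | hx'
    · refine mul_le_mul (hx' ?_) (hC' t ht x hxR) (abs_nonneg _) hC0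
      have h1 := mem_ball_zero_iff.1 hxR
      rw [mem_ball_zero_iff]
      linarith [h.norm_apply_le ht x]
    · rw [hx', abs_zero, mul_zero]; positivity
  -- `e` is the absolute error of `g'` against `g` cut off to the ball of radius `R + D`, which
  -- contains the image under `q(t,·)` of the ball of radius `R`.
  have happ : ∀ R ε : ℝ, 0 < ε → ∃ g' : Space N → ℝ, LocallyLipschitz g' ∧
      ∃ e : Space N → ℝ≥0∞, Measurable e ∧ ∫⁻ y, e y ≤ ENNReal.ofReal ε ∧
        ∀ t ∈ Icc 0 T, ∀ x ∈ Metric.ball (0 : Space N) R,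
          ‖g (q (t, x)) - g' (q (t, x))‖ₑ ≤ e (q (t, x)) := by
    intro R ε hε
    set B := Metric.ball (0 : Space N) (R + D)
    have hBm : MeasurableSet B := Metric.isOpen_ball.measurableSet
    obtain ⟨C, hC0, hC⟩ := hgb (R + D)
    have hint : Integrable (B.indicator g) := by
      rw [integrable_indicator_iff hBm]
      refine (integrableOn_const (C := C) measure_ball_lt_top.ne).mono' hg.aestronglyMeasurable ?_
      filter_upwards [ae_restrict_of_ae hC, ae_restrict_mem hBm] with y hy hyB
      exact hy hyB
    have hc : HasCompactSupport (B.indicator g) :=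
      HasCompactSupport.of_support_subset_isCompact (isCompact_closedBall (0 : Space N) (R + D))
        (support_indicator_subset.trans Metric.ball_subset_closedBall)
    obtain ⟨R', -, happ⟩ := exists_smooth_integral_sub_le hint hc
    obtain ⟨g', hg', hgc', -, hgε⟩ := happ ε hε
    have hgi' : Integrable g' := hg'.continuous.integrable_of_hasCompactSupport hgc'
    refine ⟨g', (hg'.of_le (by simp)).locallyLipschitz (𝕂 := ℝ),
      fun y => ‖B.indicator g y - g' y‖ₑ,
      ((hg.indicator hBm).sub hg'.continuous.measurable).enorm, ?_, fun t ht x hx => ?_⟩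
    · have h1 := ofReal_integral_norm_eq_lintegral_enorm (hint.sub hgi')
      simp only [Pi.sub_apply] at h1
      rw [← h1]
      exact ENNReal.ofReal_le_ofReal hgε
    · have hqB : q (t, x) ∈ B := by
        have h1 := mem_ball_zero_iff.1 hx
        rw [mem_ball_zero_iff]
        linarith [h.norm_apply_le ht x]
      show _ ≤ ‖B.indicator g (q (t, x)) - g' (q (t, x))‖ₑ
      rw [indicator_of_mem hqB]
  refine ⟨weakStarContinuous_of_lipschitz hm hmt hb fun φ hφ hc => ?_, fun φ hφ hc hs => ?_⟩
  · obtain ⟨R, hR, hs⟩ := exists_tsupport_subset_ball hc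
    obtain ⟨S, hS⟩ := hφ.continuous.bounded_above_of_compact_support hc
    have hS0 : 0 ≤ S := (norm_nonneg _).trans (hS 0)
    refine continuousOn_of_uniform_approx_of_continuousOn fun U hU => ?_
    obtain ⟨ε, hε, hεU⟩ := Metric.mem_uniformity_dist.1 hU
    obtain ⟨g', hg', e, he, hei, hge⟩ := happ R (ε / (2 * (S + 1))) (by positivity)
    have hH : LocallyLipschitz fun z : ℝ × Space N => g' (q z) * φ z.2 :=
      locallyLipschitz_mul (hg'.comp h.lip) (hφ.comp LipschitzWith.prod_snd.locallyLipschitz)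
    have hHs : ∀ t ∈ Icc 0 T, ∀ x, g' (q (t, x)) * φ x ≠ 0 →
        x ∈ Metric.closedBall (0 : Space N) R := fun t _ x hx =>
      Metric.ball_subset_closedBall (hs (subset_tsupport _ (right_ne_zero_of_mul hx)))
    refine ⟨_, continuousOn_integral_spaceJac_mul_moving h.lip hH hHs, fun t ht => hεU ?_⟩
    have hHc : HasCompactSupport fun x => g' (q (t, x)) * φ x := hc.mul_left
    have hi1 : Integrable fun x => π t x * φ x :=
      integrable_mul_of_hasCompactSupport (hmt t ht)
        (fun R => (hb R).imp fun C hC => hC.2 t ht) hφ.continuous hc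
    have hi2 : Integrable fun x => spaceJac q t x * (g' (q (t, x)) * φ x) :=
      (weakStarContinuous_spaceJac h.lip T).integrable_mul ht
        ((locallyLipschitz_slice hH t).continuous.integrable_of_hasCompactSupport hHc) hHc
    rw [dist_eq_norm, ← integral_sub hi1 hi2, Real.norm_eq_abs]
    refine (abs_integral_le_of_lintegral_le (C := S * (ε / (2 * (S + 1)))) (by positivity)
      ?_).trans_lt ?_
    · calc ∫⁻ x, ‖π t x * φ x - spaceJac q t x * (g' (q (t, x)) * φ x)‖ₑ
          ≤ ∫⁻ x, ENNReal.ofReal S * (ENNReal.ofReal (spaceJac q t x) * e (q (t, x))) := by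
            refine lintegral_mono_ae ?_
            filter_upwards [hπ t ht, h.jac_nonneg hT t ht] with x hx hx0
            have e1 : π t x * φ x - spaceJac q t x * (g' (q (t, x)) * φ x) =
                φ x * (spaceJac q t x * (g (q (t, x)) - g' (q (t, x)))) := by rw [hx]; ring
            rw [e1, enorm_mul, enorm_mul]
            by_cases hx1 : φ x = 0
            · simp [hx1]
            · gcongr
              · rw [← ofReal_norm]; exact ENNReal.ofReal_le_ofReal (hS x)
              · rw [← ofReal_norm, Real.norm_of_nonneg hx0]
              · exact hge t ht x (hs (subset_tsupport _ hx1))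
        _ = ENNReal.ofReal S * ∫⁻ y, e y := by
            have hme : Measurable fun x => ENNReal.ofReal (spaceJac q t x) * e (q (t, x)) :=
              (hJt t).ennreal_ofReal.mul (he.comp (hqt t).measurable)
            rw [lintegral_const_mul _ hme, h.lintegral_comp_mul_jac hT ha ht he]
        _ ≤ ENNReal.ofReal S * ENNReal.ofReal (ε / (2 * (S + 1))) := by gcongr
        _ = _ := (ENNReal.ofReal_mul hS0).symm
    · have : S * (ε / (2 * (S + 1))) ≤ ε / 2 := by
        rw [mul_div_assoc', div_le_div_iff₀ (by positivity) (by positivity)]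
        nlinarith
      linarith
  · have hφL : LocallyLipschitz φ := (hφ.of_le (by simp)).locallyLipschitz (𝕂 := ℝ)
    obtain ⟨R, hR, hsR⟩ := exists_tsupport_subset_ball hc
    obtain ⟨L, hL⟩ := exists_lipschitzWith_of_hasCompactSupport hφL hc
    obtain ⟨M, hM0, hM⟩ := exists_ae_norm_le ha
    set S : ℝ := L * max 1 M
    have hS0 : 0 ≤ S := by positivity
    -- `S` bounds the transport derivative of `φ`. At each time the transported error has integral
    -- at most `ε`, and integration over time contributes `T`.
    have key : ∀ ε : ℝ, 0 < ε →
        |∫ z in openSlab N T, π z.1 z.2 * transportOp a φ z| ≤ S * ε * T := by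
      intro ε hε
      obtain ⟨g', hg', e, he, hei, hge⟩ := happ R ε hε
      have hw := LipschitzWeak.mul_comp h.lip h.solves hg' φ hφL hc hs
      have hub := hb.slabBounded hm
      have hgJ : SlabBounded T fun z : ℝ × Space N => spaceJac q z.1 z.2 * g' (q z) := by
        refine ⟨(hJ.mul (hg'.comp h.lip).continuous.measurable).aestronglyMeasurable, fun R => ?_⟩
        obtain ⟨C, hC⟩ := ((locallyBounded_spaceJac h.lip T).slabBounded
          hJ.aestronglyMeasurable).2 R
        obtain ⟨C', hC0', hC'⟩ := exists_norm_le_of_continuous (hg'.comp h.lip).continuous R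
        refine ⟨C * C', ?_⟩
        filter_upwards [hC] with z hz hzR
        rw [abs_mul]
        exact mul_le_mul (hz hzR) (hC' z (Metric.ball_subset_closedBall hzR)) (abs_nonneg _)
          ((abs_nonneg _).trans (hz hzR))
      have hi1 := integrable_mul_transportOp ha hub hφL hc
      have hi2 := integrable_mul_transportOp ha hgJ hφL hc
      have hπz : ∀ᵐ z ∂volume.restrict (openSlab N T),
          π z.1 z.2 = g (q z) * spaceJac q z.1 z.2 :=
        ae_openSlab_of_forall_slice (nullMeasurableSet_eq_fun hm.aemeasurable
          ((hg.comp h.lip.continuous.measurable).mul hJ).aemeasurable) hπ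
      rw [← sub_zero (∫ z in openSlab N T, π z.1 z.2 * transportOp a φ z), ← hw,
        ← integral_sub hi1 hi2]
      refine abs_integral_le_of_lintegral_le (by positivity) ?_
      calc ∫⁻ z in openSlab N T, ‖π z.1 z.2 * transportOp a φ z -
              spaceJac q z.1 z.2 * g' (q z) * transportOp a φ z‖ₑ
          ≤ ∫⁻ z in openSlab N T, ENNReal.ofReal S *
              (ENNReal.ofReal (spaceJac q z.1 z.2) * e (q z)) := by
            refine lintegral_mono_ae ?_
            filter_upwards [hπz, h.nonneg, hM, ae_restrict_mem measurableSet_openSlab]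
              with z hz hz0 hzM hzs
            have e1 : π z.1 z.2 * transportOp a φ z - spaceJac q z.1 z.2 * g' (q z) *
                transportOp a φ z = transportOp a φ z *
                  (spaceJac q z.1 z.2 * (g (q z) - g' (q z))) := by rw [hz]; ring
            rw [e1, enorm_mul, enorm_mul]
            by_cases hz1 : z ∈ tsupport φ
            · gcongr
              · rw [← ofReal_norm]
                refine ENNReal.ofReal_le_ofReal ((norm_transportOp_le hzM).trans ?_)
                exact mul_le_mul_of_nonneg_right (norm_fderiv_le_of_lipschitz ℝ hL) (by positivity)
              · rw [← ofReal_norm, Real.norm_of_nonneg hz0]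
              · refine hge z.1 (Ioo_subset_Icc_self (mem_openSlab.1 hzs)) z.2 ?_
                have h1 := mem_ball_zero_iff.1 (hsR hz1)
                rw [mem_ball_zero_iff]
                exact (norm_snd_le z).trans_lt h1
            · simp [transportOp_eq_zero_of_notMem_tsupport hz1]
        _ = ENNReal.ofReal S * ∫⁻ t in Ioo 0 T, ∫⁻ x,
              ENNReal.ofReal (spaceJac q t x) * e (q (t, x)) := by
            have hme : Measurable fun z : ℝ × Space N =>
                ENNReal.ofReal (spaceJac q z.1 z.2) * e (q z) :=
              hJ.ennreal_ofReal.mul (he.comp h.lip.continuous.measurable)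
            rw [lintegral_const_mul _ hme, restrict_openSlab, lintegral_prod _ hme.aemeasurable]
        _ ≤ ENNReal.ofReal S * ∫⁻ t in Ioo 0 T, ENNReal.ofReal ε := by
            gcongr ENNReal.ofReal S * ?_
            refine setLIntegral_mono measurable_const fun t ht => ?_
            rw [h.lintegral_comp_mul_jac hT ha (Ioo_subset_Icc_self ht) he]
            exact hei
        _ = _ := by
            rw [setLIntegral_const, Real.volume_Ioo, sub_zero, mul_assoc S, ENNReal.ofReal_mul hS0,
              ENNReal.ofReal_mul hε.le]
    refine abs_eq_zero.1 (le_antisymm ?_ (abs_nonneg _))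
    refine le_of_forall_pos_le_add fun ε hε => ?_
    rw [zero_add]
    refine (key (ε / (S * T + 1)) (by positivity)).trans ?_
    rw [mul_div_assoc', div_mul_eq_mul_div, div_le_iff₀ (by positivity)]
    nlinarith [mul_nonneg hS0 hT.le]

/-- Composition with `q(t,·)` alone need not respect a.e. classes; the factor `J(q)` vanishes
exactly where this could matter. -/
lemma IsExtendedFlow.ae_eq_comp_mk (hT : 0 < T)
    (ha : MemLp a ⊤ (volume.restrict (openSlab N T))) (h : IsExtendedFlow T a q D)
    {f g : Space N → ℝ} (hfg : f =ᵐ[volume] g) {t : ℝ} (ht : t ∈ Icc 0 T) :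
    ∀ᵐ x, f (q (t, x)) * spaceJac q t x = g (q (t, x)) * spaceJac q t x := by
  filter_upwards [h.ae_jac_eq_zero_of_null hT ha ht hfg] with x hx
  rcases hx with hx | hx
  · rw [hx]
  · simp [hx]

theorem IsExtendedFlow.mem_weakSolutions (hT : 0 < T)
    (ha : MemLp a ⊤ (volume.restrict (openSlab N T))) (h : IsExtendedFlow T a q D)
    {g : Space N → ℝ} (hg : AEStronglyMeasurable g)
    (hgb : ∀ R : ℝ, ∃ C : ℝ, 0 ≤ C ∧ ∀ᵐ y, y ∈ Metric.ball (0 : Space N) R → |g y| ≤ C)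
    {π : ℝ → Space N → ℝ} (hm : AEStronglyMeasurable (fun z : ℝ × Space N => π z.1 z.2)
      (volume.restrict (openSlab N T)))
    (hπ : ∀ t ∈ Icc 0 T, ∀ᵐ x, π t x = g (q (t, x)) * spaceJac q t x) :
    π ∈ weakSolutions T a := by
  refine h.mem_weakSolutions_of_measurable hT ha hg.stronglyMeasurable_mk.measurable
    (fun R => ?_) hm fun t ht => ?_
  · obtain ⟨C, hC0, hC⟩ := hgb R
    refine ⟨C, hC0, ?_⟩
    filter_upwards [hC, hg.ae_eq_mk] with y hy hy' hyR
    rw [← hy']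
    exact hy hyR
  · filter_upwards [hπ t ht, h.ae_eq_comp_mk hT ha hg.ae_eq_mk ht] with x hx hx'
    rw [hx, hx']

end Reversible

/-! ### Reversible solutions and combinations of Jacobian solutions -/

section Characterization

variable {N : ℕ} {T : ℝ} {a : ℝ × Space N → Space N} {q : ℝ × Space N → Space N} {D : ℝ}

/-- Weak solutions with bounds uniform in time, measurable at all times. -/
structure IsRegularSolution (T : ℝ) (a : ℝ × Space N → Space N) (π : ℝ → Space N → ℝ) : Prop where
  measurable_slice : ∀ t ∈ Icc 0 T, AEStronglyMeasurable (π t) volume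
  bounded : LocallyBounded T π
  weakStar : WeakStarContinuous T π
  weak : LipschitzWeak T a fun z => π z.1 z.2

lemma IsRegularSolution.mem_weakSolutions {π : ℝ → Space N → ℝ} (h : IsRegularSolution T a π) :
    π ∈ weakSolutions T a := ⟨h.weakStar, h.weak.smooth⟩

lemma IsRegularSolution.slabBounded {π : ℝ → Space N → ℝ} (h : IsRegularSolution T a π) :
    SlabBounded T fun z => π z.1 z.2 := h.bounded.slabBounded h.weakStar.measurable

lemma IsRegularSolution.congr {π ρ : ℝ → Space N → ℝ} (h : IsRegularSolution T a ρ)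
    (hm : AEStronglyMeasurable (fun z : ℝ × Space N => π z.1 z.2) (volume.restrict (openSlab N T)))
    (hπ : ∀ t ∈ Icc 0 T, π t =ᵐ[volume] ρ t) : IsRegularSolution T a π := by
  have hmt : ∀ t ∈ Icc 0 T, AEStronglyMeasurable (π t) volume := fun t ht =>
    (h.measurable_slice t ht).congr (hπ t ht).symm
  have hb : LocallyBounded T π := fun R => by
    obtain ⟨C, hC0, hC⟩ := h.bounded R
    refine ⟨C, hC0, fun t ht => ?_⟩
    filter_upwards [hC t ht, hπ t ht] with x hx hx' hxR
    rw [hx']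
    exact hx hxR
  refine ⟨hmt, hb, weakStarContinuous_of_lipschitz hm hmt hb fun φ hφ hc => ?_,
    fun φ hφ hc hs => ?_⟩
  · refine (h.weakStar.continuous φ (hφ.continuous.integrable_of_hasCompactSupport hc) hc).congr
      fun t ht => integral_congr_ae ?_
    filter_upwards [hπ t ht] with x hx
    rw [hx]
  · rw [← h.weak φ hφ hc hs]
    have hz : ∀ᵐ z ∂volume.restrict (openSlab N T), π z.1 z.2 = ρ z.1 z.2 :=
      ae_openSlab_of_forall_slice (nullMeasurableSet_eq_fun hm.aemeasurable
        h.weakStar.measurable.aemeasurable) hπ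
    refine integral_congr_ae ?_
    filter_upwards [hz] with z hz
    rw [hz]

/-- The bounds uniform in time are carried through the induction because they supply the
integrability that makes the weak equation additive. -/
lemma isRegularSolution_of_mem_span (ha : MemLp a ⊤ (volume.restrict (openSlab N T))) (hT : 0 < T)
    {π : ℝ → Space N → ℝ} (hπ : π ∈ Submodule.span ℝ (jacobianSolutions T a)) :
    IsRegularSolution T a π := by
  induction hπ using Submodule.span_induction with
  | mem π h =>
    obtain ⟨hm, p, hp, hs, hπ⟩ := h
    obtain ⟨q, hq, hqp, -⟩ := exists_locallyLipschitz_extension hT.le hp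
    refine IsRegularSolution.congr (ρ := spaceJac q) ⟨fun t _ =>
      (measurable_jac fun y => q (t, y)).aestronglyMeasurable, locallyBounded_spaceJac hq T,
      weakStarContinuous_spaceJac hq T, lipschitzWeak_spaceJac hq (hs.congr hqp)⟩ hm fun t ht => ?_
    rw [spaceJac_congr hqp ht]
    exact hπ t ht
  | zero =>
    have hm : AEStronglyMeasurable (fun z : ℝ × Space N => (0 : ℝ → Space N → ℝ) z.1 z.2)
        (volume.restrict (openSlab N T)) := aestronglyMeasurable_const (b := (0 : ℝ))
    refine ⟨fun _ _ => aestronglyMeasurable_const (b := (0 : ℝ)), fun R => ⟨0, le_rfl, by simp⟩,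
      ⟨hm, fun t _ K _ => MemLp.zero', fun φ _ _ => ?_⟩, fun φ _ _ _ => by simp⟩
    simpa using continuousOn_const
  | add π ρ _ _ h h' =>
    have hmt : ∀ t ∈ Icc 0 T, AEStronglyMeasurable ((π + ρ) t) volume := fun t ht =>
      (h.measurable_slice t ht).add (h'.measurable_slice t ht)
    have hm : AEStronglyMeasurable (fun z : ℝ × Space N => (π + ρ) z.1 z.2)
        (volume.restrict (openSlab N T)) := h.weakStar.measurable.add h'.weakStar.measurable
    have hb : LocallyBounded T (π + ρ) := fun R => by
      obtain ⟨C, hC0, hC⟩ := h.bounded R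
      obtain ⟨C', hC0', hC'⟩ := h'.bounded R
      refine ⟨C + C', by positivity, fun t ht => ?_⟩
      filter_upwards [hC t ht, hC' t ht] with x hx hx' hxR
      exact (abs_add_le _ _).trans (add_le_add (hx hxR) (hx' hxR))
    refine ⟨hmt, hb, weakStarContinuous_of_lipschitz hm hmt hb fun φ hφ hc => ?_,
      fun φ hφ hc hs => ?_⟩
    · have hφi := hφ.continuous.integrable_of_hasCompactSupport hc (μ := volume)
      refine ((h.weakStar.continuous φ hφi hc).add (h'.weakStar.continuous φ hφi hc)).congr
        fun t ht => ?_
      simp only [Pi.add_apply, add_mul]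
      exact integral_add (h.weakStar.integrable_mul ht hφi hc)
        (h'.weakStar.integrable_mul ht hφi hc)
    · simp only [Pi.add_apply, add_mul]
      rw [integral_add (integrable_mul_transportOp ha h.slabBounded hφ hc)
        (integrable_mul_transportOp ha h'.slabBounded hφ hc), h.weak φ hφ hc hs,
        h'.weak φ hφ hc hs, add_zero]
  | smul c π _ h =>
    have hmt : ∀ t ∈ Icc 0 T, AEStronglyMeasurable ((c • π) t) volume := fun t ht =>
      (h.measurable_slice t ht).const_smul c
    have hm : AEStronglyMeasurable (fun z : ℝ × Space N => (c • π) z.1 z.2)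
        (volume.restrict (openSlab N T)) := h.weakStar.measurable.const_smul c
    have hb : LocallyBounded T (c • π) := fun R => by
      obtain ⟨C, hC0, hC⟩ := h.bounded R
      refine ⟨|c| * C, by positivity, fun t ht => ?_⟩
      filter_upwards [hC t ht] with x hx hxR
      simp only [Pi.smul_apply, smul_eq_mul, abs_mul]
      exact mul_le_mul_of_nonneg_left (hx hxR) (abs_nonneg c)
    refine ⟨hmt, hb, weakStarContinuous_of_lipschitz hm hmt hb fun φ hφ hc => ?_,
      fun φ hφ hc hs => ?_⟩
    · have hφi := hφ.continuous.integrable_of_hasCompactSupport hc (μ := volume)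
      refine ((h.weakStar.continuous φ hφi hc).const_smul c).congr fun t ht => ?_
      simp only [Pi.smul_apply, smul_eq_mul, mul_assoc]
      exact integral_const_mul _ _
    · simp only [Pi.smul_apply, smul_eq_mul, mul_assoc]
      rw [integral_const_mul, h.weak φ hφ hc hs, mul_zero]

/-- The set `S` may have empty interior. The difference vanishes on `S`, so its derivative is 0 at
almost every point of `S`, namely at density points. -/
lemma ae_jac_eq_of_eqOn {f g : Space N → Space N} (hf : LocallyLipschitz f)
    (hg : LocallyLipschitz g) {S : Set (Space N)} (hS : MeasurableSet S) (h : EqOn f g S) :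
    ∀ᵐ x, x ∈ S → jac f x = jac g x := by
  let w : Space N → Space N := fun x => f x - g x
  have hw : LocallyLipschitz w := locallyLipschitz_sub hf hg
  let S' := S ∩ {x | DifferentiableAt ℝ w x}
  have hS' : MeasurableSet S' := hS.inter (measurableSet_of_differentiableAt ℝ w)
  have h0 : ApproximatesLinearOn w (0 : Space N →L[ℝ] Space N) S' 0 := by
    intro x hx y hy
    simp [w, h hx.1, h hy.1]
  have key := h0.norm_fderiv_sub_le volume hS' (fun x => fderiv ℝ w x)
    fun x hx => hx.2.hasFDerivAt.hasFDerivWithinAt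
  rw [ae_restrict_iff' hS'] at key
  filter_upwards [key, ae_differentiableAt_of_locallyLipschitz (μ := volume) hf,
    ae_differentiableAt_of_locallyLipschitz (μ := volume) hg] with x hx hx1 hx2 hxS
  have h1 : fderiv ℝ w x = fderiv ℝ f x - fderiv ℝ g x := fderiv_fun_sub hx1 hx2
  have h2 := hx ⟨hxS, hx1.sub hx2⟩
  rw [sub_zero, h1] at h2
  have h3 : fderiv ℝ f x - fderiv ℝ g x = 0 := nnnorm_eq_zero.1 (le_antisymm h2 zero_le)
  rw [jac, jac, sub_eq_zero.1 h3]

lemma coord_sub_mem_exceptionalSolutions {p r : ℝ × Space N → Space N} (hp : LocallyLipschitz p)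
    (hps : SolvesTransport T a p) (hr : LocallyLipschitz r) (hrs : SolvesTransport T a r)
    (h : ∀ x, p (T, x) = r (T, x)) (i : Fin N) :
    (fun z => p z i - r z i) ∈ exceptionalSolutions T a := by
  have hpr := locallyLipschitz_sub hp hr
  have hs : SolvesTransport T a fun z => p z - r z := by
    filter_upwards [hps, hrs,
      ae_restrict_of_ae (ae_differentiableAt_of_locallyLipschitz (μ := volume) hp),
      ae_restrict_of_ae (ae_differentiableAt_of_locallyLipschitz (μ :=
        volume) hr)] with z h1 h2 h3 h4
    have h5 : fderiv ℝ (fun z => p z - r z) z = fderiv ℝ p z - fderiv ℝ r z := fderiv_fun_sub h3 h4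
    have h6 : transportOp a (fun z => p z - r z) z = transportOp a p z - transportOp a r z := by
      rw [transportOp, h5]; rfl
    rw [h6, h1, h2, sub_zero]
  refine ⟨(locallyLipschitz_coord hpr i).locallyLipschitzOn, ?_, fun x => by simp [h x]⟩
  exact hs.comp hpr (EuclideanSpace.proj i : Space N →L[ℝ] ℝ).lipschitz.locallyLipschitz

/-- Off the exceptional support, combinations of Jacobian solutions are transported by the flow. -/
lemma IsExtendedFlow.ae_eq_of_mem_span (hT : 0 < T)
    (ha : MemLp a ⊤ (volume.restrict (openSlab N T))) (h : IsExtendedFlow T a q D)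
    {π : ℝ → Space N → ℝ} (hπ : π ∈ Submodule.span ℝ (jacobianSolutions T a)) :
    ∀ t ∈ Ioo 0 T, ∀ᵐ x, (t, x) ∉ exceptionalSupport T a →
      π t x = π T (q (t, x)) * spaceJac q t x := by
  have hTmem : T ∈ Icc 0 T := right_mem_Icc.2 hT.le
  induction hπ using Submodule.span_induction with
  | mem π hmem =>
    obtain ⟨hm, p', hp', hps', hπ⟩ := hmem
    obtain ⟨p, hp, hpp, -⟩ := exists_locallyLipschitz_extension hT.le hp'
    have hps := hps'.congr hpp
    intro t ht
    have ht' := Ioo_subset_Icc_self ht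
    let f : Space N → Space N := fun y => p (T, y)
    have hf : LocallyLipschitz f := locallyLipschitz_slice hp T
    let r : ℝ × Space N → Space N := fun z => f (q z)
    have hr : LocallyLipschitz r := hf.comp h.lip
    have hrs : SolvesTransport T a r := h.solves.comp h.lip hf
    -- `p` and `r = p(T, q)` are solutions with equal final values, so each coordinate of `p - r` is
    -- exceptional and vanishes off `V_e`.
    have heq : ∀ z ∈ openSlab N T, z ∉ exceptionalSupport T a → p z = r z := by
      intro z hz hzV
      ext i
      by_contra hne
      refine hzV (mem_iUnion₂.2 ⟨_, coord_sub_mem_exceptionalSolutions hp hps hr hrs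
        (fun x => ?_) i, hz, sub_ne_zero.2 hne⟩)
      simp [r, f, h.final]
    have hS : MeasurableSet {x : Space N | (t, x) ∉ exceptionalSupport T a} :=
      (isOpen_exceptionalSupport.measurableSet.preimage measurable_prodMk_left).compl
    filter_upwards [hπ t ht', ae_jac_eq_of_eqOn (locallyLipschitz_slice hp t)
      (locallyLipschitz_slice hr t) hS fun x hx => heq (t, x) (mem_openSlab.2 ht) hx,
      h.ae_jac_comp hT ha ht' hf, h.ae_eq_comp_mk hT ha (hπ T hTmem) ht'] with x h1 h2 h3 h4 hx
    rw [h1, h4, ← spaceJac_congr hpp ht', ← spaceJac_congr hpp hTmem]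
    exact (h2 hx).trans h3
  | zero => exact fun t _ => Filter.Eventually.of_forall fun x _ => by simp
  | add π ρ _ _ h1 h2 =>
    intro t ht
    filter_upwards [h1 t ht, h2 t ht] with x hx1 hx2 hx
    simp only [Pi.add_apply, hx1 hx, hx2 hx]
    ring
  | smul c π _ h1 =>
    intro t ht
    filter_upwards [h1 t ht] with x hx1 hx
    simp only [Pi.smul_apply, smul_eq_mul, hx1 hx]
    ring

lemma IsExtendedFlow.ae_jac_eq_zero (hT : 0 < T)
    (ha : MemLp a ⊤ (volume.restrict (openSlab N T))) (h : IsExtendedFlow T a q D) :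
    ∀ᵐ z ∂volume.restrict (openSlab N T), z ∈ exceptionalSupport T a → spaceJac q z.1 z.2 = 0 :=
  ae_eq_zero_on_exceptionalSupport hT ha ((locallyBounded_spaceJac h.lip T).slabBounded
    (measurable_spaceJac h.lip.continuous).aestronglyMeasurable)
    (lipschitzWeak_spaceJac h.lip h.solves) h.nonneg

/-- A combination of Jacobian solutions that vanishes on the exceptional support is reversible. -/
theorem mem_reversibleSolutions_of_mem_span (hT : 0 < T)
    (ha : MemLp a ⊤ (volume.restrict (openSlab N T))) {X : ℝ × Space N → Space N}
    (hX : IsTransportFlow T a X) {π : ℝ → Space N → ℝ}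
    (hπ : π ∈ Submodule.span ℝ (jacobianSolutions T a))
    (hV : ∀ᵐ z ∂volume.restrict (openSlab N T), z ∈ exceptionalSupport T a → π z.1 z.2 = 0) :
    π ∈ reversibleSolutions T a := by
  obtain ⟨q, D, h, hqX⟩ := hX.exists_extension hT
  have hTmem : T ∈ Icc 0 T := right_mem_Icc.2 hT.le
  have hreg := isRegularSolution_of_mem_span ha hT hπ
  have hgm := hreg.measurable_slice T hTmem
  set g := hgm.mk with hg
  have hgmeas : Measurable g := hgm.stronglyMeasurable_mk.measurable
  -- The Borel representative `g` of `π T` makes `ρ` jointly measurable; along the flow the choice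
  -- of representative is immaterial.
  let ρ : ℝ → Space N → ℝ := fun t x => g (q (t, x)) * spaceJac q t x
  have hρm : Measurable fun z : ℝ × Space N => ρ z.1 z.2 :=
    (hgmeas.comp h.lip.continuous.measurable).mul (measurable_spaceJac h.lip.continuous)
  have hρ : ρ ∈ weakSolutions T a := by
    refine h.mem_weakSolutions_of_measurable hT ha hgmeas (fun R => ?_) hρm.aestronglyMeasurable
      fun t _ => Filter.Eventually.of_forall fun x => rfl
    obtain ⟨C, hC0, hC⟩ := hreg.bounded R
    refine ⟨C, hC0, ?_⟩
    filter_upwards [hC T hTmem, hgm.ae_eq_mk] with y hy hy' hyR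
    rw [hg, ← hy']
    exact hy hyR
  -- On `V_e` both sides vanish, `π` by hypothesis and `ρ` through the Jacobian of the flow; off
  -- `V_e` the transport formula applies.
  have hae : ∀ᵐ z ∂volume.restrict (openSlab N T), π z.1 z.2 = ρ z.1 z.2 := by
    refine ae_openSlab_of_ae_slice (P := fun z => π z.1 z.2 = ρ z.1 z.2)
      (nullMeasurableSet_eq_fun hreg.weakStar.measurable.aemeasurable
      hρm.aemeasurable) ?_
    filter_upwards [ae_slice_of_ae_openSlab hV, ae_slice_of_ae_openSlab (h.ae_jac_eq_zero hT ha),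
      ae_restrict_mem measurableSet_Ioo] with t h1 h2 ht
    have ht' := Ioo_subset_Icc_self ht
    filter_upwards [h1, h2, h.ae_eq_of_mem_span hT ha hπ t ht,
      h.ae_eq_comp_mk hT ha hgm.ae_eq_mk ht'] with x h1 h2 h3 h4
    by_cases hx : (t, x) ∈ exceptionalSupport T a
    · have e1 : spaceJac q t x = 0 := h2 hx
      have e2 : π t x = 0 := h1 hx
      simp [ρ, e1, e2]
    · rw [h3 hx, h4]
  refine ⟨hreg.mem_weakSolutions, X, hX, fun t ht => ?_⟩
  filter_upwards [hreg.weakStar.ae_eq hT hρ.1 hae t ht,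
    h.ae_eq_comp_mk hT ha hgm.ae_eq_mk ht] with x h1 h2
  rw [h1, ← hqX (mk_mem_closedSlab.2 ht), ← spaceJac_congr hqX ht, h2]

/-- A constant map solves the equation and has zero Jacobian because `N ≥ 1`. This absorbs the
difference between two representatives of the same curve of classes. -/
lemma jacobianSolutions_of_ae_zero (hN : 1 ≤ N) {π : ℝ → Space N → ℝ}
    (hm : AEStronglyMeasurable (fun z : ℝ × Space N => π z.1 z.2) (volume.restrict (openSlab N T)))
    (h : ∀ t ∈ Icc 0 T, π t =ᵐ[volume] 0) : π ∈ jacobianSolutions T a := by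
  refine ⟨hm, fun _ => 0, (LocallyLipschitz.const 0).locallyLipschitzOn,
    Filter.Eventually.of_forall fun z => by simp [transportOp], fun t ht => ?_⟩
  filter_upwards [h t ht] with x hx
  have hN' : N ≠ 0 := by omega
  simp [hx, spaceJac, jac, ContinuousLinearMap.det, hN']

/-- For `g = J(f)` the chain rule gives `g(q) J(q) = J(f ∘ q)`, and `f ∘ q` solves the transport
equation; the rest is linearity. -/
lemma IsExtendedFlow.exists_mem_span (hT : 0 < T)
    (ha : MemLp a ⊤ (volume.restrict (openSlab N T))) (h : IsExtendedFlow T a q D)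
    {g : Space N → ℝ} (hg : g ∈ Submodule.span ℝ {g : Space N → ℝ |
      ∃ f : Space N → Space N, LocallyLipschitz f ∧ g = jac f}) :
    ∃ ρ ∈ Submodule.span ℝ (jacobianSolutions T a), ∀ t ∈ Icc 0 T,
      ∀ᵐ x, ρ t x = g (q (t, x)) * spaceJac q t x := by
  induction hg using Submodule.span_induction with
  | mem g hmem =>
    obtain ⟨f, hf, rfl⟩ := hmem
    have hr : LocallyLipschitz fun z => f (q z) := hf.comp h.lip
    exact ⟨spaceJac fun z => f (q z), Submodule.subset_span
      ⟨(measurable_spaceJac hr.continuous).aestronglyMeasurable, _, hr.locallyLipschitzOn,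
        h.solves.comp h.lip hf, fun _ _ => Filter.EventuallyEq.rfl⟩,
      fun t ht => h.ae_jac_comp hT ha ht hf⟩
  | zero => exact ⟨0, Submodule.zero_mem _, fun t _ => by simp⟩
  | add g g' _ _ h1 h2 =>
    obtain ⟨ρ, hρ, h1⟩ := h1
    obtain ⟨ρ', hρ', h2⟩ := h2
    refine ⟨ρ + ρ', Submodule.add_mem _ hρ hρ', fun t ht => ?_⟩
    filter_upwards [h1 t ht, h2 t ht] with x hx hx'
    simp only [Pi.add_apply, hx, hx']
    ring
  | smul c g _ h1 =>
    obtain ⟨ρ, hρ, h1⟩ := h1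
    refine ⟨c • ρ, Submodule.smul_mem _ c hρ, fun t ht => ?_⟩
    filter_upwards [h1 t ht] with x hx
    simp only [Pi.smul_apply, smul_eq_mul, hx]
    ring

theorem mem_span_of_mem_reversibleSolutions (hN : 1 ≤ N) (hT : 0 < T)
    (ha : MemLp a ⊤ (volume.restrict (openSlab N T))) {π : ℝ → Space N → ℝ}
    (hπ : π ∈ reversibleSolutions T a) (hJ : IsJacobianCombination (π T)) :
    π ∈ Submodule.span ℝ (jacobianSolutions T a) := by
  obtain ⟨hW, X, hX, hrep⟩ := hπ
  obtain ⟨q, D, h, hqX⟩ := hX.exists_extension hT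
  obtain ⟨g, hg, hgT⟩ := hJ
  obtain ⟨ρ, hρ, hρg⟩ := h.exists_mem_span hT ha hg
  have hreg := isRegularSolution_of_mem_span ha hT hρ
  rw [← add_sub_cancel ρ π]
  refine Submodule.add_mem _ hρ (Submodule.subset_span (jacobianSolutions_of_ae_zero hN
    (hW.1.measurable.sub hreg.weakStar.measurable) fun t ht => ?_))
  filter_upwards [hrep t ht, hρg t ht, h.ae_eq_comp_mk hT ha hgT ht] with x h1 h2 h3
  rw [← hqX (mk_mem_closedSlab.2 ht), ← spaceJac_congr hqX ht] at h1
  simp [h1, h2, h3]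

/-- The factor `J(X)` is a nonnegative weak solution, so it already vanishes on `V_e`. -/
theorem mem_vanishingSolutions_of_mem_reversibleSolutions (hT : 0 < T)
    (ha : MemLp a ⊤ (volume.restrict (openSlab N T))) {π : ℝ → Space N → ℝ}
    (hπ : π ∈ reversibleSolutions T a) : π ∈ vanishingSolutions T a := by
  obtain ⟨hW, X, hX, hrep⟩ := hπ
  obtain ⟨q, D, h, hqX⟩ := hX.exists_extension hT
  refine ⟨hW, ?_⟩
  have key : ∀ᵐ z ∂volume.restrict (openSlab N T), z ∈ exceptionalSupport T a →
      π z.1 z.2 = 0 := by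
    refine ae_openSlab_of_ae_slice (P := fun z => z ∈ exceptionalSupport T a → π z.1 z.2 = 0) ?_ ?_
    · have h1 : NullMeasurableSet {z : ℝ × Space N | π z.1 z.2 = 0}
          (volume.restrict (openSlab N T)) :=
        nullMeasurableSet_eq_fun hW.1.measurable.aemeasurable aemeasurable_const
      have : {z : ℝ × Space N | z ∈ exceptionalSupport T a → π z.1 z.2 = 0} =
          (exceptionalSupport T a)ᶜ ∪ {z : ℝ × Space N | π z.1 z.2 = 0} := by
        ext z; simp [imp_iff_not_or]
      rw [this]
      exact isOpen_exceptionalSupport.measurableSet.compl.nullMeasurableSet.union h1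
    · filter_upwards [ae_slice_of_ae_openSlab (h.ae_jac_eq_zero hT ha),
        ae_restrict_mem measurableSet_Ioo] with t h1 ht
      have ht' := Ioo_subset_Icc_self ht
      filter_upwards [h1, hrep t ht'] with x h1 h2 hx
      have e1 : spaceJac q t x = 0 := h1 hx
      rw [← spaceJac_congr hqX ht', e1, mul_zero] at h2
      exact h2
  rw [ae_restrict_iff' measurableSet_openSlab] at key
  filter_upwards [key] with z hz hzV
  exact hz (exceptionalSupport_subset hzV) hzV

/-- Since `J(X) ≥ 0`, the absolute value passes to the final data: `|π| = |π(T)|(X) J(X)`. -/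
theorem abs_mem_weakSolutions (hT : 0 < T)
    (ha : MemLp a ⊤ (volume.restrict (openSlab N T))) {π : ℝ → Space N → ℝ}
    (hπ : π ∈ Submodule.span ℝ (jacobianSolutions T a)) (hrev : π ∈ reversibleSolutions T a) :
    (fun t x => |π t x|) ∈ weakSolutions T a := by
  obtain ⟨hW, X, hX, hrep⟩ := hrev
  obtain ⟨q, D, h, hqX⟩ := hX.exists_extension hT
  have hTmem : T ∈ Icc 0 T := right_mem_Icc.2 hT.le
  have hreg := isRegularSolution_of_mem_span ha hT hπ
  refine h.mem_weakSolutions hT ha (g := fun y => |π T y|) (hreg.measurable_slice T hTmem).norm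
    (fun R => ?_) hW.1.measurable.norm fun t ht => ?_
  · obtain ⟨C, hC0, hC⟩ := hreg.bounded R
    exact ⟨C, hC0, by simpa using hC T hTmem⟩
  · filter_upwards [hrep t ht, h.jac_nonneg hT t ht] with x h1 h2
    rw [h1, ← hqX (mk_mem_closedSlab.2 ht), ← spaceJac_congr hqX ht, abs_mul, abs_of_nonneg h2]

/-- As a nonnegative weak solution `|π|` vanishes on `V_e`, hence so does `π`. -/
theorem mem_reversibleSolutions_of_abs (hT : 0 < T)
    (ha : MemLp a ⊤ (volume.restrict (openSlab N T))) {X : ℝ × Space N → Space N}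
    (hX : IsTransportFlow T a X) {π : ℝ → Space N → ℝ}
    (hπ : π ∈ Submodule.span ℝ (jacobianSolutions T a))
    (habs : (fun t x => |π t x|) ∈ weakSolutions T a) : π ∈ reversibleSolutions T a := by
  have hreg := isRegularSolution_of_mem_span ha hT hπ
  have hb : SlabBounded T fun z => |π z.1 z.2| := by
    refine ⟨habs.1.measurable, fun R => ?_⟩
    simpa only [abs_abs] using hreg.slabBounded.2 R
  have hz := ae_eq_zero_on_exceptionalSupport hT ha hb (lipschitzWeak_of_smooth ha hb habs.2)
    (Filter.Eventually.of_forall fun z => abs_nonneg _)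
  refine mem_reversibleSolutions_of_mem_span hT ha hX hπ ?_
  filter_upwards [hz] with z hz hzV
  exact abs_eq_zero.1 (hz hzV)

end Characterization

/-! ### Approximate flows by the explicit Euler scheme -/

section Euler

variable {N : ℕ}

/-- The length of the part of `[kh, (k+1)h]` that lies after the time `t`. -/
def remainingTime (h : ℝ) (k : ℕ) (t : ℝ) : ℝ := max ((k + 1) * h - t) 0 - max (k * h - t) 0

/-- `k` steps of the explicit Euler scheme of step `h` on the grid `hℕ` for the field `b`, started
at `x` at time `t`. -/
def eulerScheme (b : ℝ × Space N → Space N) (h : ℝ) : ℕ → ℝ × Space N → Space N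
  | 0, z => z.2
  | k + 1, z => eulerScheme b h k z +
      remainingTime h k z.1 • b (k * h, eulerScheme b h k z)

variable {h : ℝ}

lemma remainingTime_nonneg (hh : 0 ≤ h) (k : ℕ) (t : ℝ) : 0 ≤ remainingTime h k t := by
  unfold remainingTime
  have : max (k * h - t) 0 ≤ max ((k + 1) * h - t) 0 := by gcongr; linarith
  linarith

lemma remainingTime_le (hh : 0 ≤ h) (k : ℕ) (t : ℝ) : remainingTime h k t ≤ h := by
  unfold remainingTime
  have : max ((k + 1) * h - t) 0 ≤ max (k * h - t) 0 + h := by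
    apply max_le
    · have := le_max_left (k * h - t) 0; linarith
    · have := le_max_right (k * h - t) 0; linarith
  linarith

lemma remainingTime_antitone (hh : 0 ≤ h) (k : ℕ) : Antitone (remainingTime h k) := by
  intro s t hst
  have e : ((k : ℝ) + 1) * h = k * h + h := by ring
  unfold remainingTime
  rw [e]
  rcases max_cases (k * h + h - s) 0 with h1 | h1 <;>
    rcases max_cases (k * h - s) 0 with h2 | h2 <;>
  rcases max_cases (k * h + h - t) 0 with h3 | h3 <;>
    rcases max_cases (k * h - t) 0 with h4 | h4 <;>
  linarith

lemma remainingTime_eq_zero (hh : 0 ≤ h) {k : ℕ} {t : ℝ} (ht : (k + 1) * h ≤ t) :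
    remainingTime h k t = 0 := by
  have : k * h ≤ t := by linarith
  rw [remainingTime, max_eq_right (by linarith), max_eq_right (by linarith), sub_zero]

lemma remainingTime_eq (hh : 0 ≤ h) {k : ℕ} {t : ℝ} (ht : t ≤ k * h) : remainingTime h k t = h := by
  rw [remainingTime, max_eq_left (by linarith), max_eq_left (by linarith)]
  ring

lemma remainingTime_eq_sub {k : ℕ} {t : ℝ} (ht : k * h ≤ t) (ht' : t ≤ (k + 1) * h) :
    remainingTime h k t = (k + 1) * h - t := by
  rw [remainingTime, max_eq_left (by linarith), max_eq_right (by linarith), sub_zero]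

lemma sum_remainingTime (n : ℕ) (t : ℝ) :
    ∑ k ∈ Finset.range n, remainingTime h k t = max (n * h - t) 0 - max (-t) 0 := by
  have := Finset.sum_range_sub (fun k : ℕ => max (k * h - t) 0) n
  simpa [remainingTime] using this

/-- Each remaining time decreases in the starting time, so all differences have one sign and the sum
telescopes. -/
lemma sum_abs_remainingTime_sub_le (hh : 0 ≤ h) (n : ℕ) (s t : ℝ) :
    ∑ k ∈ Finset.range n, |remainingTime h k s - remainingTime h k t| ≤ |s - t| := by
  wlog hst : s ≤ t generalizing s t
  · rw [abs_sub_comm]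
    simpa only [abs_sub_comm] using this t s (le_of_not_ge hst)
  have e : ∀ k ∈ Finset.range n, |remainingTime h k s - remainingTime h k t| =
      remainingTime h k s - remainingTime h k t := fun k _ =>
    abs_of_nonneg (sub_nonneg.2 (remainingTime_antitone hh k hst))
  rw [Finset.sum_congr rfl e, Finset.sum_sub_distrib, sum_remainingTime, sum_remainingTime,
    abs_of_nonpos (by linarith)]
  have hn : 0 ≤ n * h := by positivity
  rcases max_cases (n * h - s) 0 with h1 | h1 <;> rcases max_cases (-s) 0 with h2 | h2 <;>
  rcases max_cases (n * h - t) 0 with h3 | h3 <;> rcases max_cases (-t) 0 with h4 | h4 <;>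
  linarith

lemma eulerScheme_eq_snd (b : ℝ × Space N → Space N) (hh : 0 ≤ h) {t : ℝ} (x : Space N) :
    ∀ {k : ℕ}, k * h ≤ t → eulerScheme b h k (t, x) = x
  | 0, _ => rfl
  | k + 1, hk => by
    push_cast at hk
    rw [eulerScheme, eulerScheme_eq_snd b hh x (k := k) (by linarith),
      remainingTime_eq_zero hh hk, zero_smul, add_zero]

/-- Steps before cell `j` are void and steps after it are full, so only the partial step inside the
cell depends on the starting time. -/
lemma eulerScheme_step (b : ℝ × Space N → Space N) (hh : 0 ≤ h) {t : ℝ} (x : Space N) {j m : ℕ}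
    (hjm : j + 1 ≤ m) (ht : j * h ≤ t) (ht' : t ≤ (j + 1) * h) :
    eulerScheme b h m (t, x) =
      eulerScheme b h m ((j + 1) * h, x + ((j + 1) * h - t) • b (j * h, x)) := by
  induction m, hjm using Nat.le_induction with
  | base =>
    rw [eulerScheme_eq_snd b hh (t := (j + 1) * h) _ (by push_cast; rfl), eulerScheme,
      eulerScheme_eq_snd b hh x ht, remainingTime_eq_sub ht ht']
  | succ m hm ih =>
    have hm' : (j + 1) * h ≤ m * h := by
      gcongr
      exact_mod_cast hm
    rw [eulerScheme, eulerScheme, ih, remainingTime_eq hh (ht'.trans hm'), remainingTime_eq hh hm']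

/-- Expanding the square, the term linear in the step is controlled by the one-sided constant `β`;
the Lipschitz constant `K` enters only with `h ^ 2`. -/
lemma norm_add_smul_sub_le {b : Space N → Space N} {K β σ : ℝ} {x y : Space N}
    (hK : ‖b x - b y‖ ≤ K * ‖x - y‖) (hβ : inner ℝ (b x - b y) (x - y) ≤ β * ‖x - y‖ ^ 2)
    (hβ0 : 0 ≤ β) (hσ : 0 ≤ σ) (hσh : σ ≤ h) :
    ‖(x + σ • b x) - (y + σ • b y)‖ ≤ Real.exp (h * β + h ^ 2 * K ^ 2 / 2) * ‖x - y‖ := by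
  have e : (x + σ • b x) - (y + σ • b y) = (x - y) + σ • (b x - b y) := by module
  refine le_of_sq_le_sq ?_ (by positivity)
  have h1 : ‖b x - b y‖ ^ 2 ≤ K ^ 2 * ‖x - y‖ ^ 2 := by
    rw [← mul_pow]; exact pow_le_pow_left₀ (norm_nonneg _) hK 2
  have h2 : 1 + 2 * h * β + h ^ 2 * K ^ 2 ≤ Real.exp (2 * h * β + h ^ 2 * K ^ 2) := by
    have := Real.add_one_le_exp (2 * h * β + h ^ 2 * K ^ 2); linarith
  have h3 : Real.exp (h * β + h ^ 2 * K ^ 2 / 2) ^ 2 = Real.exp (2 * h * β + h ^ 2 * K ^ 2) := by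
    rw [sq, ← Real.exp_add]; ring_nf
  rw [e, norm_add_sq_real, inner_smul_right, norm_smul, mul_pow, mul_pow, h3, Real.norm_eq_abs,
    sq_abs, real_inner_comm]
  have h4 : σ * inner ℝ (b x - b y) (x - y) ≤ h * β * ‖x - y‖ ^ 2 :=
    (mul_le_mul_of_nonneg_left hβ hσ).trans (by rw [mul_assoc]; gcongr)
  have h5 : σ ^ 2 * ‖b x - b y‖ ^ 2 ≤ h ^ 2 * (K ^ 2 * ‖x - y‖ ^ 2) := by gcongr
  calc _ ≤ (1 + 2 * h * β + h ^ 2 * K ^ 2) * ‖x - y‖ ^ 2 := by linarith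
    _ ≤ _ := by gcongr

/-- The stretch factors of the steps multiply. Different starting times add, at each step, at most
`M` times the difference of the step lengths. -/
theorem norm_eulerScheme_sub_le {b : ℝ × Space N → Space N} {K : ℝ≥0} {M : ℝ} {β : ℝ → ℝ}
    (hK : LipschitzWith K b) (hM : ∀ z, ‖b z‖ ≤ M) (hβ0 : ∀ t, 0 ≤ β t)
    (hβ : ∀ t x y, inner ℝ (b (t, x) - b (t, y)) (x - y) ≤ β t * ‖x - y‖ ^ 2) (hh : 0 ≤ h)
    (z w : ℝ × Space N) (n : ℕ) :
    ‖eulerScheme b h n z - eulerScheme b h n w‖ ≤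
      Real.exp (∑ k ∈ Finset.range n, (h * β (k * h) + h ^ 2 * K ^ 2 / 2)) *
        (‖z.2 - w.2‖ +
          M * ∑ k ∈ Finset.range n, |remainingTime h k z.1 - remainingTime h k w.1|) := by
  have hM0 : 0 ≤ M := (norm_nonneg _).trans (hM 0)
  have hk : ∀ k : ℕ, 0 ≤ h * β (k * h) + h ^ 2 * K ^ 2 / 2 := fun k => by
    have := hβ0 (k * h); positivity
  induction n with
  | zero => simp [eulerScheme]
  | succ n ih =>
    set S := ∑ k ∈ Finset.range n, (h * β (k * h) + h ^ 2 * K ^ 2 / 2)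
    set Y := eulerScheme b h n z
    set Y' := eulerScheme b h n w
    set σ := remainingTime h n z.1
    set σ' := remainingTime h n w.1
    set D := ‖z.2 - w.2‖ + M * ∑ k ∈ Finset.range n, |remainingTime h k z.1 - remainingTime h k w.1|
    have hS : 0 ≤ S := Finset.sum_nonneg fun k _ => hk k
    have e : eulerScheme b h (n + 1) z - eulerScheme b h (n + 1) w =
        ((Y + σ • b (n * h, Y)) - (Y' + σ • b (n * h, Y'))) + (σ - σ') • b (n * h, Y') := by
      simp only [eulerScheme]
      module
    have h1 : ‖(Y + σ • b (n * h, Y)) - (Y' + σ • b (n * h, Y'))‖ ≤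
        Real.exp (h * β (n * h) + h ^ 2 * K ^ 2 / 2) * ‖Y - Y'‖ := by
      refine norm_add_smul_sub_le (b := fun x => b (n * h, x)) ?_ (hβ _ _ _) (hβ0 _)
        (remainingTime_nonneg hh _ _) (remainingTime_le hh _ _)
      refine (hK.norm_sub_le _ _).trans_eq ?_
      simp [Prod.norm_def]
    have h2 : ‖(σ - σ') • b (n * h, Y')‖ ≤ |σ - σ'| * M := by
      rw [norm_smul, Real.norm_eq_abs]; gcongr; exact hM _
    rw [Finset.sum_range_succ, Finset.sum_range_succ, Real.exp_add, e]
    have h3 : 1 ≤ Real.exp S * Real.exp (h * β (n * h) + h ^ 2 * K ^ 2 / 2) := by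
      rw [← Real.exp_add]; exact Real.one_le_exp (add_nonneg hS (hk n))
    calc _ ≤ Real.exp (h * β (n * h) + h ^ 2 * K ^ 2 / 2) * (Real.exp S * D) + |σ - σ'| * M := by
          refine (norm_add_le _ _).trans (add_le_add (h1.trans ?_) h2)
          gcongr
      _ ≤ Real.exp (h * β (n * h) + h ^ 2 * K ^ 2 / 2) * (Real.exp S * D) +
          (Real.exp S * Real.exp (h * β (n * h) + h ^ 2 * K ^ 2 / 2)) * (|σ - σ'| * M) := by
          exact add_le_add le_rfl (le_mul_of_one_le_left (by positivity) h3)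
      _ = _ := by ring

lemma lipschitzWith_eulerScheme {b : ℝ × Space N → Space N} {K : ℝ≥0} {M A : ℝ} {β : ℝ → ℝ}
    (hK : LipschitzWith K b) (hM : ∀ z, ‖b z‖ ≤ M) (hβ0 : ∀ t, 0 ≤ β t)
    (hβ : ∀ t x y, inner ℝ (b (t, x) - b (t, y)) (x - y) ≤ β t * ‖x - y‖ ^ 2) (hh : 0 ≤ h)
    {n : ℕ} (hA : ∑ k ∈ Finset.range n, (h * β (k * h) + h ^ 2 * K ^ 2 / 2) ≤ A) :
    LipschitzWith (Real.exp A * (1 + M)).toNNReal (eulerScheme b h n) := by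
  have hM0 : 0 ≤ M := (norm_nonneg _).trans (hM 0)
  refine LipschitzWith.of_dist_le_mul fun z w => ?_
  rw [Real.coe_toNNReal _ (by positivity), dist_eq_norm, mul_assoc]
  refine (norm_eulerScheme_sub_le hK hM hβ0 hβ hh z w n).trans ?_
  have h1 : ‖z.2 - w.2‖ ≤ dist z w := by
    rw [← dist_eq_norm]; exact le_max_right _ _
  have h2 : |z.1 - w.1| ≤ dist z w := by
    rw [← Real.dist_eq]; exact le_max_left _ _
  have h3 := (sum_abs_remainingTime_sub_le hh n z.1 w.1).trans h2
  rw [one_add_mul]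
  gcongr

/-- Each step is the identity plus a perturbation of norm at most `h * K < 1`, so its determinant is
nonnegative, and determinants multiply under composition. -/
lemma spaceJac_eulerScheme_nonneg {b : ℝ × Space N → Space N} {K : ℝ≥0} (hK : LipschitzWith K b)
    (hb : Differentiable ℝ b) (hh : 0 ≤ h) (hhK : h * K < 1) (n : ℕ) (t : ℝ) :
    (Differentiable ℝ fun x => eulerScheme b h n (t, x)) ∧
      ∀ x, 0 ≤ spaceJac (eulerScheme b h n) t x := by
  induction n with
  | zero =>
    refine ⟨differentiable_id, fun x => ?_⟩
    have : (fun y : Space N => eulerScheme b h 0 (t, y)) = id := rfl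
    simp [spaceJac, jac, this, ContinuousLinearMap.det]
  | succ n ih =>
    set σ := remainingTime h n t
    set g : Space N → Space N := fun y => y + σ • b (n * h, y)
    have hbn : Differentiable ℝ fun y : Space N => b (n * h, y) := by fun_prop
    have hbL : LipschitzWith K fun y : Space N => b (n * h, y) := by
      refine LipschitzWith.of_dist_le_mul fun x y => (hK.dist_le_mul _ _).trans_eq ?_
      simp [Prod.dist_eq]
    have hg : Differentiable ℝ g := by fun_prop
    have hσ0 : 0 ≤ σ := remainingTime_nonneg hh _ _
    have hσ : σ ≤ h := remainingTime_le hh _ _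
    have e : (fun x => eulerScheme b h (n + 1) (t, x)) = g ∘ fun x => eulerScheme b h n (t, x) :=
      rfl
    refine ⟨e ▸ hg.comp ih.1, fun x => ?_⟩
    have hd : ∀ y, 0 ≤ (fderiv ℝ g y).det := fun y => by
      have e2 : fderiv ℝ g y = (1 : ℝ) • ContinuousLinearMap.id ℝ _ +
          σ • fderiv ℝ (fun y : Space N => b (n * h, y)) y := by
        rw [one_smul]
        exact ((hasFDerivAt_id y).add ((hbn y).hasFDerivAt.const_smul σ)).fderiv
      rw [e2]
      apply det_smul_id_add_nonneg
      rw [norm_smul, Real.norm_of_nonneg hσ0]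
      calc _ ≤ h * K := by gcongr; exact norm_fderiv_le_of_lipschitz ℝ hbL
        _ < 1 := hhK
    have h1 := ih.2 x
    rw [spaceJac, jac] at h1 ⊢
    have e3 := LinearMap.det_comp (fderiv ℝ g (eulerScheme b h n (t, x))).toLinearMap
      (fderiv ℝ (fun x => eulerScheme b h n (t, x)) x).toLinearMap
    rw [e, fderiv_comp _ (hg _) (ih.1 x)]
    exact (mul_nonneg (hd _) h1).trans_eq e3.symm

lemma norm_fderiv_apply_le_of_eventually {V F : Type*} [NormedAddCommGroup V] [NormedSpace ℝ V]
    [NormedAddCommGroup F] [NormedSpace ℝ F] {f : V → F} {x v : V} {C : ℝ} (hC : 0 ≤ C)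
    (h : ∀ᶠ s in 𝓝 (0 : ℝ), ‖f (x + s • v) - f x‖ ≤ C * |s|) : ‖fderiv ℝ f x v‖ ≤ C := by
  by_cases hf : DifferentiableAt ℝ f x
  · have h1 := hf.hasFDerivAt.hasLineDerivAt v
    refine HasDerivAt.le_of_lip' (f := fun s : ℝ => f (x + s • v)) h1 hC ?_
    simpa using h
  · simpa [fderiv_zero_of_not_differentiableAt hf] using hC

/-- Moving in the cell along the frozen velocity `v = b(jh, x)` changes the next grid position only
through the variation of `b`, which is of order `h`. Replacing `v` by `b(t,x)` costs another `L * K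
* h`. -/
lemma norm_transportOp_eulerScheme_le {b : ℝ × Space N → Space N} {K L : ℝ≥0} {M : ℝ}
    (hK : LipschitzWith K b) (hM : ∀ z, ‖b z‖ ≤ M) (hh : 0 ≤ h) {n j : ℕ} (hj : j < n)
    (hL : LipschitzWith L (eulerScheme b h n)) {t : ℝ} (ht : j * h < t) (ht' : t < (j + 1) * h)
    (x : Space N) : ‖transportOp b (eulerScheme b h n) (t, x)‖ ≤ L * K * h * (M + 1) := by
  have hM0 : 0 ≤ M := (norm_nonneg _).trans (hM 0)
  set X := eulerScheme b h n
  set v := b (j * h, x)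
  have h1 : ‖fderiv ℝ X (t, x) (1, v)‖ ≤ L * (h * (K * M)) := by
    refine norm_fderiv_apply_le_of_eventually (by positivity) ?_
    have hev : ∀ᶠ s in 𝓝 (0 : ℝ), j * h < t + s ∧ t + s < (j + 1) * h := by
      have hc : Filter.Tendsto (fun s : ℝ => t + s) (𝓝 0) (𝓝 t) := by
        have : Continuous fun s : ℝ => t + s := by fun_prop
        simpa using this.tendsto 0
      exact (hc.eventually_const_lt ht).and (hc.eventually_lt_const ht')
    filter_upwards [hev] with s hs
    have e1 : ((t, x) + s • ((1 : ℝ), v) : ℝ × Space N) = (t + s, x + s • v) := by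
      simp
    have e3 : X (t, x) = X _ := eulerScheme_step b hh x hj ht.le ht'.le
    have e4 : X (t + s, x + s • v) = X _ := eulerScheme_step b hh _ hj hs.1.le hs.2.le
    rw [e1, e3, e4]
    refine (hL.norm_sub_le _ _).trans ?_
    rw [mul_assoc]
    gcongr
    have e2 : (((j + 1) * h, x + s • v + ((j + 1) * h - (t + s)) • b (j * h, x + s • v)) -
        ((j + 1) * h, x + ((j + 1) * h - t) • b (j * h, x)) : ℝ × Space N) =
        (0, ((j + 1) * h - (t + s)) • (b (j * h, x + s • v) - v)) := by
      refine Prod.ext (by simp) ?_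
      simp only [Prod.snd_sub]
      module
    have h2 : ‖b (j * h, x + s • v) - v‖ ≤ K * M * |s| := by
      refine (hK.norm_sub_le _ _).trans ?_
      simp only [Prod.mk_sub_mk, sub_self, add_sub_cancel_left, Prod.norm_mk, norm_zero, norm_smul,
        Real.norm_eq_abs, mul_assoc]
      gcongr
      rw [max_eq_right (by positivity), mul_comm]
      gcongr
      exact hM _
    rw [e2, Prod.norm_mk, norm_zero, max_eq_right (norm_nonneg _), norm_smul, mul_assoc]
    gcongr
    rw [Real.norm_of_nonneg (by linarith)]
    linarith
  have h2 : ‖b (t, x) - v‖ ≤ K * h := by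
    refine (hK.norm_sub_le _ _).trans ?_
    simp only [Prod.mk_sub_mk, sub_self, Prod.norm_mk, norm_zero]
    gcongr
    rw [max_eq_left (norm_nonneg _), Real.norm_of_nonneg (by linarith)]
    linarith
  have e : transportOp b X (t, x) = fderiv ℝ X (t, x) (1, v) +
      fderiv ℝ X (t, x) (0, b (t, x) - v) := by
    rw [← map_add, Prod.mk_add_mk, add_zero, add_sub_cancel]; rfl
  have h3 : ‖fderiv ℝ X (t, x) (0, b (t, x) - v)‖ ≤ L * (K * h) := by
    refine (ContinuousLinearMap.le_opNorm _ _).trans ?_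
    rw [Prod.norm_mk, norm_zero, max_eq_right (norm_nonneg _)]
    gcongr
    exact norm_fderiv_le_of_lipschitz ℝ hL
  rw [e]
  refine (norm_add_le _ _).trans ((add_le_add h1 h3).trans_eq ?_)
  ring

lemma sum_mul_le_integral_add {β : ℝ → ℝ} (hβ : Continuous β) {n : ℕ} {c : ℝ} (hh : 0 ≤ h)
    (hc : ∀ s ∈ Icc 0 (n * h), ∀ t ∈ Icc 0 (n * h), |s - t| ≤ h → β s ≤ β t + c) :
    ∑ k ∈ Finset.range n, h * β (k * h) ≤ (∫ t in 0..n * h, β t) + n * h * c := by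
  have hi := intervalIntegral.sum_integral_adjacent_intervals (f := β) (μ := volume)
    (a := fun k : ℕ => k * h) (n := n) fun k _ => hβ.intervalIntegrable _ _
  simp only [Nat.cast_zero, zero_mul] at hi
  have e : n * h * c = ∑ k ∈ Finset.range n, h * c := by simp; ring
  rw [← hi, e, ← Finset.sum_add_distrib]
  refine Finset.sum_le_sum fun k hk => ?_
  have hkn : ((k : ℝ) + 1) * h ≤ n * h := by
    gcongr
    exact_mod_cast Finset.mem_range.1 hk
  have hk0 : 0 ≤ k * h := by positivity
  have h1 : ∫ t in k * h..(k + 1 : ℕ) * h, (β (k * h) - c) ≤ ∫ t in k * h..(k + 1 : ℕ) * h, β t :=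
    by
    refine intervalIntegral.integral_mono_on (by push_cast; linarith)
      intervalIntegrable_const (hβ.intervalIntegrable _ _) fun t ht => ?_
    push_cast at ht
    have := hc (k * h) ⟨hk0, by linarith⟩ t ⟨hk0.trans ht.1, ht.2.trans hkn⟩
      (abs_le.2 ⟨by linarith [ht.2], by linarith [ht.1]⟩)
    linarith
  rw [intervalIntegral.integral_const, smul_eq_mul] at h1
  push_cast at h1 ⊢
  linarith

/-- The Lipschitz constant must not depend on `K`, which is not controlled under mollification. On a
fine grid the sum of the rates exceeds `A` by at most 1 and the `K ^ 2` terms add at most 1, whence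
`A + 2`. -/
theorem exists_approximate_flow {T : ℝ} (hT : 0 < T) {b : ℝ × Space N → Space N} {K : ℝ≥0}
    {M A : ℝ} {β : ℝ → ℝ} (hK : LipschitzWith K b) (hb : Differentiable ℝ b) (hM : ∀ z, ‖b z‖ ≤ M)
    (hβ0 : ∀ t, 0 ≤ β t) (hβc : Continuous β)
    (hβ : ∀ t x y, inner ℝ (b (t, x) - b (t, y)) (x - y) ≤ β t * ‖x - y‖ ^ 2)
    (hA : ∫ t in 0..T, β t ≤ A) {ε : ℝ} (hε : 0 < ε) :
    ∃ X : ℝ × Space N → Space N, LipschitzWith (Real.exp (A + 2) * (1 + M)).toNNReal X ∧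
      (∀ x, X (T, x) = x) ∧ (∀ t x, 0 ≤ spaceJac X t x) ∧
      ∀ᵐ z ∂volume.restrict (openSlab N T), ‖transportOp b X z‖ ≤ ε := by
  have hM0 : 0 ≤ M := (norm_nonneg _).trans (hM 0)
  set L := (Real.exp (A + 2) * (1 + M)).toNNReal
  -- An oscillation below `1 / T` on each cell makes the Riemann sum exceed the integral over
  -- `[0,T]` by at most 1.
  obtain ⟨δ, hδ0, hδ⟩ := Metric.uniformContinuousOn_iff.1
    ((isCompact_Icc (a := 0) (b := T)).uniformContinuousOn_of_continuous hβc.continuousOn) (1 / T)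
    (by positivity)
  have hlim : Filter.Tendsto (fun n : ℕ => T / n) Filter.atTop (𝓝 0) :=
    tendsto_const_div_atTop_nhds_zero_nat T
  have hsmall : ∀ c C : ℝ, 0 < C → ∀ᶠ n : ℕ in Filter.atTop, T / n * c < C := fun c C hC => by
    have := hlim.mul_const c
    rw [zero_mul] at this
    exact this.eventually_lt_const hC
  -- The four smallness conditions serve, in order, the Riemann sum, the `K ^ 2` terms, the sign of
  -- the Jacobian and the residual of the equation.
  obtain ⟨n, hn0, hn1, hn2, hn3, hn4⟩ := ((Filter.eventually_gt_atTop 0).and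
    ((hsmall 1 δ hδ0).and ((hsmall (T * K ^ 2) 2 two_pos).and ((hsmall K 1 one_pos).and
    (hsmall (L * K * (M + 1)) ε hε))))).exists
  have hn0' : (0 : ℝ) < n := by exact_mod_cast hn0
  set h := T / n
  have hh : 0 < h := by positivity
  have hnh : n * h = T := by simp only [h]; field_simp
  have hsum : ∑ k ∈ Finset.range n, (h * β (k * h) + h ^ 2 * K ^ 2 / 2) ≤ A + 2 := by
    rw [Finset.sum_add_distrib]
    have h1 : ∑ k ∈ Finset.range n, h * β (k * h) ≤ A + 1 := by
      refine (sum_mul_le_integral_add hβc (c := 1 / T) hh.le fun s hs t ht hst => ?_).trans ?_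
      · rw [hnh] at hs ht
        have := (abs_lt.1 (hδ s hs t ht (by rw [Real.dist_eq]; linarith))).2
        linarith
      · rw [hnh, mul_one_div_cancel hT.ne']
        linarith
    have h2 : ∑ k ∈ Finset.range n, h ^ 2 * (K : ℝ) ^ 2 / 2 ≤ 1 := by
      rw [Finset.sum_const, Finset.card_range, nsmul_eq_mul]
      have : n * (h ^ 2 * (K : ℝ) ^ 2 / 2) = h * ((n * h) * K ^ 2) / 2 := by ring
      rw [this, hnh]
      linarith
    linarith
  have hL : LipschitzWith L (eulerScheme b h n) := lipschitzWith_eulerScheme hK hM hβ0 hβ hh.le hsum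
  refine ⟨eulerScheme b h n, hL, fun x => eulerScheme_eq_snd b hh.le x hnh.le,
    fun t => (spaceJac_eulerScheme_nonneg hK hb hh.le hn3 n t).2, ?_⟩
  have hgrid : ∀ᵐ z : ℝ × Space N, z.1 ∉ range fun k : ℕ => k * h :=
    Measure.quasiMeasurePreserving_fst.ae
      (measure_eq_zero_iff_ae_notMem.1 ((countable_range _).measure_zero volume))
  filter_upwards [ae_restrict_of_ae hgrid, ae_restrict_mem measurableSet_openSlab] with z hz hzs
  have hz0 : 0 < z.1 := (mem_openSlab.1 hzs).1
  have hzT : z.1 < T := (mem_openSlab.1 hzs).2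
  have hj1 : (⌊z.1 / h⌋₊ : ℝ) * h ≤ z.1 :=
    (le_div_iff₀ hh).1 (Nat.floor_le (by positivity))
  have hj2 : z.1 < (⌊z.1 / h⌋₊ + 1) * h := (div_lt_iff₀ hh).1 (Nat.lt_floor_add_one _)
  have hjn : ⌊z.1 / h⌋₊ < n := by
    have : (⌊z.1 / h⌋₊ : ℝ) * h < n * h := by linarith
    exact_mod_cast lt_of_mul_lt_mul_right this hh.le
  have := norm_transportOp_eulerScheme_le hK hM hh.le hjn hL
    (lt_of_le_of_ne hj1 fun hj => hz ⟨_, hj⟩) hj2 z.2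
  refine this.trans ?_
  linarith [show h * (L * K * (M + 1)) = L * K * h * (M + 1) by ring]

end Euler

/-! ### Mollified fields keep the one-sided Lipschitz condition -/

section MollifiedField

open scoped Convolution

variable {N : ℕ} {T : ℝ}

lemma locallyIntegrable_of_ae_norm_le {V F : Type*} [TopologicalSpace V] [MeasurableSpace V]
    {μ : Measure V} [IsLocallyFiniteMeasure μ] [NormedAddCommGroup F] {g : V → F} {C : ℝ}
    (hg : AEStronglyMeasurable g μ) (hC : ∀ᵐ x ∂μ, ‖g x‖ ≤ C) : LocallyIntegrable g μ :=
  (locallyIntegrable_const C).mono hg (hC.mono fun _ hx => hx.trans (le_abs_self C))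

/-- Here `g` is merely bounded, so the derivative falls on the bump, and the Lipschitz constant
depends on that bump. -/
lemma exists_lipschitzWith_bump_convolution {V F : Type*} [NormedAddCommGroup V]
    [NormedSpace ℝ V] [FiniteDimensional ℝ V] [MeasurableSpace V] [BorelSpace V] {μ : Measure V}
    [μ.IsAddHaarMeasure] [NormedAddCommGroup F] [NormedSpace ℝ F] [CompleteSpace F]
    (ρ : ContDiffBump (0 : V)) {g : V → F} {C : ℝ} (hg : AEStronglyMeasurable g μ)
    (hC : ∀ᵐ x ∂μ, ‖g x‖ ≤ C) :
    Differentiable ℝ (ρ.normed μ ⋆[ContinuousLinearMap.lsmul ℝ ℝ, μ] g) ∧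
      ∃ K, LipschitzWith K (ρ.normed μ ⋆[ContinuousLinearMap.lsmul ℝ ℝ, μ] g) := by
  have hd := ρ.hasCompactSupport_normed.hasFDerivAt_convolution_left (μ := μ)
    (ContinuousLinearMap.lsmul ℝ ℝ) (ρ.contDiff_normed (μ := μ) (n := 1))
    (locallyIntegrable_of_ae_norm_le hg hC)
  refine ⟨fun x => (hd x).differentiableAt, ?_⟩
  set C' := ∫ y, ‖fderiv ℝ (ρ.normed μ) y‖ * C ∂μ
  have hcont : Continuous (fderiv ℝ (ρ.normed μ)) :=
    (ρ.contDiff_normed (n := 1)).continuous_fderiv one_ne_zero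
  have hint : Integrable (fderiv ℝ (ρ.normed μ)) μ :=
    hcont.integrable_of_hasCompactSupport (ρ.hasCompactSupport_normed.fderiv ℝ)
  have hle : ∀ x, ‖(fderiv ℝ (ρ.normed μ) ⋆[(ContinuousLinearMap.lsmul ℝ ℝ).precompL V, μ] g) x‖ ≤
      C' := fun x => by
    have hshift : ∀ᵐ y ∂μ, ‖g (x - y)‖ ≤ C :=
      (Measure.measurePreserving_sub_left μ x).quasiMeasurePreserving.ae hC
    refine norm_integral_le_of_norm_le (hint.norm.mul_const _) ?_
    filter_upwards [hshift] with y hy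
    refine ContinuousLinearMap.opNorm_le_bound _
      (mul_nonneg (norm_nonneg _) ((norm_nonneg _).trans hy)) fun v => ?_
    rw [ContinuousLinearMap.precompL_apply, ContinuousLinearMap.lsmul_apply, norm_smul,
      mul_right_comm]
    gcongr
    exact ContinuousLinearMap.le_opNorm _ _
  refine ⟨C'.toNNReal, lipschitzWith_of_nnnorm_fderiv_le (fun x => (hd x).differentiableAt)
    fun x => ?_⟩
  rw [(hd x).fderiv, ← NNReal.coe_le_coe, coe_nnnorm]
  exact (hle x).trans (Real.le_coe_toNNReal _)

/-- Extending both the field and a nonnegative measurable rate by 0 keeps the inequality outside the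
slab, so that convolution over all of space-time makes sense. -/
lemma OSLC.exists_measurable {a : ℝ × Space N → Space N} (h : OSLC T a) :
    ∃ γ : ℝ → ℝ, Measurable γ ∧ Integrable γ ∧ (∀ t, 0 ≤ γ t) ∧
      ∀ᵐ w : ℝ × Space N × Space N, inner ℝ ((openSlab N T).indicator a (w.1, w.2.2) -
        (openSlab N T).indicator a (w.1, w.2.1)) (w.2.2 - w.2.1) ≤
          γ w.1 * ‖w.2.2 - w.2.1‖ ^ 2 := by
  obtain ⟨α, hα, hα0, hi⟩ := h
  have hm : Measurable fun t => max (hα.1.mk α t) 0 :=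
    hα.1.stronglyMeasurable_mk.measurable.max measurable_const
  refine ⟨(Ioo 0 T).indicator fun t => max (hα.1.mk α t) 0, hm.indicator measurableSet_Ioo, ?_,
    fun t => indicator_nonneg (fun t _ => le_max_right _ _) t, ?_⟩
  · rw [integrable_indicator_iff measurableSet_Ioo]
    exact (hα.congr hα.1.ae_eq_mk).pos_part
  · have hmk : ∀ᵐ t : ℝ, t ∈ Ioo 0 T → α t = hα.1.mk α t :=
      (ae_restrict_iff' measurableSet_Ioo).1 hα.1.ae_eq_mk
    have hmk' : ∀ᵐ w : ℝ × Space N × Space N, w.1 ∈ Ioo 0 T → α w.1 = hα.1.mk α w.1 :=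
      Measure.quasiMeasurePreserving_fst.ae hmk
    have hi' := (ae_restrict_iff' (measurableSet_Ioo.prod
      (MeasurableSet.univ.prod MeasurableSet.univ))).1 hi
    filter_upwards [hmk', hi'] with w hw hw'
    by_cases ht : w.1 ∈ Ioo 0 T
    · rw [indicator_of_mem (mem_openSlab.2 ht), indicator_of_mem (mem_openSlab.2 ht),
        indicator_of_mem ht, ← hw ht]
      refine (hw' ⟨ht, mem_univ _, mem_univ _⟩).trans ?_
      gcongr
      exact le_max_left _ _
    · rw [indicator_of_notMem fun h => ht (mem_openSlab.1 h),
        indicator_of_notMem fun h => ht (mem_openSlab.1 h), indicator_of_notMem ht]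
      simp

/-- Mollification averages the condition over common translations of both space points, with `t`
fixed. The shift in time makes this meaningful for every `t`; the two a.e. quantifiers are then
exchanged on a measurable set. -/
lemma ae_ae_sub_of_ae {P : ℝ × Space N × Space N → Prop} (hP : ∀ᵐ w, P w) (t : ℝ) :
    ∀ᵐ p : Space N × Space N, ∀ᵐ w : ℝ × Space N, P (t - w.1, p.1 - w.2, p.2 - w.2) := by
  set E := (toMeasurable volume {w | ¬ P w})ᶜ
  have hE : MeasurableSet E := (measurableSet_toMeasurable _ _).compl
  have hEP : ∀ w ∈ E, P w := fun w hw => by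
    by_contra hc
    exact hw (subset_toMeasurable _ _ hc)
  have hEae : ∀ᵐ w : ℝ × Space N × Space N, w ∈ E := by
    have : {w | w ∉ E} = toMeasurable volume {w | ¬ P w} := by ext; simp [E]
    rw [ae_iff, this, measure_toMeasurable]
    exact ae_iff.1 hP
  have hsec : ∀ᵐ τ : ℝ, ∀ᵐ p : Space N × Space N, (τ, p) ∈ E := Measure.ae_ae_of_ae_prod hEae
  have : (volume : Measure (Space N × Space N)).IsAddHaarMeasure :=
    Measure.prod.instIsAddHaarMeasure volume volume
  have h1 : ∀ᵐ w : ℝ × Space N, ∀ᵐ p : Space N × Space N, (t - w.1, p.1 - w.2, p.2 - w.2) ∈ E := by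
    have h2 : ∀ᵐ τ : ℝ, ∀ᵐ p : Space N × Space N, (t - τ, p) ∈ E :=
      (Measure.measurePreserving_sub_left volume t).quasiMeasurePreserving.ae hsec
    filter_upwards [Measure.quasiMeasurePreserving_fst.ae h2] with w hw
    exact (measurePreserving_sub_right (volume : Measure (Space N × Space N))
      (w.2, w.2)).quasiMeasurePreserving.ae hw
  have hm : MeasurableSet {q : (ℝ × Space N) × (Space N × Space N) |
      (t - q.1.1, q.2.1 - q.1.2, q.2.2 - q.1.2) ∈ E} := by
    have : Measurable fun q : (ℝ × Space N) × (Space N × Space N) =>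
      (t - q.1.1, q.2.1 - q.1.2, q.2.2 - q.1.2) := by fun_prop
    exact this hE
  filter_upwards [(Measure.ae_ae_comm hm).1 h1] with p hp
  exact hp.mono fun w hw => hEP _ hw

lemma locallyIntegrable_comp_fst {γ : ℝ → ℝ} (hγ : Integrable γ) :
    LocallyIntegrable fun z : ℝ × Space N => γ z.1 := by
  refine (locallyIntegrable_iff).2 fun K hK => ?_
  have : IsFiniteMeasure (volume.restrict (Prod.snd '' K)) :=
    ⟨by simpa using (hK.image continuous_snd).measure_lt_top⟩
  have h : IntegrableOn (fun z : ℝ × Space N => γ z.1) (univ ×ˢ (Prod.snd '' K)) := by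
    rw [IntegrableOn, Measure.volume_eq_prod, ← Measure.prod_restrict, Measure.restrict_univ]
    exact hγ.comp_fst _
  exact h.mono_set fun z hz => ⟨mem_univ _, z, hz, rfl⟩

/-- The mean of `γ(t - ·)` against a space-time mollifier. -/
def mollifiedRate (ρ : ContDiffBump (0 : ℝ × Space N)) (γ : ℝ → ℝ) (t : ℝ) : ℝ :=
  ∫ w, ρ.normed volume w * γ (t - w.1)

variable {ρ : ContDiffBump (0 : ℝ × Space N)} {γ : ℝ → ℝ}

lemma mollifiedRate_nonneg (hγ0 : ∀ t, 0 ≤ γ t) (t : ℝ) : 0 ≤ mollifiedRate ρ γ t :=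
  integral_nonneg fun w => mul_nonneg (ρ.nonneg_normed w) (hγ0 _)

lemma continuous_mollifiedRate (hγ : Integrable γ) : Continuous (mollifiedRate ρ γ) := by
  have h := (ρ.hasCompactSupport_normed (μ := volume)).continuous_convolution_left (μ := volume)
    (ContinuousLinearMap.lsmul ℝ ℝ) ρ.continuous_normed (locallyIntegrable_comp_fst (N := N) hγ)
  exact h.comp (Continuous.prodMk_left (0 : Space N))

lemma integrable_mollifiedRate (hγ : Integrable γ) (t : ℝ) :
    Integrable fun w => ρ.normed volume w * γ (t - w.1) :=
  ρ.hasCompactSupport_normed.convolutionExists_left (ContinuousLinearMap.lsmul ℝ ℝ)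
    ρ.continuous_normed (locallyIntegrable_comp_fst (N := N) hγ) (t, 0)

/-- Tonelli, translation invariance and the unit mass of the mollifier. Enlarging `[0,T]` to the
whole line costs only an inequality because the rate is nonnegative. -/
lemma integral_mollifiedRate_le (hT : 0 ≤ T) (hm : Measurable γ) (hγ : Integrable γ)
    (hγ0 : ∀ t, 0 ≤ γ t) : ∫ t in 0..T, mollifiedRate ρ γ t ≤ ∫ t, γ t := by
  have hρm : Measurable (ρ.normed volume) := ρ.continuous_normed.measurable
  rw [intervalIntegral.integral_of_le hT]
  refine (ENNReal.ofReal_le_ofReal_iff (integral_nonneg hγ0)).1 ?_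
  rw [ofReal_integral_eq_lintegral_ofReal hγ (Filter.Eventually.of_forall hγ0),
    ofReal_integral_eq_lintegral_ofReal
      ((continuous_mollifiedRate hγ).integrableOn_Icc.mono_set Ioc_subset_Icc_self)
      (Filter.Eventually.of_forall (mollifiedRate_nonneg hγ0))]
  calc ∫⁻ t in Ioc 0 T, ENNReal.ofReal (mollifiedRate ρ γ t)
      ≤ ∫⁻ t, ENNReal.ofReal (mollifiedRate ρ γ t) := setLIntegral_le_lintegral _ _
    _ = ∫⁻ t, ∫⁻ w, ENNReal.ofReal (ρ.normed volume w) * ENNReal.ofReal (γ (t - w.1)) := by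
        refine lintegral_congr fun t => ?_
        rw [mollifiedRate, ofReal_integral_eq_lintegral_ofReal (integrable_mollifiedRate hγ t)
          (Filter.Eventually.of_forall fun w => mul_nonneg (ρ.nonneg_normed w) (hγ0 _))]
        exact lintegral_congr fun w => ENNReal.ofReal_mul (ρ.nonneg_normed w)
    _ = ∫⁻ w, ENNReal.ofReal (ρ.normed volume w) * ∫⁻ t, ENNReal.ofReal (γ t) := by
        rw [lintegral_lintegral_swap]
        · refine lintegral_congr fun w => ?_
          rw [lintegral_const_mul _ (by fun_prop),
            lintegral_sub_right_eq_self (fun t => ENNReal.ofReal (γ t))]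
        · exact Measurable.aemeasurable (by fun_prop)
    _ = ∫⁻ t, ENNReal.ofReal (γ t) := by
        rw [lintegral_mul_const _ (by fun_prop), ← ofReal_integral_eq_lintegral_ofReal
          ρ.integrable_normed (Filter.Eventually.of_forall ρ.nonneg_normed), ρ.integral_normed,
          ENNReal.ofReal_one, one_mul]

/-- The condition is linear in the field for fixed points, so averaging preserves it for almost
every pair `(x, y)`; continuity of the mollified field extends it to all pairs. -/
lemma inner_bump_convolution_sub_le {g : ℝ × Space N → Space N} {M : ℝ}
    (hg : AEStronglyMeasurable g) (hM : ∀ᵐ z, ‖g z‖ ≤ M) (hγ : Integrable γ)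
    (h : ∀ᵐ w : ℝ × Space N × Space N,
      inner ℝ (g (w.1, w.2.2) - g (w.1, w.2.1)) (w.2.2 - w.2.1) ≤ γ w.1 * ‖w.2.2 - w.2.1‖ ^ 2)
    (t : ℝ) (x y : Space N) :
    inner ℝ ((ρ.normed volume ⋆[ContinuousLinearMap.lsmul ℝ ℝ, volume] g) (t, x) -
      (ρ.normed volume ⋆[ContinuousLinearMap.lsmul ℝ ℝ, volume] g) (t, y)) (x - y) ≤
        mollifiedRate ρ γ t * ‖x - y‖ ^ 2 := by
  set b := ρ.normed volume ⋆[ContinuousLinearMap.lsmul ℝ ℝ, volume] g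
  have hbc : Continuous b := (exists_lipschitzWith_bump_convolution ρ hg hM).1.continuous
  have hi : ∀ z, Integrable fun w => ρ.normed volume w • g (z - w) := fun z =>
    ρ.hasCompactSupport_normed.convolutionExists_left (ContinuousLinearMap.lsmul ℝ ℝ)
      ρ.continuous_normed (locallyIntegrable_of_ae_norm_le hg hM) z
  set S : Set (Space N × Space N) := {p | inner ℝ (b (t, p.2) - b (t, p.1)) (p.2 - p.1) ≤
    mollifiedRate ρ γ t * ‖p.2 - p.1‖ ^ 2}
  have hS : IsClosed S := isClosed_le (by fun_prop) (by fun_prop)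
  have hae : ∀ᵐ p, p ∈ S := by
    filter_upwards [ae_ae_sub_of_ae h t] with p hp
    have e : b (t, p.2) - b (t, p.1) =
        ∫ w, (ρ.normed volume w • g ((t, p.2) - w) - ρ.normed volume w • g ((t, p.1) - w)) :=
      (integral_sub (hi _) (hi _)).symm
    show inner ℝ _ _ ≤ _
    rw [real_inner_comm, e, ← integral_inner (f := fun w => ρ.normed volume w • g ((t, p.2) - w) -
      ρ.normed volume w • g ((t, p.1) - w)) ((hi _).sub (hi _)), mollifiedRate,
      ← integral_mul_const]
    refine integral_mono_ae (((hi _).sub (hi _)).const_inner _)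
      ((integrable_mollifiedRate hγ t).mul_const _) ?_
    filter_upwards [hp] with w hw
    simp only [sub_sub_sub_cancel_right] at hw
    simp only [← smul_sub, inner_smul_right, mul_assoc]
    refine mul_le_mul_of_nonneg_left ?_ (ρ.nonneg_normed w)
    rw [real_inner_comm]
    exact hw
  have : S = univ := hS.closure_eq ▸ (Measure.dense_of_ae hae).closure_eq
  exact (this.symm ▸ mem_univ (y, x) : (y, x) ∈ S)

/-- A field satisfying the one-sided Lipschitz condition is a limit of smooth fields that satisfy
it uniformly. -/
theorem OSLC.exists_smooth_fields {a : ℝ × Space N → Space N} (hT : 0 ≤ T)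
    (ha : MemLp a ⊤ (volume.restrict (openSlab N T))) (h : OSLC T a) :
    ∃ (M A : ℝ) (b : ℕ → ℝ × Space N → Space N), (∀ n, Differentiable ℝ (b n)) ∧
      (∀ n, ∃ K, LipschitzWith K (b n)) ∧ (∀ n z, ‖b n z‖ ≤ M) ∧
      (∀ n, ∃ β : ℝ → ℝ, Continuous β ∧ (∀ t, 0 ≤ β t) ∧ (∫ t in 0..T, β t ≤ A) ∧
        ∀ t x y, inner ℝ (b n (t, x) - b n (t, y)) (x - y) ≤ β t * ‖x - y‖ ^ 2) ∧
      ∀ᵐ z ∂volume.restrict (openSlab N T),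
        Filter.Tendsto (fun n => b n z) Filter.atTop (𝓝 (a z)) := by
  obtain ⟨M, hM0, hM⟩ := exists_ae_norm_le ha
  obtain ⟨γ, hm, hγ, hγ0, hi⟩ := h.exists_measurable
  set g := (openSlab N T).indicator a
  have hg : AEStronglyMeasurable g :=
    (aestronglyMeasurable_indicator_iff measurableSet_openSlab).2 ha.1
  have hgM : ∀ᵐ z, ‖g z‖ ≤ M := by
    filter_upwards [(ae_restrict_iff' measurableSet_openSlab).1 hM] with z hz
    by_cases hzs : z ∈ openSlab N T
    · rw [show g z = a z from indicator_of_mem hzs a]; exact hz hzs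
    · rw [show g z = 0 from indicator_of_notMem hzs a, norm_zero]; exact hM0
  set ρ : ℕ → ContDiffBump (0 : ℝ × Space N) := shrinkingBump (ℝ × Space N)
  refine ⟨M, ∫ t, γ t,
    fun n => (ρ n).normed volume ⋆[ContinuousLinearMap.lsmul ℝ ℝ, volume] g,
    fun n => (exists_lipschitzWith_bump_convolution _ hg hgM).1,
    fun n => (exists_lipschitzWith_bump_convolution _ hg hgM).2,
    fun n z => norm_bump_convolution_le _ hgM z,
    fun n => ⟨mollifiedRate (ρ n) γ, continuous_mollifiedRate hγ, mollifiedRate_nonneg hγ0,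
      integral_mollifiedRate_le hT hm hγ hγ0, inner_bump_convolution_sub_le hg hgM hγ hi⟩, ?_⟩
  filter_upwards [ae_restrict_of_ae (ae_tendsto_shrinkingBump_convolution
    (locallyIntegrable_of_ae_norm_le hg hgM)), ae_restrict_mem measurableSet_openSlab] with z hz hzs
  rwa [show g z = a z from indicator_of_mem hzs a] at hz

end MollifiedField

/-! ### Compactness of equi-Lipschitz maps and weak convergence of derivatives -/

section Compactness

open scoped Convolution

variable {V F : Type*} [NormedAddCommGroup V] [NormedSpace ℝ V] [FiniteDimensional ℝ V]
  [NormedAddCommGroup F] [NormedSpace ℝ F] [FiniteDimensional ℝ F]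

/-- Arzelà–Ascoli by an ultrafilter: pointwise limits along it exist by boundedness and inherit the
Lipschitz constant, and a finite net makes the convergence uniform on each ball for suitable
indices. -/
theorem exists_subseq_lipschitzWith {L : ℝ≥0} {X : ℕ → V → F} (hX : ∀ n, LipschitzWith L (X n))
    (hb : ∀ z, ∃ C, ∀ n, ‖X n z‖ ≤ C) : ∃ (Y : V → F) (φ : ℕ → ℕ), LipschitzWith L Y ∧
      (∀ m, m ≤ φ m) ∧ ∀ m : ℕ, ∀ z ∈ Metric.closedBall (0 : V) m,
        ‖X (φ m) z - Y z‖ ≤ 1 / ((m : ℝ) + 1) := by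
  have : ProperSpace V := FiniteDimensional.proper ℝ V
  have : ProperSpace F := FiniteDimensional.proper ℝ F
  have hlim : ∀ z, ∃ y, Filter.Tendsto (fun n => X n z) (Filter.hyperfilter ℕ) (𝓝 y) := fun z => by
    obtain ⟨C, hC⟩ := hb z
    obtain ⟨y, -, hy⟩ := (isCompact_closedBall (0 : F) C).ultrafilter_le_nhds
      ((Filter.hyperfilter ℕ).map fun n => X n z) (by
        rw [Filter.le_principal_iff]
        exact Ultrafilter.mem_map.2 (Filter.univ_mem' fun n => mem_closedBall_zero_iff.2 (hC n)))
    exact ⟨y, hy⟩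
  choose Y hY using hlim
  have hYL : LipschitzWith L Y := LipschitzWith.of_dist_le_mul fun z w =>
    le_of_tendsto ((hY z).dist (hY w)) (Filter.Eventually.of_forall fun n => (hX n).dist_le_mul z w)
  have key : ∀ m : ℕ, ∃ n, m ≤ n ∧ ∀ z ∈ Metric.closedBall (0 : V) m,
      ‖X n z - Y z‖ ≤ 1 / ((m : ℝ) + 1) := fun m => by
    set ε : ℝ := 1 / ((m : ℝ) + 1)
    have hε : 0 < ε := by positivity
    set δ : ℝ := ε / (3 * (L + 1))
    have hδ : 0 < δ := by positivity
    have hLδ : L * δ ≤ ε / 3 := by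
      rw [mul_div_assoc', div_le_div_iff₀ (by positivity) (by positivity)]
      nlinarith [L.coe_nonneg]
    obtain ⟨t, -, htf, ht⟩ := (isCompact_closedBall (0 : V) m).finite_cover_balls hδ
    have hev : ∀ᶠ n in Filter.hyperfilter ℕ, ∀ c ∈ t, dist (X n c) (Y c) < ε / 3 :=
      (Filter.eventually_all_finite htf).2 fun c _ =>
        (hY c).eventually (Metric.ball_mem_nhds _ (by positivity))
    obtain ⟨n, hn, hmn⟩ := (hev.and
      ((Filter.eventually_ge_atTop m).filter_mono Nat.hyperfilter_le_atTop)).exists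
    refine ⟨n, hmn, fun z hz => ?_⟩
    obtain ⟨c, hc, hzc⟩ := mem_iUnion₂.1 (ht hz)
    have hzc' : L * dist z c ≤ ε / 3 := (mul_le_mul_of_nonneg_left (le_of_lt hzc) L.2).trans hLδ
    have h1 := ((hX n).dist_le_mul z c).trans hzc'
    have h2 := (hYL.dist_le_mul z c).trans hzc'
    rw [dist_comm] at h2
    rw [← dist_eq_norm]
    linarith [dist_triangle4 (X n z) (X n c) (Y c) (Y z), hn c hc]
  choose φ hφ using key
  exact ⟨Y, φ, hYL, fun m => (hφ m).1, fun m => (hφ m).2⟩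

variable [MeasurableSpace V] [BorelSpace V] {μ : Measure V} [μ.IsAddHaarMeasure]

lemma integral_mul_fderiv_eq_neg {C D : ℝ≥0} {u ψ : V → ℝ} (hu : LipschitzWith C u)
    (hψ : LipschitzWith D ψ) (hc : HasCompactSupport ψ) (v : V) :
    ∫ x, ψ x * fderiv ℝ u x v ∂μ = -∫ x, fderiv ℝ ψ x v * u x ∂μ := by
  have h := LipschitzWith.integral_lineDeriv_mul_eq (μ := μ) hu hψ hc v
  rw [← integral_neg]
  refine Eq.trans ?_ (h.trans ?_)
  · refine integral_congr_ae ?_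
    filter_upwards [hu.ae_differentiableAt (μ := μ)] with x hx
    rw [hx.lineDeriv_eq_fderiv, mul_comm]
  · refine integral_congr_ae ?_
    filter_upwards [hψ.ae_differentiableAt (μ := μ)] with x hx
    rw [hx.lineDeriv_eq_fderiv, map_neg, neg_mul]

lemma integrable_mul_fderiv {L : ℝ≥0} {u : V → ℝ} (hu : LipschitzWith L u) {ψ : V → ℝ}
    (hψ : Integrable ψ μ) (v : V) : Integrable (fun x => ψ x * fderiv ℝ u x v) μ := by
  refine hψ.mul_bdd (c := L * ‖v‖) (measurable_fderiv_apply_const ℝ u v).aestronglyMeasurable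
    (Filter.Eventually.of_forall fun x => (ContinuousLinearMap.le_opNorm _ _).trans ?_)
  gcongr
  exact norm_fderiv_le_of_lipschitz ℝ hu

lemma abs_integral_mul_fderiv_sub_le {L : ℝ≥0} {u : V → ℝ} (hu : LipschitzWith L u) {ψ ψ' : V → ℝ}
    (hψ : Integrable ψ μ) (hψ' : Integrable ψ' μ) (v : V) :
    |(∫ x, ψ x * fderiv ℝ u x v ∂μ) - ∫ x, ψ' x * fderiv ℝ u x v ∂μ| ≤
      (∫ x, |ψ x - ψ' x| ∂μ) * (L * ‖v‖) := by
  rw [← integral_sub (integrable_mul_fderiv hu hψ v) (integrable_mul_fderiv hu hψ' v),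
    ← integral_mul_const, ← Real.norm_eq_abs]
  refine norm_integral_le_of_norm_le ((hψ.sub hψ').abs.mul_const _)
    (Filter.Eventually.of_forall fun x => ?_)
  rw [← sub_mul, norm_mul, Real.norm_eq_abs]
  gcongr
  refine (ContinuousLinearMap.le_opNorm _ _).trans ?_
  gcongr
  exact norm_fderiv_le_of_lipschitz ℝ hu

/-- For smooth `ψ'` near `ψ` in L¹ the derivative is moved onto `ψ'` and uniform convergence
suffices; the L¹ error is controlled by the common Lipschitz constant. -/
theorem tendsto_integral_mul_fderiv {L : ℝ≥0} {u : ℕ → V → ℝ} {w : V → ℝ}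
    (hu : ∀ m, LipschitzWith L (u m)) (hw : LipschitzWith L w)
    (huw : ∀ m : ℕ, ∀ z ∈ Metric.closedBall (0 : V) m, |u m z - w z| ≤ 1 / ((m : ℝ) + 1))
    {ψ : V → ℝ} (hψ : Integrable ψ μ) (hc : HasCompactSupport ψ) (v : V) :
    Filter.Tendsto (fun m => ∫ x, ψ x * fderiv ℝ (u m) x v ∂μ) Filter.atTop
      (𝓝 (∫ x, ψ x * fderiv ℝ w x v ∂μ)) := by
  obtain ⟨R, hR, happ⟩ := exists_smooth_integral_sub_le hψ hc
  rw [Metric.tendsto_atTop']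
  intro ε hε
  set η := ε / (4 * (L * ‖v‖ + 1))
  have hη : 0 < η := by positivity
  have hηL : η * (L * ‖v‖) ≤ ε / 4 := by
    rw [div_mul_eq_mul_div, div_le_div_iff₀ (by positivity) (by positivity)]
    nlinarith [mul_nonneg L.coe_nonneg (norm_nonneg v)]
  obtain ⟨ψ', hψ's, hψ'c, hψ'R, hle⟩ := happ η hη
  have hψ'i : Integrable ψ' μ := hψ's.continuous.integrable_of_hasCompactSupport hψ'c
  obtain ⟨D, hD⟩ := exists_lipschitzWith_of_hasCompactSupport
    ((hψ's.of_le (by simp)).locallyLipschitz (𝕂 := ℝ)) hψ'c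
  have hdc : HasCompactSupport fun x => fderiv ℝ ψ' x v :=
    (hψ'c.fderiv ℝ).comp_left (g := fun A : V →L[ℝ] ℝ => A v) rfl
  have hdcont : Continuous fun x => fderiv ℝ ψ' x v :=
    (hψ's.continuous_fderiv (by simp)).clm_apply continuous_const
  set S := ∫ x, |fderiv ℝ ψ' x v| ∂μ
  have hlim : Filter.Tendsto (fun m : ℕ => S * (1 / ((m : ℝ) + 1))) Filter.atTop (𝓝 0) := by
    simpa using tendsto_one_div_add_atTop_nhds_zero_nat.const_mul S
  obtain ⟨m₀, hm₀⟩ := ((hlim.eventually_lt_const (show 0 < ε / 4 by positivity)).and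
    ((tendsto_natCast_atTop_atTop (R := ℝ)).eventually_ge_atTop R)).exists_forall_of_atTop
  refine ⟨m₀, fun m hm => ?_⟩
  obtain ⟨hm1, hm2⟩ := hm₀ m hm.le
  have hint : ∀ {f : V → ℝ}, Continuous f → Integrable (fun x => fderiv ℝ ψ' x v * f x) μ :=
    fun hf => (hdcont.mul hf).integrable_of_hasCompactSupport hdc.mul_right
  have h1 := (abs_integral_mul_fderiv_sub_le (hu m) hψ hψ'i v).trans
    ((mul_le_mul_of_nonneg_right hle (by positivity)).trans hηL)
  have h2 := (abs_integral_mul_fderiv_sub_le hw hψ hψ'i v).trans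
    ((mul_le_mul_of_nonneg_right hle (by positivity)).trans hηL)
  have h3 : |(∫ x, ψ' x * fderiv ℝ (u m) x v ∂μ) - ∫ x, ψ' x * fderiv ℝ w x v ∂μ| ≤
      S * (1 / ((m : ℝ) + 1)) := by
    rw [integral_mul_fderiv_eq_neg (hu m) hD hψ'c, integral_mul_fderiv_eq_neg hw hD hψ'c,
      neg_sub_neg, ← integral_sub (hint hw.continuous) (hint (hu m).continuous),
      ← integral_mul_const, ← Real.norm_eq_abs]
    refine norm_integral_le_of_norm_le
      ((hdcont.integrable_of_hasCompactSupport hdc).abs.mul_const _)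
      (Filter.Eventually.of_forall fun x => ?_)
    rw [← mul_sub, norm_mul, Real.norm_eq_abs, Real.norm_eq_abs, abs_sub_comm]
    by_cases hx : x ∈ tsupport ψ'
    · gcongr
      exact huw m x (Metric.closedBall_subset_closedBall hm2
        (Metric.ball_subset_closedBall (hψ'R hx)))
    · simp [fderiv_eq_zero_of_notMem_tsupport hx]
  rw [Real.dist_eq]
  rw [abs_le] at h1 h2 h3
  rw [abs_lt]
  constructor <;> linarith [h1.1, h1.2, h2.1, h2.2, h3.1, h3.2]

theorem tendsto_integral_fderiv_apply {L : ℝ≥0} {u : ℕ → V → ℝ} {w : V → ℝ}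
    (hu : ∀ m, LipschitzWith L (u m)) (hw : LipschitzWith L w)
    (huw : ∀ m : ℕ, ∀ z ∈ Metric.closedBall (0 : V) m, |u m z - w z| ≤ 1 / ((m : ℝ) + 1))
    {c : V → V} (hci : Integrable c μ) (hc : HasCompactSupport c) :
    Filter.Tendsto (fun m => ∫ x, fderiv ℝ (u m) x (c x) ∂μ) Filter.atTop
      (𝓝 (∫ x, fderiv ℝ w x (c x) ∂μ)) := by
  let b := Module.finBasis ℝ V
  have hbi : ∀ j, Integrable (fun x => b.coord j (c x)) μ := fun j =>
    (LinearMap.toContinuousLinearMap (b.coord j)).integrable_comp hci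
  have hbc : ∀ j, HasCompactSupport fun x => b.coord j (c x) := fun j =>
    hc.comp_left (g := b.coord j) (map_zero _)
  have e : ∀ {f : V → ℝ}, LipschitzWith L f → ∫ x, fderiv ℝ f x (c x) ∂μ =
      ∑ j, ∫ x, b.coord j (c x) * fderiv ℝ f x (b j) ∂μ := fun {f} hf => by
    rw [← integral_finsetSum _ fun j _ => integrable_mul_fderiv hf (hbi j) (b j)]
    refine integral_congr_ae (Filter.Eventually.of_forall fun x => ?_)
    have e1 : fderiv ℝ f x (c x) = fderiv ℝ f x (∑ j, b.repr (c x) j • b j) := by rw [b.sum_repr]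
    exact e1.trans (by simp only [map_sum, map_smul, smul_eq_mul, Module.Basis.coord_apply])
  simp only [e (hu _), e hw]
  exact tendsto_finsetSum _ fun j _ => tendsto_integral_mul_fderiv hu hw huw (hbi j) (hbc j) (b j)

/-- Translated bumps are admissible, and their averages of `g` converge to `g` almost everywhere. -/
lemma ae_nonneg_of_integral_mul_nonneg {g : V → ℝ} (hg : LocallyIntegrable g μ)
    (h : ∀ φ : V → ℝ, ContDiff ℝ 1 φ → HasCompactSupport φ → (∀ x, 0 ≤ φ x) →
      0 ≤ ∫ x, g x * φ x ∂μ) : ∀ᵐ x ∂μ, 0 ≤ g x := by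
  filter_upwards [ae_tendsto_shrinkingBump_convolution hg] with x hx
  refine ge_of_tendsto' hx fun n => ?_
  rw [convolution_eq_swap]
  set ρ := shrinkingBump V n
  have hρ := h (fun y => ρ.normed μ (x - y))
    ((ρ.contDiff_normed).comp (contDiff_const.sub contDiff_id))
    (ρ.hasCompactSupport_normed.comp_homeomorph (Homeomorph.subLeft x))
    fun y => ρ.nonneg_normed _
  refine hρ.trans_eq (integral_congr_ae (Filter.Eventually.of_forall fun y => ?_))
  simp [mul_comm]

end Compactness

/-! ### Existence of a transport flow under the one-sided Lipschitz condition -/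

section Existence

variable {N : ℕ} {T : ℝ} {a : ℝ × Space N → Space N}

/-- Derivatives converge only weakly, but tested Jacobians converge under uniform convergence with a
common Lipschitz bound, so their sign passes to the limit. -/
lemma spaceJac_nonneg_of_approx {L : ℝ≥0} {X : ℕ → ℝ × Space N → Space N}
    {Y : ℝ × Space N → Space N} (hX : ∀ m, LipschitzWith L (X m)) (hY : LipschitzWith L Y)
    (hXY : ∀ m : ℕ, ∀ z ∈ Metric.closedBall (0 : ℝ × Space N) m,
      ‖X m z - Y z‖ ≤ 1 / ((m : ℝ) + 1))
    (hJ : ∀ m t x, 0 ≤ spaceJac (X m) t x) (t : ℝ) : ∀ᵐ x, 0 ≤ spaceJac Y t x := by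
  have hsl : ∀ {Z : ℝ × Space N → Space N}, LipschitzWith L Z → LipschitzWith L fun x => Z (t, x) :=
    fun hZ => LipschitzWith.of_dist_le_mul fun x y => (hZ.dist_le_mul _ _).trans_eq (by
      simp [Prod.dist_eq])
  obtain ⟨C, -, hC⟩ := exists_abs_det_le (Space N) L
  refine ae_nonneg_of_integral_mul_nonneg (locallyIntegrable_of_ae_norm_le (C := C)
    (measurable_jac _).aestronglyMeasurable (Filter.Eventually.of_forall fun x =>
      hC _ (norm_fderiv_le_of_lipschitz ℝ (hsl hY)))) fun φ hφ hc hφ0 => ?_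
  obtain ⟨R, -, hR⟩ := exists_tsupport_subset_ball hc
  obtain ⟨C', -, hC'⟩ :=
    exists_abs_integral_jac_mul_sub_le (hφ.locallyLipschitz (𝕂 := ℝ)) hc hR L
  have hlim : Filter.Tendsto (fun m : ℕ => -(C' * (1 / ((m : ℝ) + 1)))) Filter.atTop (𝓝 0) := by
    simpa using (tendsto_one_div_add_atTop_nhds_zero_nat.const_mul C').neg
  refine le_of_tendsto hlim ?_
  filter_upwards [(tendsto_natCast_atTop_atTop (R := ℝ)).eventually_ge_atTop (max |t| R)] with m hm
  have h1 := hC' (fun x => X m (t, x)) (fun x => Y (t, x)) (hsl (hX m)).locallyLipschitz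
    (hsl hY).locallyLipschitz (hsl (hX m)).lipschitzOnWith (hsl hY).lipschitzOnWith
    (1 / ((m : ℝ) + 1)) fun x hx => hXY m _ (mem_closedBall_zero_iff.2 (by
      rw [Prod.norm_mk, Real.norm_eq_abs]
      refine (max_le_max le_rfl ?_).trans hm
      exact (mem_ball_zero_iff.1 hx).le))
  have h2 : 0 ≤ ∫ x, jac (fun x => X m (t, x)) x * φ x :=
    integral_nonneg fun x => mul_nonneg (hJ m t x) (hφ0 x)
  have h3 := (abs_le.1 h1).2
  simp only [spaceJac]
  linarith

/-- Derivatives converge weakly and the fields a.e. The limit is tested along the fixed direction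
`(1, a)`: replacing `(1, b m)` by `(1, a)` costs at most `L ‖a - b m‖`, which tends to 0 in the
integral by dominated convergence. -/
theorem solvesTransport_of_approx (ha : MemLp a ⊤ (volume.restrict (openSlab N T))) {L : ℝ≥0}
    {M : ℝ} {X b : ℕ → ℝ × Space N → Space N} {Y : ℝ × Space N → Space N}
    (hX : ∀ m, LipschitzWith L (X m)) (hY : LipschitzWith L Y)
    (hXY : ∀ m : ℕ, ∀ z ∈ Metric.closedBall (0 : ℝ × Space N) m,
      ‖X m z - Y z‖ ≤ 1 / ((m : ℝ) + 1))
    (hb : ∀ m, Continuous (b m)) (hbM : ∀ m z, ‖b m z‖ ≤ M)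
    (hba : ∀ᵐ z ∂volume.restrict (openSlab N T),
      Filter.Tendsto (fun m => b m z) Filter.atTop (𝓝 (a z)))
    (hs : ∀ m : ℕ, ∀ᵐ z ∂volume.restrict (openSlab N T),
      ‖transportOp (b m) (X m) z‖ ≤ 1 / ((m : ℝ) + 1)) : SolvesTransport T a Y := by
  obtain ⟨Ma, hMa0, hMa⟩ := exists_ae_norm_le ha
  have hM0 : 0 ≤ M := (norm_nonneg _).trans (hbM 0 0)
  have hcoord : ∀ {Z : ℝ × Space N → Space N} (i : Fin N), LipschitzWith L Z →
      LipschitzWith L fun z => Z z i := fun i hZ => LipschitzWith.of_dist_le_mul fun z w => by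
    refine le_trans ?_ (hZ.dist_le_mul z w)
    rw [Real.dist_eq, dist_eq_norm]
    exact abs_coord_le (_ - _) i
  have hfcoord : ∀ {Z : ℝ × Space N → Space N} (i : Fin N) {z}, DifferentiableAt ℝ Z z → ∀ v,
      fderiv ℝ (fun z => Z z i) z v = fderiv ℝ Z z v i := fun {Z} i {z} hZ v => by
    have := ((EuclideanSpace.proj (𝕜 := ℝ) i).hasFDerivAt.comp z hZ.hasFDerivAt).fderiv
    exact congrArg (fun A => A v) this
  have key : ∀ i : Fin N, ∀ᵐ z, z ∈ openSlab N T → fderiv ℝ (fun z => Y z i) z (1, a z) = 0 := by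
    intro i
    have hma := aestronglyMeasurable_transportOp ha fun z => Y z i
    refine isOpen_openSlab.ae_eq_zero_of_integral_contDiff_smul_eq_zero ?_ fun φ hφ hc hφs => ?_
    · have h1 : LocallyIntegrable (fun z => fderiv ℝ (fun z => Y z i) z (1, a z))
          (volume.restrict (openSlab N T)) := by
        refine locallyIntegrable_of_ae_norm_le (C := L * max 1 Ma) hma ?_
        filter_upwards [hMa] with z hz
        refine (norm_transportOp_le (a := a) hz).trans ?_
        gcongr
        exact norm_fderiv_le_of_lipschitz ℝ (hcoord i hY)
      exact (locallyIntegrableOn_of_locallyIntegrable_restrict h1)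
    -- Nothing is assumed on `a` outside the slab. The indicator makes `c` integrable, yet does not
    -- change `φ • (1, a)`, since `φ` vanishes there.
    set c : ℝ × Space N → ℝ × Space N := (openSlab N T).indicator fun z => φ z • ((1 : ℝ), a z)
    have hφ0 : ∀ {z}, z ∉ openSlab N T → φ z = 0 := fun hz =>
      image_eq_zero_of_notMem_tsupport fun h => hz (hφs h)
    have hcz : ∀ z, c z = φ z • ((1 : ℝ), a z) := fun z => by
      by_cases hz : z ∈ openSlab N T
      · exact indicator_of_mem hz _
      · rw [hφ0 hz, zero_smul]; exact indicator_of_notMem hz _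
    have hcc : HasCompactSupport c :=
      hc.mono fun z hz h => hz (by rw [hcz, h, zero_smul])
    have hφi : Integrable φ := hφ.continuous.integrable_of_hasCompactSupport hc
    have hci : Integrable c := by
      rw [integrable_indicator_iff measurableSet_openSlab]
      have hm : AEStronglyMeasurable (fun z => ((1 : ℝ), a z)) (volume.restrict (openSlab N T)) :=
        aestronglyMeasurable_const.prodMk ha.1
      refine (hφi.norm.mul_const (max 1 Ma)).integrableOn.mono'
        (hφ.continuous.aestronglyMeasurable.smul hm) ?_
      filter_upwards [hMa] with z hz
      rw [norm_smul, Prod.norm_mk, norm_one]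
      gcongr
    have hlim := tendsto_integral_fderiv_apply (fun m => hcoord i (hX m)) (hcoord i hY)
      (fun m z hz => (abs_coord_le (X m z - Y z) i).trans (hXY m z hz)) hci hcc
    have hzero : Filter.Tendsto (fun m => ∫ z, fderiv ℝ (fun z => X m z i) z (c z)) Filter.atTop
        (𝓝 0) := by
      have hbd : Filter.Tendsto (fun m : ℕ => ∫ z in openSlab N T,
          |φ z| * (1 / ((m : ℝ) + 1) + L * ‖a z - b m z‖)) Filter.atTop (𝓝 0) := by
        have h0 : ∫ z in openSlab N T, (0 : ℝ) = 0 := integral_zero _ _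
        rw [← h0]
        refine tendsto_integral_of_dominated_convergence
          (fun z => |φ z| * (1 + L * (Ma + M))) (fun m => ?_)
          (hφi.abs.mul_const _).integrableOn (fun m => ?_) ?_
        · exact hφ.continuous.abs.aestronglyMeasurable.mul
            (aestronglyMeasurable_const.add ((ha.1.sub
              (hb m).aestronglyMeasurable).norm.const_mul _))
        · filter_upwards [hMa] with z hz
          rw [norm_mul, Real.norm_eq_abs, abs_abs, Real.norm_of_nonneg (by positivity)]
          have h1 : 1 / ((m : ℝ) + 1) ≤ 1 := by
            rw [div_le_one (by positivity)]; linarith [m.cast_nonneg (α := ℝ)]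
          have h2 : ‖a z - b m z‖ ≤ Ma + M := (norm_sub_le _ _).trans (add_le_add hz (hbM m z))
          gcongr
        · filter_upwards [hba] with z hz
          have h1 : Filter.Tendsto (fun m => ‖a z - b m z‖) Filter.atTop (𝓝 0) := by
            simpa using ((tendsto_const_nhds (x := a z)).sub hz).norm
          simpa using (tendsto_one_div_add_atTop_nhds_zero_nat.add (h1.const_mul (L : ℝ))).const_mul
            |φ z|
      refine squeeze_zero_norm (fun m => ?_) hbd
      have e : ∫ z, fderiv ℝ (fun z => X m z i) z (c z) =
          ∫ z in openSlab N T, fderiv ℝ (fun z => X m z i) z (c z) :=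
        (setIntegral_eq_integral_of_forall_compl_eq_zero fun z hz => by
          rw [hcz, hφ0 hz, zero_smul, map_zero]).symm
      rw [e]
      refine norm_integral_le_of_norm_le ?_ ?_
      · refine hφi.abs.integrableOn.mul_bdd (c := 1 / ((m : ℝ) + 1) + L * (Ma + M))
          (aestronglyMeasurable_const.add
            ((ha.1.sub (hb m).aestronglyMeasurable).norm.const_mul _)) ?_
        filter_upwards [hMa] with z hz
        rw [Real.norm_of_nonneg (by positivity)]
        gcongr
        exact (norm_sub_le _ _).trans (add_le_add hz (hbM m z))
      · filter_upwards [hs m, ae_restrict_of_ae (hX m).ae_differentiableAt] with z hz hd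
        rw [hcz, map_smul, norm_smul, Real.norm_eq_abs, hfcoord i hd]
        gcongr
        refine (abs_coord_le _ i).trans ?_
        have e2 : fderiv ℝ (X m) z (1, a z) =
            transportOp (b m) (X m) z + fderiv ℝ (X m) z (0, a z - b m z) := by
          rw [transportOp, ← map_add, Prod.mk_add_mk, add_zero, add_sub_cancel]
        rw [e2]
        refine (norm_add_le _ _).trans (add_le_add hz
          ((ContinuousLinearMap.le_opNorm _ _).trans ?_))
        rw [Prod.norm_mk, norm_zero, max_eq_right (norm_nonneg _)]
        gcongr
        exact norm_fderiv_le_of_lipschitz ℝ (hX m)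
    have h := tendsto_nhds_unique hlim hzero
    rw [← h]
    refine integral_congr_ae (Filter.Eventually.of_forall fun z => ?_)
    simp only [hcz, map_smul]
  have hall : ∀ᵐ z, ∀ i : Fin N, z ∈ openSlab N T → fderiv ℝ (fun z => Y z i) z (1, a z) = 0 :=
    ae_all_iff.2 key
  filter_upwards [ae_restrict_of_ae hall, ae_restrict_of_ae hY.ae_differentiableAt,
    ae_restrict_mem measurableSet_openSlab] with z hz hd hzs
  ext i
  have := hz i hzs
  rwa [hfcoord i hd] at this

/-- The approximate flows of the mollified fields share one Lipschitz constant, depending only on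
`A` and `M`, so they have a uniform limit on bounded sets along a subsequence. -/
theorem exists_isTransportFlow_of_OSLC (hT : 0 < T)
    (ha : MemLp a ⊤ (volume.restrict (openSlab N T))) (h : OSLC T a) :
    ∃ X, IsTransportFlow T a X := by
  obtain ⟨M, A, b, hbd, hbL, hbM, hbβ, hba⟩ := h.exists_smooth_fields hT.le ha
  set L := (Real.exp (A + 2) * (1 + M)).toNNReal
  have hex : ∀ n : ℕ, ∃ X : ℝ × Space N → Space N, LipschitzWith L X ∧
      (∀ x, X (T, x) = x) ∧ (∀ t x, 0 ≤ spaceJac X t x) ∧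
      ∀ᵐ z ∂volume.restrict (openSlab N T), ‖transportOp (b n) X z‖ ≤ 1 / ((n : ℝ) + 1) := by
    intro n
    obtain ⟨K, hK⟩ := hbL n
    obtain ⟨β, hβc, hβ0, hβA, hβ⟩ := hbβ n
    exact exists_approximate_flow hT hK (hbd n) (hbM n) hβ0 hβc hβ hβA (by positivity)
  choose X hXL hXT hXJ hXs using hex
  obtain ⟨Y, φ, hY, hφ, hXY⟩ := exists_subseq_lipschitzWith hXL fun z =>
    ⟨‖z.2‖ + L * ‖z - (T, z.2)‖, fun n => by
      have h1 := (hXL n).norm_sub_le z (T, z.2)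
      rw [hXT] at h1
      calc ‖X n z‖ = ‖z.2 + (X n z - z.2)‖ := by rw [add_sub_cancel]
        _ ≤ _ := (norm_add_le _ _).trans (by gcongr)⟩
  have hφt : Filter.Tendsto φ Filter.atTop Filter.atTop :=
    Filter.tendsto_atTop_mono hφ Filter.tendsto_id
  refine ⟨Y, ⟨L, hY.lipschitzOnWith⟩, ?_, fun x => ?_, ?_⟩
  · refine solvesTransport_of_approx ha (fun m => hXL (φ m)) hY hXY
      (fun m => (hbd (φ m)).continuous) (fun m => hbM (φ m)) ?_ fun m => ?_
    · filter_upwards [hba] with z hz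
      exact hz.comp hφt
    · filter_upwards [hXs (φ m)] with z hz
      refine hz.trans ?_
      have : (m : ℝ) ≤ φ m := by exact_mod_cast hφ m
      gcongr
  · have hev : ∀ᶠ m : ℕ in Filter.atTop, ‖x - Y (T, x)‖ ≤ 1 / ((m : ℝ) + 1) := by
      filter_upwards [(tendsto_natCast_atTop_atTop (R := ℝ)).eventually_ge_atTop
        ‖((T, x) : ℝ × Space N)‖] with m hm
      have := hXY m (T, x) (mem_closedBall_zero_iff.2 hm)
      rwa [hXT] at this
    have h0 := ge_of_tendsto tendsto_one_div_add_atTop_nhds_zero_nat hev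
    exact (sub_eq_zero.1 (norm_le_zero_iff.1 h0)).symm
  · exact ae_openSlab_of_forall_slice (measurableSet_le measurable_const
      (measurable_spaceJac hY.continuous)).nullMeasurableSet fun t _ =>
      spaceJac_nonneg_of_approx (fun m => hXL (φ m)) hY hXY (fun m => hXJ (φ m)) t

end Existence

end Transport

end

/-! ### The two equivalences -/

theorem mainTheorem9 (N : ℕ) (hN : 1 ≤ N) (T : ℝ) (hT : 0 < T)
    (a : ℝ × Transport.Space N → Transport.Space N)
    (ha : MemLp a ∞ (volume.restrict (Transport.openSlab N T)))
    (hflow : Transport.OSLC T a ∨ ∃ X, Transport.IsTransportFlow T a X) :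
    (∀ π ∈ Transport.weakSolutions T a, Transport.IsJacobianCombination (π T) →
      (π ∈ Transport.reversibleSolutions T a ↔
        π ∈ Submodule.span ℝ (Transport.jacobianSolutions T a) ∧
          π ∈ Transport.vanishingSolutions T a)) ∧
    (∀ π ∈ Submodule.span ℝ (Transport.jacobianSolutions T a),
      (π ∈ Transport.reversibleSolutions T a ↔
        (fun t x => |π t x|) ∈ Transport.weakSolutions T a)) := by
  obtain ⟨X, hX⟩ : ∃ X, Transport.IsTransportFlow T a X :=
    hflow.elim (fun h => Transport.exists_isTransportFlow_of_OSLC hT ha h) id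
  refine ⟨fun π hπ hJ => ⟨fun hr => ?_, fun h => ?_⟩, fun π hπ => ⟨?_, ?_⟩⟩
  · exact ⟨Transport.mem_span_of_mem_reversibleSolutions hN hT ha hr hJ,
      Transport.mem_vanishingSolutions_of_mem_reversibleSolutions hT ha hr⟩
  · exact Transport.mem_reversibleSolutions_of_mem_span hT ha hX h.1 (ae_restrict_of_ae h.2.2)
  · exact Transport.abs_mem_weakSolutions hT ha hπ
  · exact Transport.mem_reversibleSolutions_of_abs hT ha hX hπ
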